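/- Let $\Bbbk$ be a field of characteristic zero and let $\mathfrak g=\bigoplus_{i\in\mathbb Z}\mathfrak g_i$ be a complete differential graded Lie algebra over $\Bbbk$ (homological grading, differential $d$ of degree $-1$): it carries a descending filtration $\mathfrak g=F_0\supseteq F_1\supseteq F_2\supseteq\cdots$ by graded subspaces with $d(F_p)\subseteq F_p$ and $[F_p,F_q]\subseteq F_{p+q}$, for which every component $\mathfrak g_i$ is separated and complete. A Maurer--Cartan element is an $\alpha\in\mathfrak g_{-1}\cap F_1$ with $d\alpha+\frac12[\alpha,\alpha]=0$ (if $F_1=\mathfrak g$, the condition $\alpha\in F_1$ is empty). All infinite sums are taken in the topology defined by the filtration. Let $s\mathfrak g$ be the suspension of $\mathfrak g$ (degrees raised by one), with differential $d_{s\mathfrak g}(sx)=-s(dx)$. Let $\mathfrak b=\prod_{n\ge2}\mathrm{End}_{s\mathfrak g}(n)^{S_n}$, whose elements of degree $r$ are the families $(f_n)_{n\ge 2}$ of multilinear maps $f_n\colon (s\mathfrak g)^{n}\to s\mathfrak g$ that are homogeneous of degree $r$, graded symmetric, and compatible with the filtration, $f_n(sF_{p_1},\dots,sF_{p_n})\subseteq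 sF_{p_1+\cdots+p_n}$. Let $\star$ be the pre-Lie product $$(f\star g)_n(x_1,\dots,x_n)=\sum_{S\subseteq\{1,\dots,n\}}\pm f_{n-|S|+1}\big(g_{|S|}(x_S),x_{S^c}\big)$$ with Koszul signs, where $x_S$ lists the $x_i$ with $i\in S$ in increasing order; put $r_g(h)=h\star g$, and let $[f,g]=f\star g-(-1)^{|f||g|}g\star f$. Let $\phi\in\mathfrak b$ be the element of arity two that encodes the bracket, $\phi(sx,sy)=(-1)^{|x|}s[x,y]$, and let $\partial^\phi(f)=\partial f+[\phi,f]$, where $\partial f=[d_{s\mathfrak g},f]$ is the differential induced by $d_{s\mathfrak g}$. Let $f\in\mathfrak b$ be of degree one, let $\lambda=\partial^\phi(f)$ (a homologically trivial cycle of degree zero), and let $\alpha$ be a Maurer--Cartan element of $\mathfrak g$. Put $e^\lambda=1+\sum_{i\ge1}\frac1{i!}r_\lambda^{i-1}(\lambda)$, define $\lambda.\alpha\in\mathfrak g_{-1}$ by $$s(\lambda.\alpha)=\sum_{n\ge1}\frac1{n!}(e^\lambda)_n(s\alpha,\dots,s\alpha),$$ and define $f_i\in\mathfrak g_0$, for $i\ge1$,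 by $$s f_i=\frac1{(i-1)!}\sum_{n\ge 2}\frac1{n!}\big(r_\lambda^{i-1}(f)\big)_n(s\alpha,\dots,s\alpha).$$ For $n\ge1$ let $$G_n(i_1,\dots,i_n)=\frac1n\sum_{\substack{\rho\in S_n\\ \rho(1)=1}}\frac{(-1)^{\mathsf d(\rho^{-1})}}{\binom{n-1}{\mathsf d(\rho^{-1})}}\prod_{j=1}^n\frac1{i_{\rho(1)}+\cdots+i_{\rho(j)}},$$ where $\mathsf d(\sigma)$ is the number of $j$ with $1\le j<n$ and $\sigma(j)>\sigma(j+1)$. Let $\overline{\mathfrak g}=\mathfrak g\oplus\Bbbk\delta$ be the graded Lie algebra that extends $\mathfrak g$ by an element $\delta$ of degree $-1$ with $[\delta,\delta]=0$ and $[\delta,x]=dx$ for $x\in\mathfrak g$. Then the series that define $\lambda.\alpha$ and the $f_i$ converge, $\lambda.\alpha$ is again a Maurer--Cartan element, the series $$\xi=\sum_{n\ge1}\ \sum_{i_1,\dots,i_n\ge1}G_n(i_1,\dots,i_n)\,\mathrm{ad}_{f_{i_n}}\mathrm{ad}_{f_{i_{n-1}}}\cdots\mathrm{ad}_{f_{i_2}}(f_{i_1})$$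 converges to an element of $\mathfrak g_0\cap F_1$, and in $\overline{\mathfrak g}$ the exponential series converges with $$\exp(\mathrm{ad}_\xi)(\delta+\alpha)=\delta+\lambda.\alpha .$$ In particular, the ambient action of $\lambda$ on Maurer--Cartan elements is gauge trivial. -/

import Mathlib

open scoped Nat

noncomputable section

namespace AmbientGauge

/-! ### Signs, parity, convergence -/

/-- `(-1)^c` for a parity `c`. -/
def sgn (k : Type*) [Field k] (c : ZMod 2) : k := if c = 0 then 1 else -1

section Graded

variable {k : Type*} [Field k] {𝔤 : Type*} [AddCommGroup 𝔤] [Module k 𝔤]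
  (gr : ℤ → Submodule k 𝔤) [DirectSum.Decomposition gr]

/-- The projection of a graded vector space `𝔤 = ⨁ gr i` onto the sum of the components whose
degree has parity `c`. -/
def parityProj (c : ZMod 2) : 𝔤 →ₗ[k] 𝔤 :=
  (DirectSum.toModule k ℤ 𝔤 fun i => if (i : ZMod 2) = c then (gr i).subtype else 0) ∘ₗ
    (DirectSum.decomposeLinearEquiv gr).toLinearMap

/-- The operator `x ↦ (-1)^{|x|} x`. -/
def parityInv : 𝔤 →ₗ[k] 𝔤 := parityProj gr 0 - parityProj gr 1

end Graded

/-- The family `u` is (unconditionally) summable with sum `a` for the topology defined by the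
decreasing family of subspaces `F`. -/
def HasFSum {k V ι : Type*} [Field k] [AddCommGroup V] [Module k V]
    (F : ℕ → Submodule k V) (u : ι → V) (a : V) : Prop :=
  ∀ p : ℕ, ∀ᶠ s : Finset ι in Filter.atTop, a - ∑ i ∈ s, u i ∈ F p

open Classical in
/-- The sum of the family `u` for the topology defined by `F` (`0` if the family is not
summable). -/
def fsum {k V ι : Type*} [Field k] [AddCommGroup V] [Module k V]
    (F : ℕ → Submodule k V) (u : ι → V) : V :=
  if h : ∃ a, HasFSum F u a then h.choose else 0

/-! ### Complete differential graded Lie algebras -/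

/-- A complete dg Lie algebra structure on the graded vector space `𝔤 = ⨁ gr i` (homological
grading, differential of degree `-1`): a graded Lie bracket, a differential which is a
derivation, and a descending filtration `𝔤 = F 0 ⊇ F 1 ⊇ ⋯` by graded subspaces, compatible with
the bracket and the differential, for which every component `gr i` is separated and complete. -/
structure CompleteDGLie (k : Type*) [Field k] {𝔤 : Type*} [AddCommGroup 𝔤] [Module k 𝔤]
    (gr : ℤ → Submodule k 𝔤) where
  bracket : 𝔤 →ₗ[k] 𝔤 →ₗ[k] 𝔤
  d : 𝔤 →ₗ[k] 𝔤
  F : ℕ → Submodule k 𝔤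
  bracket_mem : ∀ {i j : ℤ} {x y : 𝔤}, x ∈ gr i → y ∈ gr j → bracket x y ∈ gr (i + j)
  antisymm : ∀ {i j : ℤ} {x y : 𝔤}, x ∈ gr i → y ∈ gr j →
    bracket x y = -(sgn k ((i : ZMod 2) * j) • bracket y x)
  jacobi : ∀ {i j : ℤ} {x y : 𝔤} (z : 𝔤), x ∈ gr i → y ∈ gr j →
    bracket x (bracket y z) =
      bracket (bracket x y) z + sgn k ((i : ZMod 2) * j) • bracket y (bracket x z)
  d_mem : ∀ {i : ℤ} {x : 𝔤}, x ∈ gr i → d x ∈ gr (i - 1)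
  d_d : ∀ x : 𝔤, d (d x) = 0
  leibniz : ∀ {i : ℤ} {x : 𝔤} (y : 𝔤), x ∈ gr i →
    d (bracket x y) = bracket (d x) y + sgn k (i : ZMod 2) • bracket x (d y)
  F_zero : F 0 = ⊤
  F_antitone : Antitone F
  F_graded : ∀ p : ℕ, F p = ⨆ i : ℤ, F p ⊓ gr i
  bracket_F : ∀ {p q : ℕ} {x y : 𝔤}, x ∈ F p → y ∈ F q → bracket x y ∈ F (p + q)
  d_F : ∀ {p : ℕ} {x : 𝔤}, x ∈ F p → d x ∈ F p
  separated : ∀ x : 𝔤, (∀ p : ℕ, x ∈ F p) → x = 0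
  complete : ∀ (i : ℤ) (x : ℕ → 𝔤), (∀ n, x n ∈ gr i) → (∀ n, x (n + 1) - x n ∈ F n) →
    ∃ y ∈ gr i, ∀ n, y - x n ∈ F n

/-! ### The pre-Lie algebra of symmetric multilinear maps on the suspension -/

/-- Families `(f_n)_{n ≥ 0}` of multilinear maps. We use them as elements of
`∏_n End_{s𝔤}(n)`: the suspension `s𝔤` is `𝔤` itself, where an element of `gr i` is given the
degree `i + 1`, and `s` is the identity map. -/
abbrev Cochain (k : Type*) [Field k] (𝔤 : Type*) [AddCommGroup 𝔤] [Module k 𝔤] :=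
  ∀ n : ℕ, MultilinearMap k (fun _ : Fin n => 𝔤) 𝔤

section PreLie

variable {k : Type*} [Field k] {𝔤 : Type*} [AddCommGroup 𝔤] [Module k 𝔤]
  (gr : ℤ → Submodule k 𝔤) [DirectSum.Decomposition gr]

/-- The multilinear map `(x_1, …, x_n) ↦ f (g (x_S), x_{Sᶜ})`, where `x_S` and `x_{Sᶜ}` list the
arguments with index in `S` and in its complement in increasing order. -/
def insertAt (f g : Cochain k 𝔤) {n : ℕ} (S : Finset (Fin n)) :
    MultilinearMap k (fun _ : Fin n => 𝔤) 𝔤 :=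
  (MultilinearMap.curryFinFinset k 𝔤 𝔤 (s := S) rfl rfl).symm
    ((f (Sᶜ.card + 1)).curryLeft.compMultilinearMap (g S.card))

/-- The Koszul sign of `x_1 ⊗ ⋯ ⊗ x_n ↦ x_S ⊗ x_{Sᶜ}` when `x_i` has degree of parity `e i`. -/
def shuffleSign (k : Type*) [Field k] {n : ℕ} (e : Fin n → ZMod 2) (S : Finset (Fin n)) : k :=
  sgn k (∑ p : Fin n × Fin n with p.1 < p.2 ∧ p.1 ∉ S ∧ p.2 ∈ S, e p.1 * e p.2)

/-- The pre-Lie product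
`(f ⋆ g)(x_1, …, x_n) = ∑_{S ⊆ {1, …, n}} ± f (g (x_S), x_{Sᶜ})`, with Koszul signs for the
degrees in `s𝔤`. It is written for arbitrary arguments by decomposing each of them into the parts
of even and of odd degree in `s𝔤`. -/
def preLieMul (f g : Cochain k 𝔤) : Cochain k 𝔤 := fun n =>
  ∑ S : Finset (Fin n), ∑ e : Fin n → ZMod 2,
    shuffleSign k e S • (insertAt f g S).compLinearMap fun i => parityProj gr (e i - 1)

/-- The graded commutator `f ⋆ g - (-1)^{|f||g|} g ⋆ f` of elements of degrees `p` and `q`. -/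
def comm (p q : ℤ) (f g : Cochain k 𝔤) : Cochain k 𝔤 :=
  preLieMul gr f g - sgn k ((p : ZMod 2) * q) • preLieMul gr g f

/-- `r_g^m (f) = (⋯((f ⋆ g) ⋆ g) ⋯) ⋆ g`, with `m` factors `g`. -/
def rightMul (g : Cochain k 𝔤) (m : ℕ) (f : Cochain k 𝔤) : Cochain k 𝔤 :=
  (fun h => preLieMul gr h g)^[m] f

/-- A linear map, regarded as an element of arity one. -/
def ofLinear (T : 𝔤 →ₗ[k] 𝔤) : Cochain k 𝔤
  | 1 => MultilinearMap.ofSubsingletonₗ k k 𝔤 𝔤 (0 : Fin 1) T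
  | _ => 0

/-- A bilinear map, regarded as an element of arity two. -/
def ofBilinear (B : 𝔤 →ₗ[k] 𝔤 →ₗ[k] 𝔤) : Cochain k 𝔤
  | 2 => LinearMap.uncurryLeft
      ((MultilinearMap.ofSubsingletonₗ k k 𝔤 𝔤 (0 : Fin 1)).toLinearMap ∘ₗ B)
  | _ => 0

/-- The pre-Lie exponential `e^l = 1 + ∑_{i ≥ 1} r_l^{i-1}(l) / i!` of an element `l` with
components in arities at least two. For such `l` the element `r_l^{i-1}(l)` has components only in
arities at least `i + 1`, so that in arity `n` only the terms with `i < n` contribute. -/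
def preLieExp (l : Cochain k 𝔤) : Cochain k 𝔤 := fun n =>
  ofLinear LinearMap.id n + ∑ i ∈ Finset.Ico 1 n, (i ! : k)⁻¹ • rightMul gr l (i - 1) l n

end PreLie

namespace CompleteDGLie

variable {k : Type*} [Field k] {𝔤 : Type*} [AddCommGroup 𝔤] [Module k 𝔤]
  {gr : ℤ → Submodule k 𝔤} (L : CompleteDGLie k gr)

/-- `f` is an element of degree `r` of `𝔟 = ∏_{n ≥ 2} End_{s𝔤}(n)^{S_n}`, where `End_{s𝔤}` is formed
in complete (filtered) graded vector spaces: its components are homogeneous of degree `r` on `s𝔤`,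
symmetric with Koszul signs on `s𝔤`, and compatible with the filtration. -/
structure IsCochain (r : ℤ) (f : Cochain k 𝔤) : Prop where
  arity_zero : f 0 = 0
  arity_one : f 1 = 0
  degree : ∀ {n : ℕ} {a : Fin n → ℤ} {x : Fin n → 𝔤}, (∀ i, x i ∈ gr (a i - 1)) →
    f n x ∈ gr (∑ i, a i + r - 1)
  symmetric : ∀ {n : ℕ} {a : Fin n → ℤ} {x : Fin n → 𝔤}, (∀ i, x i ∈ gr (a i - 1)) →
    ∀ σ : Equiv.Perm (Fin n), f n (fun i => x (σ i)) =
      sgn k (∑ p : Fin n × Fin n with p.1 < p.2 ∧ σ p.2 < σ p.1,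
        (a (σ p.1) : ZMod 2) * a (σ p.2)) • f n x
  filtered : ∀ {n : ℕ} {p : Fin n → ℕ} {x : Fin n → 𝔤}, (∀ i, x i ∈ L.F (p i)) →
    f n x ∈ L.F (∑ i, p i)

/-- Maurer--Cartan elements: `α` of degree `-1` and positive filtration with
`dα + ½[α, α] = 0`. -/
def IsMaurerCartan (α : 𝔤) : Prop :=
  α ∈ gr (-1) ∧ α ∈ L.F 1 ∧ L.d α + (2 : k)⁻¹ • L.bracket α α = 0

/-- The element `∑_n a_n(α, …, α) / n!` of (the desuspension of) `s𝔤`, that is, the arity zero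
part of `a ⊚ (1 + sα)`. -/
def evalExp (a : Cochain k 𝔤) (α : 𝔤) : 𝔤 :=
  fsum L.F fun n : ℕ => (n ! : k)⁻¹ • a n fun _ => α

/-- The iterated bracket `ad_{y_n} ⋯ ad_{y_1} (y_0)`. -/
def nestedAd : (n : ℕ) → (Fin (n + 1) → 𝔤) → 𝔤
  | 0, y => y 0
  | n + 1, y => L.bracket (y (Fin.last (n + 1))) (nestedAd n fun j => y j.castSucc)

variable [DirectSum.Decomposition gr]

/-- The element `φ` of `End_{s𝔤}(2)` that encodes the Lie bracket,
`φ(sx, sy) = (-1)^{|x|} s[x, y]`. -/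
def phi : Cochain k 𝔤 := ofBilinear (L.bracket ∘ₗ parityInv gr)

/-- The twisted differential `∂^φ(f) = ∂f + [φ, f]` on elements `f` of degree `p`, where
`∂f = [d_{s𝔤}, f]` is induced by the differential `d_{s𝔤}(sx) = -s(dx)` of `s𝔤`. -/
def twistedDiff (p : ℤ) (f : Cochain k 𝔤) : Cochain k 𝔤 :=
  comm gr (-1) p (ofLinear (-L.d)) f + comm gr (-1) p L.phi f

/-- The ambient action `l.α = ∑_{n ≥ 1} (e^l)_n(α, …, α) / n!`. -/
def ambient (l : Cochain k 𝔤) (α : 𝔤) : 𝔤 := L.evalExp (preLieExp gr l) α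

/-- The cochain `r_l^{i-1}(f) / (i-1)!`. -/
def weightCochain (l f : Cochain k 𝔤) (i : ℕ+) : Cochain k 𝔤 :=
  (((i : ℕ) - 1)! : k)⁻¹ • rightMul gr l ((i : ℕ) - 1) f

/-- The weight component `f_i = ∑_n (r_l^{i-1}(f))_n(α, …, α) / (n! (i-1)!)`. -/
def weightComp (l f : Cochain k 𝔤) (α : 𝔤) (i : ℕ+) : 𝔤 :=
  L.evalExp (weightCochain (gr := gr) l f i) α

/-- The graded Lie bracket of the extension `𝔤 ⊕ k δ`, where `δ = (0, 1)` has degree `-1`,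
`[δ, δ] = 0` and `[δ, x] = dx` (so that `[x, δ] = -(-1)^{|x|} dx`). -/
def extBracket : (𝔤 × k) →ₗ[k] (𝔤 × k) →ₗ[k] (𝔤 × k) :=
  LinearMap.mk₂ k
    (fun u v => (L.bracket u.1 v.1 + u.2 • L.d v.1 - v.2 • L.d (parityInv gr u.1), 0))
    (by intro u u' v; ext <;> simp; module)
    (by intro c u v; ext <;> simp; module)
    (by intro u v v'; ext <;> simp; module)
    (by intro c u v; ext <;> simp; module)

/-- The filtration of `𝔤 ⊕ k δ` that defines the product of the topology of `𝔤` and the discrete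
topology of `k δ`. -/
def extF (p : ℕ) : Submodule k (𝔤 × k) := (L.F p).prod ⊥

end CompleteDGLie

/-! ### The coefficients -/

/-- The number of descents of a permutation of `{0, …, n}`. -/
def descents {n : ℕ} (ρ : Equiv.Perm (Fin (n + 1))) : ℕ :=
  (Finset.univ.filter fun i : Fin n => ρ i.succ < ρ i.castSucc).card

/-- The coefficient `G_{n+1}(x_0, …, x_n)`, with indices shifted to start from `0`:
`1/(n+1) ∑_{ρ(0) = 0} (-1)^{d(ρ⁻¹)} / C(n, d(ρ⁻¹)) ∏_j 1 / (x_{ρ(0)} + ⋯ + x_{ρ(j)})`. -/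
def coeffG (k : Type*) [Field k] (n : ℕ) (x : Fin (n + 1) → k) : k :=
  ((n : k) + 1)⁻¹ * ∑ ρ : Equiv.Perm (Fin (n + 1)) with ρ 0 = 0,
    ((-1) ^ descents ρ⁻¹ / (n.choose (descents ρ⁻¹) : k)) *
      ∏ j : Fin (n + 1), (∑ l ∈ Finset.Iic j, x (ρ l))⁻¹

namespace CompleteDGLie

variable {k : Type*} [Field k] {𝔤 : Type*} [AddCommGroup 𝔤] [Module k 𝔤]
  {gr : ℤ → Submodule k 𝔤} (L : CompleteDGLie k gr)

/-- The term `G_n(i_1, …, i_n) ad_{f_{i_n}} ⋯ ad_{f_{i_2}} (f_{i_1})` of the series for `ξ`, for the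
index `t = ⟨n - 1, (i_1, …, i_n)⟩`, where `fc i = f_i`. -/
def gaugeTerm (fc : ℕ+ → 𝔤) (t : Σ n : ℕ, Fin (n + 1) → ℕ+) : 𝔤 :=
  coeffG k t.1 (fun j => ((t.2 j : ℕ) : k)) • L.nestedAd t.1 fun j => fc (t.2 j)

/-- The element
`ξ = ∑_{n ≥ 1} ∑_{i_1, …, i_n ≥ 1} G_n(i_1, …, i_n) ad_{f_{i_n}} ⋯ ad_{f_{i_2}} (f_{i_1})`. -/
def gaugeElement (fc : ℕ+ → 𝔤) : 𝔤 := fsum L.F (L.gaugeTerm fc)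

end CompleteDGLie

end AmbientGauge

end

/-!
# Ambient gauge triviality

Elements of degree `-1` of `𝔤` have even suspension, so on tuples of such elements a cochain is
symmetric in the ungraded sense and defines a formal vector field `x ↦ h(x) = ∑ h_n(x, …, x) / n!`.
The pre-Lie product becomes the directional derivative, `(h ⋆ e)(x) = h'(x; e(x))`
(`coeffExt_preLieMul`).

**The flow.** Put `b(s) = ∑ b_m s^m` with `b_0 = α` and `b_{c+1} = (r_λ^c λ)(α) / (c + 1)!`. Then
`b` is an integral curve of the vector field `λ`, evaluation of a cochain `h` at `b(s)` is
evaluation of `exp(s r_λ) h` at `α` (`truncExt_flow`), and `λ.α = b(1)` (`ambient_smodEq`). In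
particular `f(b(s)) = ∑ f_{a+1} s^a =: g(s)`. For `λ = ∂^φ f` the equation `b' = λ(b)` reads
`b' = [g, δ + b] - f'(b; R)`, where `R = d b + ½ [b, b]` is the curvature of `b`
(`smul_flow_eq_sub`). The Bianchi identity `bracket_curvature` turns this into a linear differential
equation for `R`; since `R(0) = 0`, the curvature vanishes (`curvature_flow`). So `λ.α` is a
Maurer--Cartan element and `b' = [g, δ + b]` (`smul_flowSeq`).

**The Magnus expansion.** On the quotient of `𝔤 ⊕ k δ` by `F N` the operators `ad g(s)` generate a
nilpotent algebra. The time-ordered exponential `V(s)` of `ad g` from `s` to `1` maps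
`δ + b(s)` to `δ + b(1)` (`timeOrdered_smul_eq_sum`). With `w = Ad V - 1` one has
`log V(0) = ∫₀¹ ((1 + w) log (1 + w) / w) g` (`logSum_timeOrdered`): the derivative of a power of
`V - 1` is a sum of products with `V g` in the middle, and the operators of left and right
multiplication commute, so that a divided difference of the logarithm arises
(`logQuot_mul_eq_sum`). Since `Ad V` is a series of iterated commutators with iterated integrals as
coefficients (`conjSeries_mul`), so is `log V(0)`, and the coefficients are those of
`(1 + w) log (1 + w) / w` in the generating series `w` of iterated integrals.

**The coefficients.** They are the numbers `G_n` (`coeffG_eq_unitIntegral`). The descent weight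
`(-1)^d / (n choose d) / (n + 1)` in `G_{n+1}` is the Beta integral of `(1 - u)^(n - d) (-u)^d`, and
the products of inverses of partial sums are integrals over simplices, so that `G_{n+1}` is an
integral over a cube in which neighbouring variables carry a weight `1 - u` or `-u`, according to
their order. For fixed `u` this integral satisfies a Riccati equation in the lower limit of
integration. The Riccati equation is linearized by the iterated integrals, and its solution is a
geometric series in `-u` over the decompositions of the word into pieces (`cubeInt_Ico`).

**Convergence.** Since `f` has arities at least two and `α ∈ F 1`, the element `f_i` is in
`F (i + 1)` and `b_m` in `F (m + 1)`. Hence all series are finite modulo `F N`, and the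
identities above are identities modulo `F N` for all `N`.
-/

open scoped Nat

open Polynomial Finset

noncomputable section

namespace AmbientGauge

/-! ### Formal integration of polynomials -/

section Integral

variable {k : Type*} [Field k] {A : Type*} [Ring A] [Algebra k A]

/-- The formal integral `∫₀¹ p` of a polynomial `p` with coefficients in a `k`-algebra. -/
def unitIntegral (k : Type*) [Field k] {A : Type*} [Ring A] [Algebra k A] : A[X] →ₗ[k] A :=
  Polynomial.lsum fun n => ((n : k) + 1)⁻¹ • LinearMap.id

theorem unitIntegral_monomial (n : ℕ) (a : A) :
    unitIntegral k (monomial n a) = ((n : k) + 1)⁻¹ • a := by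
  simp [unitIntegral, Polynomial.lsum_apply, Polynomial.sum_monomial_index]

theorem unitIntegral_mul_C (p : k[X]) (c : k) :
    unitIntegral k (p * C c) = unitIntegral k p * c := by
  rw [mul_comm, ← smul_eq_C_mul, map_smul, smul_eq_mul, mul_comm]

theorem unitIntegral_derivative [CharZero k] (p : A[X]) :
    unitIntegral k (derivative p) = p.eval 1 - p.eval 0 := by
  induction p using Polynomial.induction_on' with
  | add p q hp hq => simp only [map_add, hp, hq, eval_add]; abel
  | monomial n a =>
    rw [derivative_monomial, unitIntegral_monomial, eval_monomial, eval_monomial]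
    cases n with
    | zero => simp
    | succ n =>
      have h : ((n : k) + 1) ≠ 0 := by exact_mod_cast n.succ_ne_zero
      have e : a * ((n + 1 : ℕ) : A) = ((n : k) + 1) • a := by
        rw [← Nat.cast_comm, ← nsmul_eq_mul, ← Nat.cast_smul_eq_nsmul k]; push_cast; rfl
      rw [e]
      simp [smul_smul, inv_mul_cancel₀ h]

/-- The polynomial `s ↦ ∫_s^1 p`. -/
def tailIntegral (k : Type*) [Field k] : k[X] →ₗ[k] k[X] :=
  Polynomial.lsum fun n => LinearMap.toSpanSingleton k k[X] (C ((n : k) + 1)⁻¹ * (1 - X ^ (n + 1)))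

theorem tailIntegral_monomial (n : ℕ) (a : k) :
    tailIntegral k (monomial n a) = a • (C ((n : k) + 1)⁻¹ * (1 - X ^ (n + 1))) := by
  simp [tailIntegral, Polynomial.lsum_apply, Polynomial.sum_monomial_index]

theorem derivative_tailIntegral [CharZero k] (p : k[X]) :
    derivative (tailIntegral k p) = -p := by
  induction p using Polynomial.induction_on' with
  | add p q hp hq => simp only [map_add, hp, hq]; abel
  | monomial n a =>
    have h : ((n : k) + 1) ≠ 0 := by exact_mod_cast n.succ_ne_zero
    rw [tailIntegral_monomial, derivative_smul, derivative_C_mul]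
    simp only [derivative_sub, derivative_one, derivative_X_pow, zero_sub, Nat.add_sub_cancel]
    rw [← C_mul_X_pow_eq_monomial, smul_eq_C_mul]
    have : C ((n : k) + 1)⁻¹ * C ((n + 1 : ℕ) : k) = 1 := by
      rw [← C_mul]; push_cast; rw [inv_mul_cancel₀ h, C_1]
    linear_combination (-C a * X ^ n) * this

theorem eval_one_tailIntegral (p : k[X]) : (tailIntegral k p).eval 1 = 0 := by
  induction p using Polynomial.induction_on' with
  | add p q hp hq => simp only [map_add, hp, hq, eval_add, add_zero]
  | monomial n a => rw [tailIntegral_monomial]; simp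

theorem eq_of_derivative_eq [CharZero k] {p q : k[X]} (h : derivative p = derivative q)
    (h1 : p.eval 1 = q.eval 1) : p = q := by
  have hd : derivative (p - q) = 0 := by simp [h]
  have := eq_C_of_natDegree_eq_zero (derivative_eq_zero.mp hd)
  have h2 : (p - q).eval 1 = 0 := by simp [h1]
  rw [this, eval_C] at h2
  rw [h2, C_0] at this
  exact sub_eq_zero.mp this

/-- The Beta integral. -/
theorem unitIntegral_beta [CharZero k] (a d : ℕ) :
    unitIntegral k ((1 - X) ^ a * X ^ d : k[X]) =
      (((a + d : ℕ) : k) + 1)⁻¹ * ((a + d).choose d : k)⁻¹ := by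
  induction a generalizing d with
  | zero =>
    have : (X ^ d : k[X]) = monomial d 1 := (monomial_one_right_eq_X_pow d).symm
    simp [this, unitIntegral_monomial]
  | succ a ih =>
    have h := unitIntegral_derivative (k := k) ((1 - X) ^ (a + 1) * X ^ (d + 1) : k[X])
    have e : derivative ((1 - X) ^ (a + 1) * X ^ (d + 1) : k[X]) =
        ((d : k) + 1) • ((1 - X) ^ (a + 1) * X ^ d) -
          ((a : k) + 1) • ((1 - X) ^ a * X ^ (d + 1)) := by
      rw [derivative_mul, derivative_pow, derivative_X_pow]
      simp only [derivative_sub, derivative_one, derivative_X, smul_eq_C_mul]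
      push_cast
      simp only [C_add, C_1]
      ring
    rw [e, map_sub, map_smul, map_smul, ih (d + 1)] at h
    have hd : ((d : k) + 1) ≠ 0 := by exact_mod_cast d.succ_ne_zero
    have ha : ((a : k) + 1) ≠ 0 := by exact_mod_cast a.succ_ne_zero
    have hc : ((a + 1 + d).choose d : k) ≠ 0 := by
      exact_mod_cast (Nat.choose_pos (by omega)).ne'
    have hc' : ((a + 1 + d).choose (d + 1) : k) ≠ 0 := by
      exact_mod_cast (Nat.choose_pos (by omega)).ne'
    have hcc : ((a + 1 + d).choose (d + 1) : k) * ((d : k) + 1) =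
        ((a + 1 + d).choose d : k) * ((a : k) + 1) := by
      have := Nat.choose_succ_right_eq (a + 1 + d) d
      rw [show a + 1 + d - d = a + 1 by omega] at this
      exact_mod_cast this
    rw [show a + (d + 1) = a + 1 + d by omega] at h
    simp only [smul_eq_mul, eval_mul, eval_pow, eval_sub, eval_one, eval_X, sub_self,
      ne_eq, Nat.add_eq_zero_iff, one_ne_zero, and_false, not_false_eq_true, zero_pow, zero_mul,
      mul_zero] at h
    have h' : unitIntegral k ((1 - X) ^ (a + 1) * X ^ d : k[X]) = ((a : k) + 1) *
        ((((a + 1 + d : ℕ) : k) + 1)⁻¹ * ((a + 1 + d).choose (d + 1) : k)⁻¹) / ((d : k) + 1) := by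
      rw [eq_div_iff hd]; linear_combination h
    have hD : (((a + 1 + d : ℕ) : k) + 1) ≠ 0 := by exact_mod_cast (a + 1 + d).succ_ne_zero
    rw [h', div_eq_iff hd]
    field_simp
    linear_combination -hcc

/-- The iterated integral `∫_{s < t_1 < ⋯ < t_n < 1} t_1^{a_1} ⋯ t_n^{a_n}`, as a polynomial
in `s`, for the list `[a_1, …, a_n]`. -/
def iterInt (k : Type*) [Field k] : List ℕ → k[X]
  | [] => 1
  | a :: w => tailIntegral k (X ^ a * iterInt k w)

theorem derivative_iterInt_cons [CharZero k] (a : ℕ) (w : List ℕ) :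
    derivative (iterInt k (a :: w)) = -(X ^ a * iterInt k w) := derivative_tailIntegral _

theorem eval_one_iterInt {w : List ℕ} (hw : w ≠ []) : (iterInt k w).eval 1 = 0 := by
  cases w with
  | nil => exact absurd rfl hw
  | cons a w => exact eval_one_tailIntegral _

theorem unitIntegral_X_pow_mul_cons [CharZero k] (c a : ℕ) (w : List ℕ) :
    unitIntegral k (X ^ c * iterInt k (a :: w)) =
      ((c : k) + 1)⁻¹ * unitIntegral k (X ^ (c + 1 + a) * iterInt k w) := by
  have hc : ((c : k) + 1) ≠ 0 := by exact_mod_cast c.succ_ne_zero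
  have h := unitIntegral_derivative (k := k) (X ^ (c + 1) * iterInt k (a :: w))
  have e : derivative (X ^ (c + 1) * iterInt k (a :: w)) =
      ((c : k) + 1) • (X ^ c * iterInt k (a :: w)) - X ^ (c + 1 + a) * iterInt k w := by
    rw [derivative_mul, derivative_X_pow, derivative_iterInt_cons, smul_eq_C_mul]
    push_cast
    simp only [C_add, C_1]
    ring
  rw [e, map_sub, map_smul, eval_mul, eval_mul, eval_one_iterInt (List.cons_ne_nil _ _)] at h
  simp only [smul_eq_mul, eval_pow, eval_X, ne_eq, Nat.add_eq_zero_iff, one_ne_zero, and_false,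
    not_false_eq_true, zero_pow, zero_mul, mul_zero, sub_self] at h
  field_simp
  linear_combination h

theorem sum_Iic_fin_succ {M : Type*} [AddCommMonoid M] {n : ℕ} (f : Fin (n + 1) → M) (j : Fin n) :
    ∑ l ∈ Iic j.succ, f l = f 0 + ∑ l ∈ Iic j, f l.succ := by
  have hs : Iic j.succ = cons 0 ((Iic j).map (Fin.succEmb n)) (by simp) := by
    ext x
    refine Fin.cases ?_ (fun x => ?_) x <;> simp
  rw [hs, sum_cons, sum_map]
  rfl

theorem sum_Iic_fin_zero {M : Type*} [AddCommMonoid M] {n : ℕ} (f : Fin (n + 1) → M) :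
    ∑ l ∈ Iic 0, f l = f 0 := by
  have h0 : Iic (0 : Fin (n + 1)) = {0} := by ext x; simp
  rw [h0, sum_singleton]

/-- The product of the inverses of partial sums in `G_n` is an integral over a simplex. -/
theorem unitIntegral_X_pow_mul_iterInt [CharZero k] {n : ℕ} (c : ℕ) (y : Fin n → ℕ) :
    unitIntegral k (X ^ c * iterInt k (List.ofFn y)) =
      ((c : k) + 1)⁻¹ * ∏ j : Fin n, ((c : k) + 1 + ∑ l ∈ Iic j, ((y l : k) + 1))⁻¹ := by
  induction n generalizing c with
  | zero =>
    simp only [List.ofFn_zero, iterInt, mul_one, univ_eq_empty, prod_empty]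
    rw [← monomial_one_right_eq_X_pow, unitIntegral_monomial]; simp
  | succ n ih =>
    rw [List.ofFn_succ, unitIntegral_X_pow_mul_cons, ih, Fin.prod_univ_succ]
    congr 1
    rw [sum_Iic_fin_zero]
    push_cast
    congr 1
    · congr 1; ring
    · refine prod_congr rfl fun j _ => ?_
      rw [sum_Iic_fin_succ]
      congr 1; ring

end Integral

/-! ### Sums over orderings of a finite set -/

section Orderings

/-- The sum of `F l` over the lists `l` of length `r` without repetitions and with entries
in `T`; for `r = #T` these are the orderings of `T`. -/
def orderSum {M : Type*} [AddCommMonoid M] : ℕ → Finset ℕ → (List ℕ → M) → M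
  | 0, _, F => F []
  | r + 1, T, F => ∑ m ∈ T, orderSum r (T.erase m) fun l => F (m :: l)

theorem orderSum_congr {M : Type*} [AddCommMonoid M] {r : ℕ} {T : Finset ℕ} (hT : #T = r)
    {F G : List ℕ → M} (h : ∀ l : List ℕ, (∀ j, j ∈ l ↔ j ∈ T) → F l = G l) :
    orderSum r T F = orderSum r T G := by
  induction r generalizing T F G with
  | zero => exact h [] (by simp [card_eq_zero.mp hT])
  | succ r ih =>
    refine sum_congr rfl fun m hm => ih (by rw [card_erase_of_mem hm, hT]; rfl) fun l hl => ?_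
    refine h _ fun j => ?_
    rw [List.mem_cons, hl, mem_erase]
    constructor
    · rintro (rfl | h)
      exacts [hm, h.2]
    · intro hj
      by_cases e : j = m
      exacts [Or.inl e, Or.inr ⟨e, hj⟩]

theorem map_orderSum {M N : Type*} [AddCommMonoid M] [AddCommMonoid N] (θ : M →+ N) (r : ℕ)
    (T : Finset ℕ) (F : List ℕ → M) :
    θ (orderSum r T F) = orderSum r T fun l => θ (F l) := by
  induction r generalizing T F with
  | zero => rfl
  | succ r ih => simp only [orderSum, map_sum, ih]

theorem orderSum_zero {M : Type*} [AddCommMonoid M] (r : ℕ) (T : Finset ℕ) :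
    orderSum r T (fun _ => (0 : M)) = 0 := by
  induction r generalizing T with
  | zero => rfl
  | succ r ih => simp only [orderSum, ih, sum_const_zero]

theorem orderSum_eq_sum_injective {M : Type*} [AddCommMonoid M] {N : ℕ} (r : ℕ) (T : Finset ℕ)
    (hT : T ⊆ range N) (F : List ℕ → M) :
    ∑ ρ ∈ univ.filter fun ρ : Fin r → Fin N => Function.Injective ρ ∧ ∀ j, (ρ j : ℕ) ∈ T,
      F (List.ofFn fun j => (ρ j : ℕ)) = orderSum r T F := by
  induction r generalizing T F with
  | zero =>
    rw [filter_true_of_mem fun ρ _ => ⟨Function.injective_of_subsingleton ρ, fun j => j.elim0⟩]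
    simp [orderSum]
  | succ r ih =>
    have key : ∀ (m : Fin N) (ρ : Fin r → Fin N),
        (Function.Injective (Fin.cons m ρ : Fin (r + 1) → Fin N) ∧
          ∀ j, ((Fin.cons m ρ : Fin (r + 1) → Fin N) j : ℕ) ∈ T) ↔
        (m : ℕ) ∈ T ∧ (Function.Injective ρ ∧ ∀ j, (ρ j : ℕ) ∈ T.erase m) := by
      intro m ρ
      rw [Fin.cons_injective_iff, Fin.forall_fin_succ]
      simp only [Fin.cons_zero, Fin.cons_succ, mem_erase, Set.mem_range, not_exists, ne_eq,
        Fin.val_inj]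
      constructor
      · rintro ⟨⟨h1, h2⟩, h3, h4⟩
        exact ⟨h3, h2, fun j => ⟨h1 j, h4 j⟩⟩
      · rintro ⟨h1, h2, h3⟩
        exact ⟨⟨fun j => (h3 j).1, h2⟩, h1, fun j => (h3 j).2⟩
    rw [sum_filter, ← (Fin.consEquiv fun _ : Fin (r + 1) => Fin N).sum_comp, Fintype.sum_prod_type]
    have e0 : ∀ (m : Fin N) (ρ : Fin r → Fin N),
        (if Function.Injective (Fin.consEquiv (fun _ : Fin (r + 1) => Fin N) (m, ρ)) ∧
            ∀ j, ((Fin.consEquiv (fun _ : Fin (r + 1) => Fin N) (m, ρ)) j : ℕ) ∈ T then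
          F (List.ofFn fun j => ((Fin.consEquiv (fun _ : Fin (r + 1) => Fin N) (m, ρ)) j : ℕ))
          else 0) =
        if (m : ℕ) ∈ T ∧ (Function.Injective ρ ∧ ∀ j, (ρ j : ℕ) ∈ T.erase m) then
          F (m :: List.ofFn fun j => (ρ j : ℕ)) else 0 := by
      intro m ρ
      refine if_congr (key m ρ) ?_ rfl
      rw [List.ofFn_succ]
      rfl
    rw [sum_congr rfl fun m _ => sum_congr rfl fun ρ _ => e0 m ρ]
    simp only [orderSum]
    have e : ∑ m ∈ T, orderSum r (T.erase m) (fun l => F (m :: l)) =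
        ∑ m : Fin N, if (m : ℕ) ∈ T then orderSum r (T.erase m) (fun l => F (m :: l)) else 0 := by
      rw [Fin.sum_univ_eq_sum_range (fun m => if m ∈ T then
        orderSum r (T.erase m) (fun l => F (m :: l)) else 0) N, ← sum_filter]
      refine sum_congr ?_ fun _ _ => rfl
      ext m
      simp only [mem_filter]
      exact ⟨fun h => ⟨hT h, h⟩, fun h => h.2⟩
    rw [e]
    refine sum_congr rfl fun m _ => ?_
    by_cases hm : (m : ℕ) ∈ T
    · rw [if_pos hm, ← ih (T.erase m) ((erase_subset _ _).trans hT) fun l => F (m :: l), sum_filter]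
      simp [hm]
    · simp [hm]

/-- Permutations that fix `0` are orderings of the remaining indices. -/
theorem sum_perm_fixing_zero {M : Type*} [AddCommMonoid M] (n : ℕ) (F : List ℕ → M) :
    ∑ ρ : Equiv.Perm (Fin (n + 1)) with ρ 0 = 0, F (List.ofFn fun j => (ρ j : ℕ)) =
      orderSum n ((range (n + 1)).erase 0) fun l => F (0 :: l) := by
  have h := orderSum_eq_sum_injective (N := n + 1) (n + 1) (range (n + 1)) subset_rfl
    (fun l => if l.head? = some 0 then F l else 0)
  have e : orderSum (n + 1) (range (n + 1)) (fun l => if l.head? = some 0 then F l else 0) =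
      orderSum n ((range (n + 1)).erase 0) fun l => F (0 :: l) := by
    rw [orderSum, sum_eq_single 0]
    · simp
    · intro m _ hm
      simp [hm, orderSum_zero]
    · simp
  rw [← e, ← h]
  simp only [List.ofFn_succ, List.head?_cons, Option.some.injEq]
  rw [← sum_filter, filter_filter]
  refine sum_bij (fun ρ _ => ⇑ρ) ?_ ?_ ?_ ?_
  · intro ρ hρ
    simp only [mem_filter, mem_univ, true_and] at hρ ⊢
    refine ⟨⟨ρ.injective, fun j => mem_range.mpr (ρ j).2⟩, by simp [hρ]⟩
  · intro ρ _ ρ' _ h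
    exact DFunLike.coe_injective h
  · intro ρ hρ
    simp only [mem_filter, mem_univ, true_and] at hρ
    refine ⟨Equiv.ofBijective ρ (Finite.injective_iff_bijective.mp hρ.1.1), ?_, rfl⟩
    simp only [mem_filter, mem_univ, true_and, Equiv.ofBijective_apply]
    exact Fin.ext (by simpa using hρ.2)
  · intro ρ _
    rfl

/-- The weight `∏ (1 - u) ∏ (-u)` of a list of distinct numbers: a factor `1 - u` for each pair
`(j, j + 1)` of entries that occur in this order, and a factor `-u` for each pair that occurs in
the opposite order. -/
def orderWeight {K : Type*} [CommRing K] (u : K) : List ℕ → K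
  | [] => 1
  | m :: l => (if m + 1 ∈ l then 1 - u else 1) * (if ∃ j ∈ l, j + 1 = m then -u else 1) *
      orderWeight u l

theorem map_orderWeight {K K' : Type*} [CommRing K] [CommRing K'] (θ : K →+* K') (u : K)
    (l : List ℕ) : θ (orderWeight u l) = orderWeight (θ u) l := by
  induction l with
  | nil => simp [orderWeight]
  | cons m l ih => simp only [orderWeight, map_mul, ih, apply_ite θ, map_sub, map_neg, map_one]

theorem orderWeight_ofFn {K : Type*} [CommRing K] (u : K) {r : ℕ} (y : Fin r → ℕ) :
    orderWeight u (List.ofFn y) =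
      (∏ p : Fin r, if ∃ q, p < q ∧ y q = y p + 1 then 1 - u else 1) *
        ∏ p : Fin r, if ∃ q, p < q ∧ y q + 1 = y p then -u else 1 := by
  induction r with
  | zero => simp [orderWeight]
  | succ r ih =>
    rw [List.ofFn_succ, orderWeight, ih, Fin.prod_univ_succ, Fin.prod_univ_succ]
    have h1 : y 0 + 1 ∈ List.ofFn (fun i : Fin r => y i.succ) ↔ ∃ q, 0 < q ∧ y q = y 0 + 1 := by
      rw [List.mem_ofFn, Fin.exists_fin_succ]; simp
    have h2 : (∃ j ∈ List.ofFn (fun i : Fin r => y i.succ), j + 1 = y 0) ↔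
        ∃ q, 0 < q ∧ y q + 1 = y 0 := by
      simp only [List.mem_ofFn]; rw [Fin.exists_fin_succ]; simp
    have h3 (p : Fin r) : (∃ q : Fin (r + 1), p.succ < q ∧ y q = y p.succ + 1) ↔
        ∃ q : Fin r, p < q ∧ y q.succ = y p.succ + 1 := by
      rw [Fin.exists_fin_succ]; simp
    have h4 (p : Fin r) : (∃ q : Fin (r + 1), p.succ < q ∧ y q + 1 = y p.succ) ↔
        ∃ q : Fin r, p < q ∧ y q.succ + 1 = y p.succ := by
      rw [Fin.exists_fin_succ]; simp
    simp only [h1, h2, h3, h4]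
    ring

/-- The weight of an ordering `ρ` depends only on the number of descents of `ρ⁻¹`, since the pair
`(j, j + 1)` occurs in the opposite order if and only if `j` is a descent of `ρ⁻¹`. -/
theorem orderWeight_perm {K : Type*} [CommRing K] (u : K) {n : ℕ}
    (ρ : Equiv.Perm (Fin (n + 1))) :
    orderWeight u (List.ofFn fun j => (ρ j : ℕ)) =
      (1 - u) ^ (n - descents ρ⁻¹) * (-u) ^ descents ρ⁻¹ := by
  rw [orderWeight_ofFn]
  have h1 : (∏ p : Fin (n + 1), if ∃ q, p < q ∧ (ρ q : ℕ) = ρ p + 1 then 1 - u else 1) =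
      ∏ i : Fin n, if ρ⁻¹ i.succ < ρ⁻¹ i.castSucc then 1 else 1 - u := by
    rw [← Equiv.prod_comp ρ⁻¹, Fin.prod_univ_castSucc]
    rw [if_neg, mul_one]
    · refine prod_congr rfl fun i _ => ?_
      have : (∃ q, ρ⁻¹ i.castSucc < q ∧ (ρ q : ℕ) = ρ (ρ⁻¹ i.castSucc) + 1) ↔
          ¬ ρ⁻¹ i.succ < ρ⁻¹ i.castSucc := by
        have hne : ρ⁻¹ i.succ ≠ ρ⁻¹ i.castSucc := fun h =>
          (Fin.castSucc_lt_succ (i := i)).ne' (ρ⁻¹.injective h)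
        constructor
        · rintro ⟨q, hq, h⟩
          have : q = ρ⁻¹ i.succ := by
            rw [Equiv.Perm.eq_inv_iff_eq]; ext; simpa using h
          exact this ▸ hq.not_gt
        · intro h
          exact ⟨ρ⁻¹ i.succ, lt_of_le_of_ne (not_lt.mp h) hne.symm, by simp⟩
      simp only [this, ite_not]
    · rintro ⟨q, _, h⟩
      have := (ρ q).2
      simp at h
      omega
  have h2 : (∏ p : Fin (n + 1), if ∃ q, p < q ∧ (ρ q : ℕ) + 1 = ρ p then -u else 1) =
      ∏ i : Fin n, if ρ⁻¹ i.succ < ρ⁻¹ i.castSucc then -u else 1 := by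
    rw [← Equiv.prod_comp ρ⁻¹, Fin.prod_univ_succ]
    rw [if_neg, one_mul]
    · refine prod_congr rfl fun i _ => ?_
      have : (∃ q, ρ⁻¹ i.succ < q ∧ (ρ q : ℕ) + 1 = ρ (ρ⁻¹ i.succ)) ↔
          ρ⁻¹ i.succ < ρ⁻¹ i.castSucc := by
        constructor
        · rintro ⟨q, hq, h⟩
          have : q = ρ⁻¹ i.castSucc := by
            rw [Equiv.Perm.eq_inv_iff_eq]; ext; simpa using h
          exact this ▸ hq
        · intro h
          exact ⟨ρ⁻¹ i.castSucc, h, by simp⟩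
      simp only [this]
    · rintro ⟨q, _, h⟩
      simp at h
  rw [h1, h2, prod_ite, prod_ite, prod_const_one, prod_const_one, one_mul, mul_one, prod_const,
    prod_const, descents]
  congr 2
  have := card_filter_add_card_filter_not (s := (univ : Finset (Fin n)))
    (fun i : Fin n => ρ⁻¹ i.succ < ρ⁻¹ i.castSucc)
  rw [card_fin] at this
  omega

end Orderings

/-! ### The weighted sum over all orderings of the integration variables -/

section Riccati

variable {k : Type*} [Field k]

/-- The sum over the orderings `(j_1, …, j_r)` of `T` of the iterated integrals of
`t_{j_1}^{a j_1} ⋯ t_{j_r}^{a j_r}` over `s < t_{j_1} < ⋯ < t_{j_r} < 1`, each multiplied by the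
weight of the ordering. In other words, the integral over the cube `(s, 1)^T` with the weight
`1 - u` or `-u` for each pair `j, j + 1 ∈ T`, according to whether `t_j < t_{j+1}` or not. -/
def cubeInt (a : ℕ → ℕ) (u : k) (T : Finset ℕ) : k[X] :=
  orderSum #T T fun l => orderWeight u l • iterInt k (l.map a)

/-- The part of the weight that involves the smallest variable `t_m`. -/
def minWeight (u : k) (T : Finset ℕ) (m : ℕ) : k :=
  (if m + 1 ∈ T then 1 - u else 1) * (if ∃ j ∈ T, j + 1 = m then -u else 1)

theorem cubeInt_empty (a : ℕ → ℕ) (u : k) : cubeInt a u ∅ = 1 := by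
  simp [cubeInt, orderSum, orderWeight, iterInt]

theorem eval_one_cubeInt (a : ℕ → ℕ) (u : k) {T : Finset ℕ} (hT : T.Nonempty) :
    (cubeInt a u T).eval 1 = 0 := by
  have h : (cubeInt a u T).eval 1 =
      orderSum #T T fun l => (orderWeight u l • iterInt k (l.map a)).eval 1 :=
    map_orderSum (evalRingHom (1 : k)).toAddMonoidHom _ _ _
  rw [h, ← orderSum_zero (M := k) #T T]
  refine orderSum_congr rfl fun l hl => ?_
  have : l.map a ≠ [] := by
    obtain ⟨j, hj⟩ := hT
    intro h
    rw [List.map_eq_nil_iff] at h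
    subst h
    exact absurd ((hl j).mpr hj) (by simp)
  rw [eval_smul, eval_one_iterInt this, smul_zero]

/-- The letters `a p, …, a (q - 1)`. -/
def slice (a : ℕ → ℕ) (p q : ℕ) : List ℕ := (List.range' p (q - p)).map a

theorem slice_self (a : ℕ → ℕ) (p : ℕ) : slice a p p = [] := by simp [slice]

theorem slice_eq_cons (a : ℕ → ℕ) {p q : ℕ} (h : p < q) :
    slice a p q = a p :: slice a (p + 1) q := by
  rw [slice, slice, show q - p = q - (p + 1) + 1 by omega, List.range'_succ, List.map_cons]

/-- The derivative of `M + u ∑ M I`, where `M` solves a Riccati equation and `I` a linear one. -/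
theorem derivative_add_sum_of_riccati {p q : ℕ} (h : p < q) (u : k) (x M I Mm : ℕ → k[X])
    (Mp : ℕ → ℕ → k[X])
    (hM : ∀ r, derivative (M r) = -∑ m ∈ Ico p r, Mm m * x m * Mp (m + 1) r)
    (hp : Mm p = 1) (hMm : ∀ r, p < r → Mm r = -(C u * M r))
    (hI : ∀ r, r < q → derivative (I r) = -(x r * I (r + 1)))
    (bracket : ∀ m ∈ Ico p q, Mp (m + 1) q + C u * ∑ r ∈ Ioo m q, Mp (m + 1) r * I r =
      I (m + 1)) :
    derivative (M q + C u * ∑ r ∈ Ioo p q, M r * I r) = derivative (I p) := by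
  have h1 : derivative (∑ r ∈ Ioo p q, M r * I r) =
      -∑ m ∈ Ico p q, Mm m * x m * ∑ r ∈ Ioo m q, Mp (m + 1) r * I r -
        ∑ r ∈ Ioo p q, M r * (x r * I (r + 1)) := by
    rw [map_sum]
    have : ∀ r ∈ Ioo p q, derivative (M r * I r) =
        -(∑ m ∈ Ico p r, Mm m * x m * (Mp (m + 1) r * I r)) - M r * (x r * I (r + 1)) :=
      fun r hr => by
        rw [mem_Ioo] at hr
        rw [derivative_mul, hM r, hI r hr.2, neg_mul, sum_mul, mul_neg, sub_eq_add_neg]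
        congr 2
        exact sum_congr rfl fun m _ => by ring
    rw [sum_congr rfl this, sum_sub_distrib, sum_neg_distrib]
    congr 2
    simp only [mul_sum]
    refine sum_comm' fun r m => ?_
    simp only [mem_Ioo, mem_Ico]
    omega
  have h2 : x p * I (p + 1) - C u * ∑ r ∈ Ioo p q, M r * (x r * I (r + 1)) =
      ∑ m ∈ Ico p q, Mm m * x m * I (m + 1) := by
    have e : Ico p q = insert p (Ioo p q) := by
      ext j; simp only [mem_Ioo, mem_Ico, mem_insert]; omega
    rw [e, sum_insert (by simp), mul_sum, sub_eq_add_neg, ← sum_neg_distrib, hp, one_mul]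
    congr 1
    refine sum_congr rfl fun r hr => ?_
    rw [mem_Ioo] at hr
    rw [hMm r hr.1]
    ring
  have h3 : ∑ m ∈ Ico p q, Mm m * x m * Mp (m + 1) q +
      C u * ∑ m ∈ Ico p q, Mm m * x m * ∑ r ∈ Ioo m q, Mp (m + 1) r * I r =
      ∑ m ∈ Ico p q, Mm m * x m * I (m + 1) := by
    rw [mul_sum, ← sum_add_distrib]
    refine sum_congr rfl fun m hm => ?_
    rw [← bracket m hm]
    ring
  rw [derivative_add, derivative_C_mul, h1, hM q, hI p h]
  linear_combination h2 - h3

/-- The sum over the decompositions of a word into `m` nonempty words of the products of the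
iterated integrals of the pieces. -/
def iterIntPow (k : Type*) [Field k] : ℕ → List ℕ → k[X]
  | 0, w => if w = [] then 1 else 0
  | m + 1, w => ∑ j ∈ range w.length, iterIntPow k m (w.take j) * iterInt k (w.drop j)

theorem iterIntPow_eq_zero {m : ℕ} {w : List ℕ} (h : w.length < m) : iterIntPow k m w = 0 := by
  induction m generalizing w with
  | zero => omega
  | succ m ih =>
    refine sum_eq_zero fun j hj => ?_
    rw [mem_range] at hj
    rw [ih, zero_mul]
    rw [List.length_take]
    omega

theorem iterIntPow_succ_slice (a : ℕ → ℕ) (m p q : ℕ) :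
    iterIntPow k (m + 1) (slice a p q) =
      ∑ r ∈ Ico p q, iterIntPow k m (slice a p r) * iterInt k (slice a r q) := by
  rw [iterIntPow, sum_Ico_eq_sum_range]
  have hl : (slice a p q).length = q - p := by simp [slice]
  rw [hl]
  refine sum_congr rfl fun j hj => ?_
  rw [mem_range] at hj
  have e1 : (slice a p q).take j = slice a p (p + j) := by
    rw [slice, slice, ← List.map_take, List.take_range'_of_length_ge (by omega)]
    congr 2
    omega
  have e2 : (slice a p q).drop j = slice a (p + j) q := by
    rw [slice, slice, ← List.map_drop, List.drop_range', Nat.sub_sub]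
    simp
  rw [e1, e2]

variable [CharZero k]

/-- Differentiation with respect to the lower limit `s` removes the smallest variable. -/
theorem derivative_cubeInt (a : ℕ → ℕ) (u : k) (T : Finset ℕ) :
    derivative (cubeInt a u T) =
      -∑ m ∈ T, minWeight u T m • (X ^ a m * cubeInt a u (T.erase m)) := by
  rcases T.eq_empty_or_nonempty with rfl | hT
  · simp [cubeInt_empty]
  obtain ⟨r, hr⟩ : ∃ r, #T = r + 1 := ⟨#T - 1, by have := hT.card_pos; omega⟩
  rw [cubeInt, hr, orderSum, map_sum, ← sum_neg_distrib]
  refine sum_congr rfl fun m hm => ?_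
  have hr' : #(T.erase m) = r := by rw [card_erase_of_mem hm, hr]; rfl
  have h1 := map_orderSum (derivative (R := k)).toAddMonoidHom r (T.erase m)
    (fun l => orderWeight u (m :: l) • iterInt k ((m :: l).map a))
  have h2 := map_orderSum
    ((LinearMap.mulLeft k (X ^ a m : k[X])).toAddMonoidHom) r (T.erase m)
    (fun l => orderWeight u l • iterInt k (l.map a))
  have h3 := map_orderSum ((-minWeight u T m • (LinearMap.id : k[X] →ₗ[k] k[X])).toAddMonoidHom) r
    (T.erase m) (fun l => X ^ a m * orderWeight u l • iterInt k (l.map a))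
  simp only [LinearMap.toAddMonoidHom_coe, LinearMap.mulLeft_apply, LinearMap.smul_apply,
    LinearMap.id_coe, id_eq] at h1 h2 h3
  rw [h1, cubeInt, hr', h2, ← neg_smul, h3]
  refine orderSum_congr hr' fun l hl => ?_
  have hw : orderWeight u (m :: l) = minWeight u T m * orderWeight u l := by
    rw [orderWeight, minWeight]
    have e1 : m + 1 ∈ l ↔ m + 1 ∈ T := by rw [hl, mem_erase]; simp
    have e2 : (∃ j ∈ l, j + 1 = m) ↔ ∃ j ∈ T, j + 1 = m := by
      constructor
      · rintro ⟨j, hj, h⟩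
        exact ⟨j, mem_of_mem_erase ((hl j).mp hj), h⟩
      · rintro ⟨j, hj, h⟩
        exact ⟨j, (hl j).mpr (mem_erase.mpr ⟨by omega, hj⟩), h⟩
    simp only [e1, e2]
  rw [hw, List.map_cons, derivative_smul, derivative_iterInt_cons]
  simp only [smul_eq_C_mul, C_mul, C_neg]
  ring

/-- The integral over a cube factors over sets of variables that are not linked by a weight. -/
theorem cubeInt_union (a : ℕ → ℕ) (u : k) (T₁ T₂ : Finset ℕ)
    (h : ∀ i ∈ T₁, ∀ j ∈ T₂, i + 1 < j) :
    cubeInt a u (T₁ ∪ T₂) = cubeInt a u T₁ * cubeInt a u T₂ := by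
  induction hn : #T₁ + #T₂ using Nat.strong_induction_on generalizing T₁ T₂ with
  | _ n ih =>
  subst hn
  rcases T₁.eq_empty_or_nonempty with rfl | h1
  · simp [cubeInt_empty]
  rcases T₂.eq_empty_or_nonempty with rfl | h2
  · simp [cubeInt_empty]
  refine eq_of_derivative_eq ?_ ?_
  · have hd : Disjoint T₁ T₂ := disjoint_left.mpr fun i hi hj => by have := h i hi i hj; omega
    rw [derivative_mul, derivative_cubeInt, derivative_cubeInt, derivative_cubeInt,
      sum_union hd, neg_add, neg_mul, mul_neg, sum_mul, mul_sum]
    congr 2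
    · refine sum_congr rfl fun m hm => ?_
      have hm2 : m ∉ T₂ := disjoint_left.mp hd hm
      have e : (T₁ ∪ T₂).erase m = T₁.erase m ∪ T₂ := by
        rw [erase_union_distrib, erase_eq_of_notMem hm2]
      have ew : minWeight u (T₁ ∪ T₂) m = minWeight u T₁ m := by
        have e1 : m + 1 ∈ T₁ ∪ T₂ ↔ m + 1 ∈ T₁ := by
          rw [mem_union, or_iff_left]
          intro h'
          have := h m hm _ h'
          omega
        have e2 : (∃ j ∈ T₁ ∪ T₂, j + 1 = m) ↔ ∃ j ∈ T₁, j + 1 = m := by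
          refine exists_congr fun j => and_congr_left fun hj => ?_
          rw [mem_union, or_iff_left]
          intro h'
          have := h m hm _ h'
          omega
        simp only [minWeight, e1, e2]
      rw [e, ew, ih _ (by have := card_erase_lt_of_mem hm; omega) (T₁.erase m) T₂
        (fun i hi j hj => h i (mem_of_mem_erase hi) j hj) rfl]
      simp only [smul_eq_C_mul]
      ring
    · refine sum_congr rfl fun m hm => ?_
      have hm1 : m ∉ T₁ := disjoint_right.mp hd hm
      have e : (T₁ ∪ T₂).erase m = T₁ ∪ T₂.erase m := by
        rw [erase_union_distrib, erase_eq_of_notMem hm1]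
      have ew : minWeight u (T₁ ∪ T₂) m = minWeight u T₂ m := by
        have e1 : m + 1 ∈ T₁ ∪ T₂ ↔ m + 1 ∈ T₂ := by
          rw [mem_union, or_iff_right]
          intro h'
          have := h _ h' m hm
          omega
        have e2 : (∃ j ∈ T₁ ∪ T₂, j + 1 = m) ↔ ∃ j ∈ T₂, j + 1 = m := by
          refine exists_congr fun j => and_congr_left fun hj => ?_
          rw [mem_union, or_iff_right]
          intro h'
          have := h _ h' m hm
          omega
        simp only [minWeight, e1, e2]
      rw [e, ew, ih _ (by have := card_erase_lt_of_mem hm; omega) T₁ (T₂.erase m)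
        (fun i hi j hj => h i hi j (mem_of_mem_erase hj)) rfl]
      simp only [smul_eq_C_mul]
      ring
  · rw [eval_mul, eval_one_cubeInt a u h1, eval_one_cubeInt a u (h1.mono subset_union_left),
      zero_mul]

/-- The integral over the cube of an interval of variables satisfies a Riccati equation. -/
theorem derivative_cubeInt_Ico (a : ℕ → ℕ) (u : k) (p q : ℕ) :
    derivative (cubeInt a u (Ico p q)) =
      -∑ m ∈ Ico p q, ((if p = m then 1 else -(C u * cubeInt a u (Ico p m))) * X ^ a m *
        (if m + 1 = q then 1 else C (1 - u) * cubeInt a u (Ico (m + 1) q))) := by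
  rw [derivative_cubeInt]
  congr 1
  refine sum_congr rfl fun m hm => ?_
  rw [mem_Ico] at hm
  have e : (Ico p q).erase m = Ico p m ∪ Ico (m + 1) q := by
    ext j; simp only [mem_erase, mem_Ico, mem_union]; omega
  have e1 : m + 1 ∈ Ico p q ↔ ¬ m + 1 = q := by rw [mem_Ico]; omega
  have e2 : (∃ j ∈ Ico p q, j + 1 = m) ↔ ¬ p = m := by
    constructor
    · rintro ⟨j, hj, rfl⟩
      rw [mem_Ico] at hj
      omega
    · intro h
      exact ⟨m - 1, by rw [mem_Ico]; omega, by omega⟩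
  rw [e, cubeInt_union a u _ _ fun i hi j hj => by rw [mem_Ico] at hi hj; omega, minWeight]
  simp only [e1, e2, ite_not]
  split_ifs with h1 h2 h2
  · subst h1; rw [Ico_self, Ico_eq_empty (by omega), cubeInt_empty]; simp
  · rw [h1, Ico_self, cubeInt_empty]; simp only [smul_eq_C_mul, C_neg, one_mul]; ring
  · rw [h2, Ico_self, cubeInt_empty]; simp only [smul_eq_C_mul, mul_one]; ring
  · simp only [smul_eq_C_mul, C_neg, C_mul, C_sub, C_1]; ring

/-- The linear equation that is solved by the solution of the Riccati equation. -/
theorem cubeInt_Ico_add (a : ℕ → ℕ) (u : k) (p q : ℕ) (h : p < q) :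
    cubeInt a u (Ico p q) +
      C u * ∑ r ∈ Ioo p q, cubeInt a u (Ico p r) * iterInt k (slice a r q) =
        iterInt k (slice a p q) := by
  induction hn : q - p using Nat.strong_induction_on generalizing p with
  | _ n ih =>
  subst hn
  refine eq_of_derivative_eq ?_ ?_
  · refine derivative_add_sum_of_riccati (p := p) (q := q) h u (fun m => X ^ a m)
      (fun r => cubeInt a u (Ico p r)) (fun r => iterInt k (slice a r q))
      (fun m => if p = m then 1 else -(C u * cubeInt a u (Ico p m)))
      (fun i j => if i = j then 1 else C (1 - u) * cubeInt a u (Ico i j))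
      (fun r => derivative_cubeInt_Ico a u p r)
      (if_pos rfl) (fun r hr => if_neg hr.ne) (fun r hr => ?_) (fun m hm => ?_)
    · rw [slice_eq_cons a hr, derivative_iterInt_cons]
    · rw [mem_Ico] at hm
      by_cases hq : m + 1 = q
      · rw [if_pos hq, show Ioo m q = ∅ by ext; simp; omega, hq, slice_self, sum_empty, iterInt]
        ring
      · have := ih (q - (m + 1)) (by omega) (m + 1) (by omega) rfl
        have e : Ioo m q = insert (m + 1) (Ioo (m + 1) q) := by
          ext j; simp only [mem_Ioo, mem_insert]; omega
        have e' : ∑ r ∈ Ioo (m + 1) q, (if m + 1 = r then 1 else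
              C (1 - u) * cubeInt a u (Ico (m + 1) r)) * iterInt k (slice a r q) =
            C (1 - u) * ∑ r ∈ Ioo (m + 1) q,
              cubeInt a u (Ico (m + 1) r) * iterInt k (slice a r q) := by
          rw [mul_sum]
          refine sum_congr rfl fun r hr => ?_
          rw [mem_Ioo] at hr
          rw [if_neg hr.1.ne]
          ring
        rw [if_neg hq, e, sum_insert (by simp), if_pos rfl, e', C_sub, C_1]
        linear_combination (1 - C u) * this
  · have hIe : ∀ r, r < q → (iterInt k (slice a r q)).eval 1 = 0 := fun r hr =>
      eval_one_iterInt (by rw [slice_eq_cons a hr]; exact List.cons_ne_nil _ _)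
    rw [eval_add, eval_mul, eval_finsetSum, hIe p h, eval_one_cubeInt a u (nonempty_Ico.mpr h),
      sum_eq_zero fun r hr => ?_]
    · simp
    · rw [mem_Ioo] at hr
      rw [eval_mul, hIe r hr.2, mul_zero]

/-- The integral over the cube of an interval of variables is a geometric series in `-u` over the
decompositions of the corresponding word. -/
theorem cubeInt_Ico (a : ℕ → ℕ) (u : k) {K p q : ℕ} (h : p < q) (hK : q - p ≤ K) :
    cubeInt a u (Ico p q) = ∑ m ∈ range K, C ((-u) ^ m) * iterIntPow k (m + 1) (slice a p q) := by
  induction q using Nat.strong_induction_on with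
  | _ q ih =>
  have hlen : ∀ r, (slice a p r).length = r - p := fun r => by simp [slice]
  have h0 : ∀ m, iterIntPow k (m + 1) (slice a p p) = 0 := fun m => by
    simp [iterIntPow, slice_self]
  have e : Ico p q = insert p (Ioo p q) := by
    ext j; simp only [mem_Ioo, mem_Ico, mem_insert]; omega
  have hstep : ∀ m, iterIntPow k (m + 2) (slice a p q) =
      ∑ r ∈ Ioo p q, iterIntPow k (m + 1) (slice a p r) * iterInt k (slice a r q) := fun m => by
    rw [iterIntPow_succ_slice, e, sum_insert (by simp), h0, zero_mul, zero_add]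
  have hone : iterIntPow k 1 (slice a p q) = iterInt k (slice a p q) := by
    rw [iterIntPow_succ_slice, e, sum_insert (by simp), sum_eq_zero]
    · simp [iterIntPow, slice_self]
    · intro r hr
      rw [mem_Ioo] at hr
      rw [slice_eq_cons a hr.1]
      simp [iterIntPow]
  have hS : ∑ r ∈ Ioo p q, cubeInt a u (Ico p r) * iterInt k (slice a r q) =
      ∑ m ∈ range K, C ((-u) ^ m) * iterIntPow k (m + 2) (slice a p q) := by
    simp only [hstep, mul_sum]
    rw [sum_comm]
    refine sum_congr rfl fun r hr => ?_
    rw [mem_Ioo] at hr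
    rw [ih r hr.2 hr.1 (by omega), sum_mul]
    exact sum_congr rfl fun m _ => by ring
  have hmain := cubeInt_Ico_add a u p q h
  rw [hS] at hmain
  have hK' : K = (K - 1) + 1 := by omega
  rw [hK', sum_range_succ, iterIntPow_eq_zero (m := K - 1 + 2) (by rw [hlen]; omega)] at hmain
  rw [hK', sum_range_succ', hone, ← hmain]
  have : ∑ m ∈ range (K - 1), C ((-u) ^ (m + 1)) * iterIntPow k (m + 1 + 1) (slice a p q) =
      -(C u * ∑ m ∈ range (K - 1), C ((-u) ^ m) * iterIntPow k (m + 2) (slice a p q)) := by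
    rw [mul_sum, ← sum_neg_distrib]
    refine sum_congr rfl fun m _ => ?_
    rw [pow_succ, C_mul, C_neg]
    ring
  rw [this]
  simp

end Riccati

/-! ### The coefficients as integrals -/

section Coefficients

variable {k : Type*} [Field k] [CharZero k]

/-- The coefficient of a word in the power series
`(1 + w) log (1 + w) / w = 1 + ∑_m (-1)^m w^(m+1) / ((m+1)(m+2))`, where `w` is the generating
series of the iterated integrals of nonempty words. -/
def logCoeff (k : Type*) [Field k] (K : ℕ) (w : List ℕ) : k[X] :=
  (if w = [] then 1 else 0) +
    ∑ m ∈ range K, C ((-1) ^ m * (((m : k) + 1) * (m + 2))⁻¹) * iterIntPow k (m + 1) w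

theorem unitIntegral_one_sub_mul_neg_pow (m : ℕ) :
    unitIntegral k ((1 - X) * (-X) ^ m : k[X]) = (-1) ^ m * (((m : k) + 1) * (m + 2))⁻¹ := by
  have h := unitIntegral_beta (k := k) 1 m
  rw [pow_one] at h
  have e : ((1 - X) * (-X) ^ m : k[X]) = ((1 - X) * X ^ m) * C ((-1) ^ m) := by
    rw [neg_pow]; simp; ring
  rw [e, unitIntegral_mul_C, h, mul_comm]
  congr 1
  rw [show 1 + m = m + 1 by omega, Nat.choose_succ_self_right, mul_inv]
  push_cast
  rw [mul_comm]
  congr 2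
  ring

theorem descents_le {n : ℕ} (ρ : Equiv.Perm (Fin (n + 1))) : descents ρ ≤ n := by
  have := card_filter_le (univ : Finset (Fin n)) fun i => ρ i.succ < ρ i.castSucc
  rwa [card_fin] at this

/-- The descent weight in `G_{n+1}` is a Beta integral. -/
theorem unitIntegral_orderWeight {n : ℕ} (ρ : Equiv.Perm (Fin (n + 1))) :
    unitIntegral k (orderWeight (X : k[X]) (List.ofFn fun j => (ρ j : ℕ))) =
      ((n : k) + 1)⁻¹ * ((-1) ^ descents ρ⁻¹ / (n.choose (descents ρ⁻¹) : k)) := by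
  have hd := descents_le ρ⁻¹
  rw [orderWeight_perm]
  have e : ((1 - X) ^ (n - descents ρ⁻¹) * (-X) ^ descents ρ⁻¹ : k[X]) =
      (1 - X) ^ (n - descents ρ⁻¹) * X ^ descents ρ⁻¹ * C ((-1) ^ descents ρ⁻¹) := by
    rw [neg_pow]; simp; ring
  rw [e, unitIntegral_mul_C, unitIntegral_beta, Nat.sub_add_cancel hd]
  ring

/-- The coefficient `G_{n+1}` is an integral of the coefficients of a power series in the
generating series of iterated integrals. -/
theorem coeffG_eq_unitIntegral {n K : ℕ} (hK : n ≤ K) (y : Fin (n + 1) → ℕ) :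
    coeffG k n (fun j => (y j : k) + 1) =
      unitIntegral k (X ^ y 0 * logCoeff k K (List.ofFn fun j : Fin n => y j.succ)) := by
  set a : ℕ → ℕ := fun j => if h : j < n + 1 then y ⟨j, h⟩ else 0 with ha
  have hay : ∀ j : Fin (n + 1), a j = y j := fun j => dif_pos j.2
  set J : List ℕ → k := fun l => unitIntegral k (X ^ y 0 * iterInt k (l.map a)) with hJ
  have h1 : coeffG k n (fun j => (y j : k) + 1) =
      orderSum n ((range (n + 1)).erase 0) fun l =>
        unitIntegral k (orderWeight (X : k[X]) (0 :: l)) * J l := by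
    have h := sum_perm_fixing_zero n fun l =>
      unitIntegral k (orderWeight (X : k[X]) l) * J l.tail
    simp only [List.tail_cons] at h
    rw [← h, coeffG, mul_sum]
    refine sum_congr rfl fun ρ hρ => ?_
    have hρ0 : ρ 0 = 0 := by simpa using hρ
    rw [unitIntegral_orderWeight, ← mul_assoc]
    congr 1
    have e : (List.ofFn fun j => (ρ j : ℕ)).tail.map a =
        List.ofFn fun j : Fin n => y (ρ j.succ) := by
      rw [List.ofFn_succ, List.tail_cons, List.map_ofFn]
      congr 1
      ext j
      exact hay _
    rw [hJ]
    beta_reduce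
    rw [e, unitIntegral_X_pow_mul_iterInt, Fin.prod_univ_succ, sum_Iic_fin_zero, hρ0]
    congr 1
    refine prod_congr rfl fun j _ => ?_
    rw [sum_Iic_fin_succ, hρ0]
  rw [h1]
  rcases Nat.eq_zero_or_pos n with rfl | hn
  · have h0 : ∀ m, iterIntPow k (m + 1) [] = 0 := fun m => iterIntPow_eq_zero (by simp)
    have e1 : unitIntegral k (1 : k[X]) = 1 := by
      rw [← monomial_zero_one, unitIntegral_monomial]; simp
    simp [orderSum, orderWeight, hJ, logCoeff, h0, iterInt, e1]
  -- Every ordering starts with `0`, so the pair `(0, 1)` contributes the factor `1 - u`, and the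
  -- other indices `1, …, n` are weighted as in a cube integral.
  have hT : (range (n + 1)).erase 0 = Ico 1 (n + 1) := by
    ext j; simp only [mem_erase, mem_range, mem_Ico]; omega
  have hcard : #(Ico 1 (n + 1)) = n := by simp
  have hw : (List.ofFn fun j : Fin n => y j.succ) = slice a 1 (n + 1) := by
    refine List.ext_getElem (by simp [slice]) fun i h1 h2 => ?_
    have hi : i < n := by simpa using h1
    simp [slice, ha, hi, add_comm 1 i]
  rw [hT, hw]
  set P : k[X] := orderSum n (Ico 1 (n + 1)) fun l => orderWeight (X : k[X]) l * C (J l) with hP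
  have h2 : (orderSum n (Ico 1 (n + 1)) fun l =>
      unitIntegral k (orderWeight (X : k[X]) (0 :: l)) * J l) = unitIntegral k ((1 - X) * P) := by
    have := map_orderSum ((unitIntegral k ∘ₗ LinearMap.mulLeft k (1 - X : k[X])).toAddMonoidHom) n
      (Ico 1 (n + 1)) (fun l => orderWeight (X : k[X]) l * C (J l))
    simp only [LinearMap.toAddMonoidHom_coe, LinearMap.comp_apply, LinearMap.mulLeft_apply] at this
    rw [hP, this]
    refine orderSum_congr hcard fun l hl => ?_
    have e1 : 0 + 1 ∈ l := (hl _).mpr (by rw [mem_Ico]; omega)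
    rw [orderWeight, if_pos e1, if_neg (by simp), mul_one, ← mul_assoc, unitIntegral_mul_C]
  have h3 : P = ∑ m ∈ range K,
      (-X) ^ m * C (unitIntegral k (X ^ y 0 * iterIntPow k (m + 1) (slice a 1 (n + 1)))) := by
    refine Polynomial.funext fun u => ?_
    have e1 : P.eval u = orderSum n (Ico 1 (n + 1)) fun l => orderWeight u l * J l := by
      have := map_orderSum (evalRingHom u).toAddMonoidHom n (Ico 1 (n + 1))
        (fun l => orderWeight (X : k[X]) l * C (J l))
      simp only [RingHom.toAddMonoidHom_eq_coe, AddMonoidHom.coe_coe, map_mul, map_orderWeight,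
        coe_evalRingHom, eval_X, eval_C] at this
      exact this
    have e2 : (orderSum n (Ico 1 (n + 1)) fun l => orderWeight u l * J l) =
        unitIntegral k (X ^ y 0 * cubeInt a u (Ico 1 (n + 1))) := by
      have := map_orderSum ((unitIntegral k ∘ₗ LinearMap.mulLeft k (X ^ y 0 : k[X])).toAddMonoidHom)
        n (Ico 1 (n + 1)) (fun l => orderWeight u l • iterInt k (l.map a))
      simp only [LinearMap.toAddMonoidHom_coe, LinearMap.comp_apply, LinearMap.mulLeft_apply,
        map_smul, smul_eq_mul] at this
      rw [cubeInt, hcard, this]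
    rw [e1, e2, cubeInt_Ico a u (K := K) (by omega) (by omega), mul_sum, map_sum, eval_finsetSum]
    refine sum_congr rfl fun m _ => ?_
    rw [mul_left_comm, ← smul_eq_C_mul, map_smul]
    simp
  rw [h2, h3, mul_sum, map_sum, logCoeff, if_neg (by rw [slice_eq_cons a (by omega)]; simp),
    zero_add, mul_sum, map_sum]
  refine sum_congr rfl fun m _ => ?_
  rw [← mul_assoc, unitIntegral_mul_C, unitIntegral_one_sub_mul_neg_pow, mul_left_comm,
    ← smul_eq_C_mul, map_smul, smul_eq_mul]

end Coefficients

/-! ### Exponential and logarithm of nilpotent elements -/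

section ExpLog

variable (k : Type*) [Field k]

/-- The truncated exponential series. -/
def expSum {A : Type*} [Ring A] [Algebra k A] (K : ℕ) (z : A) : A :=
  ∑ m ∈ range K, (m ! : k)⁻¹ • z ^ m

/-- The truncated power series `log (1 + w)`. -/
def logSum {A : Type*} [Ring A] [Algebra k A] (K : ℕ) (w : A) : A :=
  ∑ m ∈ range K, ((-1) ^ m * ((m : k) + 1)⁻¹) • w ^ (m + 1)

/-- The truncated power series `log (1 + q) / q`. -/
def logQuot {A : Type*} [Ring A] [Algebra k A] (K : ℕ) (q : A) : A :=
  ∑ m ∈ range K, ((-1) ^ m * ((m : k) + 1)⁻¹) • q ^ m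

variable {k} [CharZero k]

theorem X_pow_dvd_expSum_logSum (N : ℕ) :
    (X ^ (N + 1) : k[X]) ∣ expSum k (N + 1) (logSum k (N + 1) (X : k[X])) - (1 + X) := by
  set p : k[X] := logSum k (N + 1) (X : k[X]) with hp
  set q : k[X] := expSum k (N + 1) p with hq
  have hp' : derivative p * (1 + X) = 1 - (-X) ^ (N + 1) := by
    have e : derivative p = ∑ m ∈ range (N + 1), (-X) ^ m := by
      rw [hp, logSum, map_sum]
      refine sum_congr rfl fun m _ => ?_
      have hm : ((m : k) + 1) ≠ 0 := by exact_mod_cast m.succ_ne_zero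
      rw [derivative_smul, derivative_X_pow, smul_eq_C_mul, ← mul_assoc, ← C_mul]
      push_cast
      rw [mul_assoc, inv_mul_cancel₀ hm, neg_pow (X : k[X]) m]
      simp
    rw [e, ← sub_neg_eq_add, geom_sum_mul_neg]
  have hXp : (X : k[X]) ∣ p := by
    rw [hp, logSum]
    refine dvd_sum fun m _ => ?_
    rw [smul_eq_C_mul, pow_succ]
    exact Dvd.intro_left _ (mul_assoc _ _ _)
  have hq' : (1 + X) * derivative q = (1 - (-X) ^ (N + 1)) * (q - (N ! : k)⁻¹ • p ^ N) := by
    have e : derivative q = derivative p * (q - (N ! : k)⁻¹ • p ^ N) := by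
      rw [hq, expSum, map_sum, sum_range_succ', sum_range_succ, add_sub_cancel_right, mul_sum]
      simp only [pow_zero, derivative_smul, derivative_one, smul_zero, add_zero]
      refine sum_congr rfl fun m _ => ?_
      have hm : ((m : k) + 1) ≠ 0 := by exact_mod_cast m.succ_ne_zero
      rw [derivative_pow_succ, Nat.factorial_succ, smul_eq_C_mul, smul_eq_C_mul, ← mul_assoc,
        ← mul_assoc, ← C_mul]
      push_cast
      have e2 : (((m : k) + 1) * (m ! : k))⁻¹ * ((m : k) + 1) = (m ! : k)⁻¹ := by
        rw [mul_inv]; field_simp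
      rw [e2]
      ring
    rw [e, ← hp']; ring
  have hcoef : ∀ m, m < N → ((m : k) + 1) * q.coeff (m + 1) + m * q.coeff m = q.coeff m := by
    intro m hm
    have h1 : ((1 + X) * derivative q).coeff m = q.coeff m := by
      rw [hq']
      obtain ⟨s, hs⟩ := pow_dvd_pow_of_dvd hXp N
      have e : (1 - (-X) ^ (N + 1)) * (q - (N ! : k)⁻¹ • p ^ N) =
          q + X ^ N * (-(C (N ! : k)⁻¹ * s) + -(-1) ^ (N + 1) * X * (q - (N ! : k)⁻¹ • p ^ N)) := by
        rw [hs, smul_eq_C_mul, neg_pow (X : k[X]) (N + 1)]; ring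
      rw [e, coeff_add, coeff_X_pow_mul', if_neg (by omega), add_zero]
    rw [add_mul, one_mul, coeff_add, coeff_derivative] at h1
    rcases m with _ | m
    · simpa using h1
    · rw [coeff_X_mul, coeff_derivative] at h1
      push_cast at h1 ⊢
      linear_combination h1
  have hq0 : q.coeff 0 = 1 := by
    have hp0 : p.coeff 0 = 0 := by rwa [← X_dvd_iff]
    rw [hq, expSum, coeff_zero_eq_eval_zero, eval_finsetSum, sum_range_succ', sum_eq_zero]
    · simp
    · intro m _
      rw [eval_smul, eval_pow, ← coeff_zero_eq_eval_zero, hp0]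
      simp
  have hq1 : 0 < N → q.coeff 1 = 1 := fun h => by
    have := hcoef 0 h
    rw [hq0] at this
    simpa using this
  have hq2 : ∀ m, m + 2 ≤ N → q.coeff (m + 2) = 0 := by
    intro m
    induction m with
    | zero =>
      intro h
      have := hcoef 1 (by omega)
      rw [hq1 (by omega)] at this
      norm_num at this
      exact this
    | succ m ih =>
      intro h
      have := hcoef (m + 2) (by omega)
      rw [ih (by omega), mul_zero, add_zero] at this
      refine (mul_eq_zero.mp this).resolve_left ?_
      exact_mod_cast (m + 2).succ_ne_zero
  rw [X_pow_dvd_iff]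
  intro d hd
  rcases d with _ | _ | d
  · simp [hq0]
  · simp [hq1 (by omega), coeff_one]
  · rw [coeff_sub, hq2 d (by omega)]
    simp [coeff_one, coeff_X]

/-- `exp (log (1 + w)) = 1 + w` for nilpotent `w`. -/
theorem expSum_logSum {A : Type*} [Ring A] [Algebra k A] {N : ℕ} {w : A} (hw : w ^ (N + 1) = 0) :
    expSum k (N + 1) (logSum k (N + 1) w) = 1 + w := by
  obtain ⟨r, hr⟩ := X_pow_dvd_expSum_logSum (k := k) N
  have := congrArg (aeval w) hr
  rw [map_mul, map_pow, aeval_X, hw, zero_mul] at this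
  simp only [expSum, logSum, map_sub, map_sum, map_smul, map_pow, map_add, map_one,
    aeval_X] at this ⊢
  exact sub_eq_zero.mp this

section Commutative

variable {R : Type*} [CommRing R] [Algebra k R]

omit [CharZero k] in
theorem one_sub_mul_sum_complete (s t : R) (K : ℕ) :
    (1 - s) * ∑ m ∈ range (K + 1), ∑ p ∈ antidiagonal m, s ^ p.1 * t ^ p.2 =
      ∑ m ∈ range (K + 1), t ^ m - s * ∑ p ∈ antidiagonal K, s ^ p.1 * t ^ p.2 := by
  have hstep : ∀ m, ∑ p ∈ antidiagonal (m + 1), s ^ p.1 * t ^ p.2 =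
      t ^ (m + 1) + s * ∑ p ∈ antidiagonal m, s ^ p.1 * t ^ p.2 := by
    intro m
    rw [Nat.sum_antidiagonal_succ, mul_sum]
    simp only [pow_zero, one_mul]
    congr 1
    exact sum_congr rfl fun p _ => by ring
  induction K with
  | zero => simp
  | succ K ih =>
    rw [sum_range_succ, mul_add, ih, sum_range_succ _ (K + 1), hstep]
    ring

/-- The divided difference of `log (1 + z)` at nilpotent elements `x` and `y`: if `v` is the
inverse of `1 + y`, then `log (1 + x) - log (1 + y) = log (1 + (x - y) v)`, divided by `x - y`.
Both sides are scaled by a variable; then they have the same derivative. -/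
theorem logQuot_mul_eq_sum {N K : ℕ} {x y v : R} (hv : (1 + y) * v = 1) (hx : x ^ N = 0)
    (hy : y ^ N = 0) (hK : 2 * N ≤ K) :
    logQuot k K ((x - y) * v) * v =
      ∑ m ∈ range K, ((-1) ^ m * ((m : k) + 1)⁻¹) • ∑ p ∈ antidiagonal m, x ^ p.1 * y ^ p.2 := by
  rcases subsingleton_or_nontrivial R with hR | hR
  · exact Subsingleton.elim _ _
  have hN : N ≠ 0 := by rintro rfl; simp at hx
  obtain ⟨K, rfl⟩ : ∃ K', K = K' + 1 := ⟨K - 1, by omega⟩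
  have hxy : ∀ i j, 2 * N ≤ i + j + 1 → x ^ i * y ^ j = 0 := by
    intro i j hij
    rcases le_or_gt N i with h | h
    · rw [pow_eq_zero_of_le h hx, zero_mul]
    · rw [pow_eq_zero_of_le (by omega) hy, mul_zero]
  have hc : (x - y) ^ (K + 1) = 0 := by
    rw [sub_eq_add_neg, add_pow]
    refine sum_eq_zero fun j hj => ?_
    rw [mem_range] at hj
    rw [neg_pow y, mul_left_comm, hxy j (K + 1 - j) (by omega)]
    simp
  set Y : R[X] := ∑ j ∈ range N, (-(X * C y)) ^ j with hY
  have hY1 : Y * (1 + X * C y) = 1 := by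
    rw [hY, ← sub_neg_eq_add, geom_sum_mul_neg, neg_pow, mul_pow, ← C_pow, hy]
    simp
  set P : R[X] := ∑ m ∈ range (K + 1), ((-1) ^ m * ((m : k) + 1)⁻¹) •
    (C (x - y) ^ m * (X * Y) ^ (m + 1)) with hP
  set S : R[X] := ∑ m ∈ range (K + 1), ((-1) ^ m * ((m : k) + 1)⁻¹) •
    (X ^ (m + 1) * C (∑ p ∈ antidiagonal m, x ^ p.1 * y ^ p.2)) with hS
  have hcancel : ∀ (m : ℕ) (q : R[X]),
      ((-1) ^ m * ((m : k) + 1)⁻¹) • (((m : R[X]) + 1) * q) = (-1) ^ m * q := by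
    intro m q
    have hm : ((m : k) + 1) ≠ 0 := by exact_mod_cast m.succ_ne_zero
    have e : ((m : R[X]) + 1) * q = ((m : k) + 1) • q := by
      rw [Algebra.smul_def]; simp
    rw [e, smul_smul, mul_assoc, inv_mul_cancel₀ hm, mul_one, Algebra.smul_def]
    simp
  set ρ : R[X] := X * Y with hρ
  have hρ1 : ρ * (1 + X * C y) = X := by rw [hρ, mul_assoc, hY1, mul_one]
  have hρ' : derivative ρ * (1 + X * C y) ^ 2 = 1 := by
    have := congrArg derivative hρ1
    simp only [derivative_mul, derivative_add, derivative_one, derivative_X, derivative_C] at this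
    linear_combination (1 + X * C y) * this - C y * hρ1
  have hP' : derivative P * (1 + C (x - y) * ρ) = derivative ρ := by
    have e : derivative P = derivative ρ * ∑ m ∈ range (K + 1), (-(C (x - y) * ρ)) ^ m := by
      rw [hP, map_sum, mul_sum]
      refine sum_congr rfl fun m _ => ?_
      rw [derivative_smul, ← C_pow, derivative_C_mul, derivative_pow_succ]
      have : C ((x - y) ^ m) * (C ((m : R) + 1) * ρ ^ m * derivative ρ) =
          ((m : R[X]) + 1) * (C ((x - y) ^ m) * ρ ^ m * derivative ρ) := by
        rw [C_add, C_1, C_eq_natCast]; ring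
      rw [this, hcancel, neg_pow, mul_pow, C_pow]
      ring
    rw [e, ← sub_neg_eq_add, mul_assoc, geom_sum_mul_neg, neg_pow, mul_pow, ← C_pow, hc]
    simp
  have hS' : derivative S * ((1 + X * C x) * (1 + X * C y)) = 1 := by
    have e : derivative S = ∑ m ∈ range (K + 1), ∑ p ∈ antidiagonal m,
        (-(X * C x)) ^ p.1 * (-(X * C y)) ^ p.2 := by
      rw [hS, map_sum]
      refine sum_congr rfl fun m _ => ?_
      rw [derivative_smul, derivative_mul, derivative_X_pow, derivative_C, mul_zero, add_zero]
      push_cast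
      rw [mul_assoc, C_add, C_1, C_eq_natCast, hcancel, map_sum, mul_sum,
        mul_sum]
      refine sum_congr rfl fun p hp => ?_
      rw [HasAntidiagonal.mem_antidiagonal] at hp
      rw [neg_pow, neg_pow (X * C y), ← hp, C_mul, C_pow, C_pow]
      ring
    have h0 : -(X * C x) * ∑ p ∈ antidiagonal K,
        (-(X * C x)) ^ p.1 * (-(X * C y)) ^ p.2 = 0 := by
      rw [mul_sum]
      refine sum_eq_zero fun p hp => ?_
      rw [HasAntidiagonal.mem_antidiagonal] at hp
      have := hxy (p.1 + 1) p.2 (by omega)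
      have h' : C x ^ (p.1 + 1) * C y ^ p.2 = 0 := by rw [← C_pow, ← C_pow, ← C_mul, this, C_0]
      rw [neg_pow, neg_pow (X * C y)]
      linear_combination (-1 * (-1) ^ p.1 * (-1) ^ p.2 * X ^ (p.1 + 1) * X ^ p.2) * h'
    have h1 := one_sub_mul_sum_complete (-(X * C x)) (-(X * C y)) K
    rw [h0, sub_zero, ← e, sub_neg_eq_add] at h1
    rw [← mul_assoc, mul_comm _ (1 + X * C x), h1, ← sub_neg_eq_add, geom_sum_mul_neg, neg_pow,
      mul_pow, ← C_pow, pow_eq_zero_of_le (by omega) hy]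
    simp
  have hPS : derivative P = derivative S := by
    have h1 : derivative P * ((1 + X * C x) * (1 + X * C y)) = 1 := by
      have : (1 + C (x - y) * ρ) * (1 + X * C y) = 1 + X * C x := by
        rw [C_sub]; linear_combination (C x - C y) * hρ1
      rw [← this]
      linear_combination (1 + X * C y) ^ 2 * hP' + hρ'
    linear_combination derivative S * h1 - derivative P * hS'
  have h1 : P.eval 1 = S.eval 1 := by
    have e1 := unitIntegral_derivative (k := k) P
    have e2 := unitIntegral_derivative (k := k) S
    have e3 : P.eval 0 = 0 := by
      rw [hP, eval_finsetSum]; exact sum_eq_zero fun m _ => by rw [hρ]; simp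
    have e4 : S.eval 0 = 0 := by
      rw [hS, eval_finsetSum]; exact sum_eq_zero fun m _ => by simp
    rw [hPS, e2, e3, e4, sub_zero, sub_zero] at e1
    exact e1.symm
  have hYv : Y.eval 1 = v := by
    have := congrArg (eval 1) hY1
    simp only [eval_mul, eval_add, eval_one, eval_X, eval_C, one_mul] at this
    linear_combination v * this - Y.eval 1 * hv
  rw [hP, hS, eval_finsetSum, eval_finsetSum] at h1
  rw [logQuot, sum_mul]
  convert h1 using 2 with m _ m _
  · rw [eval_smul, eval_mul, eval_pow, eval_C, eval_pow, hρ, eval_mul, eval_X, hYv, one_mul,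
      smul_mul_assoc, mul_pow, pow_succ v]
    congr 1
    ring
  · simp [eval_finsetSum]

end Commutative

/-- The noncommutative form of `logQuot_mul_eq_sum`. -/
theorem logQuot_mul_eq_sum_of_commute {A : Type*} [Ring A] [Algebra k A] {N K : ℕ} {x y v : A}
    (hxy : Commute x y) (hv : (1 + y) * v = 1) (hx : x ^ N = 0) (hy : y ^ N = 0)
    (hK : 2 * N ≤ K) :
    logQuot k K ((x - y) * v) * v =
      ∑ m ∈ range K, ((-1) ^ m * ((m : k) + 1)⁻¹) • ∑ p ∈ antidiagonal m, x ^ p.1 * y ^ p.2 := by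
  let B := Algebra.adjoin k ({x, y} : Set A)
  have : IsMulCommutative B := Algebra.isMulCommutative_adjoin k (s := ({x, y} : Set A)) (by
    rintro a (rfl | rfl) b (rfl | rfl)
    exacts [rfl, hxy, hxy.symm, rfl])
  let _ : CommRing B := { B.toRing with mul_comm := fun a b => this.is_comm.comm a b }
  let x' : B := ⟨x, Algebra.subset_adjoin (by simp)⟩
  let y' : B := ⟨y, Algebra.subset_adjoin (by simp)⟩
  let v' : B := ∑ j ∈ range N, (-y') ^ j
  have hx' : x' ^ N = 0 := Subtype.ext (by simpa using hx)
  have hy' : y' ^ N = 0 := Subtype.ext (by simpa using hy)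
  have hv' : (1 + y') * v' = 1 := by
    rw [← sub_neg_eq_add, mul_neg_geom_sum, neg_pow, hy', mul_zero, sub_zero]
  have hvv : (v' : A) = v := by
    have h1 : (v' : A) * (1 + y) = 1 := by
      have := congrArg (B.val) hv'
      rw [mul_comm] at this
      simpa using this
    calc (v' : A) = v' * ((1 + y) * v) := by rw [hv, mul_one]
      _ = v := by rw [← mul_assoc, h1, one_mul]
  have h := congrArg B.val (logQuot_mul_eq_sum (k := k) hv' hx' hy' hK)
  simpa only [logQuot, map_mul, map_sum, map_smul, map_pow, map_sub, Subalgebra.coe_val, hvv]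
    using h

end ExpLog

/-! ### Sums over words -/

section Words

/-- The sum of `F w` over the words `w` of length `n` in the letters `0, …, N - 1`. -/
def wordSum {M : Type*} [AddCommMonoid M] (N : ℕ) : ℕ → (List ℕ → M) → M
  | 0, F => F []
  | n + 1, F => ∑ a ∈ range N, wordSum N n fun w => F (a :: w)

variable {M : Type*} [AddCommMonoid M] {N : ℕ}

theorem wordSum_congr {n : ℕ} {F G : List ℕ → M} (h : ∀ w : List ℕ, w.length = n → F w = G w) :
    wordSum N n F = wordSum N n G := by
  induction n generalizing F G with
  | zero => exact h [] rfl
  | succ n ih => exact sum_congr rfl fun a _ => ih fun w hw => h _ (by simp [hw])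

theorem wordSum_zero {n : ℕ} : wordSum N n (fun _ => (0 : M)) = 0 := by
  induction n with
  | zero => rfl
  | succ n ih => simp only [wordSum, ih, sum_const_zero]

theorem wordSum_eq_zero {n : ℕ} {F : List ℕ → M} (h : ∀ w : List ℕ, w.length = n → F w = 0) :
    wordSum N n F = 0 := by
  rw [wordSum_congr h, wordSum_zero]

theorem map_wordSum {M' : Type*} [AddCommMonoid M'] {Θ : Type*} [FunLike Θ M M']
    [AddMonoidHomClass Θ M M'] (θ : Θ) (n : ℕ) (F : List ℕ → M) :
    θ (wordSum N n F) = wordSum N n fun w => θ (F w) := by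
  induction n generalizing F with
  | zero => rfl
  | succ n ih => simp only [wordSum, map_sum, ih]

theorem wordSum_add {n : ℕ} (F G : List ℕ → M) :
    wordSum N n (fun w => F w + G w) = wordSum N n F + wordSum N n G := by
  induction n generalizing F G with
  | zero => rfl
  | succ n ih => simp only [wordSum, ih, sum_add_distrib]

theorem wordSum_sum {ι : Type*} (s : Finset ι) {n : ℕ} (F : ι → List ℕ → M) :
    wordSum N n (fun w => ∑ i ∈ s, F i w) = ∑ i ∈ s, wordSum N n (F i) := by
  induction n generalizing F with
  | zero => rfl
  | succ n ih => simp only [wordSum, ih]; rw [sum_comm]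

theorem wordSum_append (m n : ℕ) (F : List ℕ → M) :
    wordSum N (m + n) F = wordSum N m fun w => wordSum N n fun w' => F (w ++ w') := by
  induction m generalizing F with
  | zero => simp [wordSum]
  | succ m ih => rw [Nat.succ_add]; simp only [wordSum, ih, List.cons_append]

theorem wordSum_mem {S : Type*} [SetLike S M] [AddSubmonoidClass S M] (s : S) {n : ℕ}
    {F : List ℕ → M} (h : ∀ w : List ℕ, w.length = n → F w ∈ s) : wordSum N n F ∈ s := by
  induction n generalizing F with
  | zero => exact h [] rfl
  | succ n ih => exact sum_mem fun a _ => ih fun w hw => h _ (by simp [hw])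

theorem wordSum_eq_sum_piFinset (n : ℕ) (F : List ℕ → M) :
    wordSum N n F = ∑ y ∈ Fintype.piFinset fun _ : Fin n => range N, F (List.ofFn y) := by
  induction n generalizing F with
  | zero =>
    simp [wordSum]
  | succ n ih =>
    simp only [wordSum, ih]
    rw [← sum_product']
    refine sum_bij' (fun p _ => (Fin.cons p.1 p.2 : Fin (n + 1) → ℕ))
      (fun y _ => (y 0, Fin.tail y)) ?_ ?_ ?_ ?_ ?_
    · intro p hp
      rw [mem_product, Fintype.mem_piFinset] at hp
      rw [Fintype.mem_piFinset]
      exact Fin.cases hp.1 hp.2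
    · intro y hy
      rw [Fintype.mem_piFinset] at hy
      rw [mem_product, Fintype.mem_piFinset]
      exact ⟨hy 0, fun i => hy i.succ⟩
    · intro p _
      simp
    · intro y _
      simp
    · intro p _
      simp [List.ofFn_succ]

end Words

/-! ### Filtered algebras and polynomials -/

section Filtered

variable {k : Type*} [Field k] {A : Type*} [Ring A] [Algebra k A]

/-- A descending multiplicative filtration of an algebra. -/
structure IsAlgFiltration (J : ℕ → Submodule k A) : Prop where
  one_mem : 1 ∈ J 0
  mul_mem : ∀ {p q : ℕ} {a b : A}, a ∈ J p → b ∈ J q → a * b ∈ J (p + q)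
  antitone : Antitone J

theorem IsAlgFiltration.pow_mem {J : ℕ → Submodule k A} (hJ : IsAlgFiltration J) {a : A}
    (ha : a ∈ J 1) (n : ℕ) : a ^ n ∈ J n := by
  induction n with
  | zero => simpa using hJ.one_mem
  | succ n ih => rw [pow_succ]; exact hJ.mul_mem ih ha

theorem IsAlgFiltration.mul_mem_left {J : ℕ → Submodule k A} (hJ : IsAlgFiltration J) {p : ℕ}
    {a b : A} (ha : a ∈ J 0) (hb : b ∈ J p) : a * b ∈ J p := by
  simpa using hJ.mul_mem ha hb

theorem IsAlgFiltration.mul_mem_right {J : ℕ → Submodule k A} (hJ : IsAlgFiltration J) {p : ℕ}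
    {a b : A} (ha : a ∈ J p) (hb : b ∈ J 0) : a * b ∈ J p := by
  simpa using hJ.mul_mem ha hb

/-- The polynomials with coefficients in a subspace. -/
def polySub (S : Submodule k A) : Submodule k A[X] where
  carrier := {f | ∀ n, f.coeff n ∈ S}
  add_mem' hf hg n := by rw [coeff_add]; exact S.add_mem (hf n) (hg n)
  zero_mem' n := by rw [coeff_zero]; exact S.zero_mem
  smul_mem' c f hf n := by rw [coeff_smul]; exact S.smul_mem c (hf n)

theorem IsAlgFiltration.polySub {J : ℕ → Submodule k A} (hJ : IsAlgFiltration J) :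
    IsAlgFiltration fun p => polySub (J p) where
  one_mem n := by
    rw [coeff_one]
    split_ifs
    exacts [hJ.one_mem, (J 0).zero_mem]
  mul_mem hf hg n := by
    rw [coeff_mul]
    exact sum_mem fun p _ => hJ.mul_mem (hf p.1) (hg p.2)
  antitone _ _ h _ hf n := hJ.antitone h (hf n)

theorem eq_zero_of_mem_polySub_bot {f : A[X]} (hf : f ∈ polySub (⊥ : Submodule k A)) : f = 0 := by
  ext n
  simpa using hf n

/-- A polynomial with value `0` at `1` has its coefficients in a subspace if its derivative has. -/
theorem mem_polySub_of_derivative [CharZero k] {S : Submodule k A} {f : A[X]}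
    (hf : derivative f ∈ polySub S) (h1 : f.eval 1 = 0) : f ∈ polySub S := by
  have hs : ∀ n, f.coeff (n + 1) ∈ S := fun n => by
    have h := hf n
    have hn : ((n : k) + 1) ≠ 0 := by exact_mod_cast n.succ_ne_zero
    rw [coeff_derivative] at h
    have e : f.coeff (n + 1) * ((n : A) + 1) = ((n : k) + 1) • f.coeff (n + 1) := by
      rw [Algebra.smul_def, Algebra.commutes]; simp
    rw [e] at h
    have := S.smul_mem (((n : k) + 1)⁻¹) h
    rwa [smul_smul, inv_mul_cancel₀ hn, one_smul] at this
  rintro (_ | n)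
  · rw [eval_eq_sum_range, sum_range_succ'] at h1
    have : f.coeff 0 = -∑ m ∈ range f.natDegree, f.coeff (m + 1) := by
      simp only [one_pow, mul_one] at h1
      exact (neg_eq_of_add_eq_zero_right h1).symm
    rw [this]
    exact S.neg_mem (sum_mem fun m _ => hs m)
  · exact hs n

/-- The polynomial `q c` with coefficients in `A`, for a scalar polynomial `q` and `c ∈ A`. -/
def polyTensor : k[X] →ₗ[k] A →ₗ[k] A[X] :=
  LinearMap.mk₂ k (fun q c => q.map (algebraMap k A) * C c)
    (by intro q q' c; simp [add_mul])
    (by intro t q c; simp [Algebra.smul_def, mul_assoc])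
    (by intro q c c'; simp [mul_add])
    (by intro t q c; rw [← smul_C, mul_smul_comm])

theorem polyTensor_apply (q : k[X]) (c : A) :
    polyTensor q c = q.map (algebraMap k A) * C c := rfl

theorem coeff_polyTensor (q : k[X]) (c : A) (n : ℕ) :
    (polyTensor q c).coeff n = q.coeff n • c := by
  rw [polyTensor_apply, coeff_mul_C, coeff_map, Algebra.smul_def]

theorem commute_map_algebraMap (q : k[X]) (f : A[X]) :
    Commute (q.map (algebraMap k A)) f := by
  induction q using Polynomial.induction_on' with
  | add p q hp hq => rw [Polynomial.map_add]; exact hp.add_left hq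
  | monomial n a =>
    rw [map_monomial, ← C_mul_X_pow_eq_monomial]
    refine Commute.mul_left ?_ (commute_X_pow f n)
    ext m
    rw [coeff_C_mul, coeff_mul_C, Algebra.commutes]

theorem polyTensor_mul (q r : k[X]) (c d : A) :
    polyTensor q c * polyTensor r d = polyTensor (q * r) (c * d) := by
  rw [polyTensor_apply, polyTensor_apply, polyTensor_apply, Polynomial.map_mul, C_mul, mul_assoc,
    ← mul_assoc (C c), ← (commute_map_algebraMap r (C c)).eq, mul_assoc, mul_assoc]

theorem polyTensor_one_one : polyTensor (1 : k[X]) (1 : A) = 1 := by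
  simp [polyTensor_apply]

theorem derivative_polyTensor (q : k[X]) (c : A) :
    derivative (polyTensor q c) = polyTensor (derivative q) c := by
  rw [polyTensor_apply, polyTensor_apply, derivative_mul, derivative_C, mul_zero, add_zero,
    derivative_map]

theorem eval_one_polyTensor (q : k[X]) (c : A) :
    (polyTensor q c).eval 1 = q.eval 1 • c := by
  induction q using Polynomial.induction_on' with
  | add p q hp hq => rw [map_add, LinearMap.add_apply, eval_add, hp, hq, eval_add, add_smul]
  | monomial n a =>
    rw [polyTensor_apply, map_monomial, monomial_mul_C, eval_monomial, eval_monomial,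
      Algebra.smul_def]
    simp

theorem unitIntegral_polyTensor (q : k[X]) (c : A) :
    unitIntegral k (polyTensor q c) = unitIntegral k q • c := by
  induction q using Polynomial.induction_on' with
  | add p q hp hq => rw [map_add, LinearMap.add_apply, map_add, hp, hq, map_add, add_smul]
  | monomial n a =>
    rw [polyTensor_apply, map_monomial, monomial_mul_C, unitIntegral_monomial,
      unitIntegral_monomial, ← Algebra.smul_def, smul_smul, smul_eq_mul]

theorem polyTensor_mem {S : Submodule k A} (q : k[X]) {c : A} (hc : c ∈ S) :
    polyTensor q c ∈ polySub S := fun n => by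
  rw [coeff_polyTensor]; exact S.smul_mem _ hc

end Filtered

/-! ### Time-ordered exponentials -/

section Flow

variable {k : Type*} [Field k] {A : Type*} [Ring A] [Algebra k A]

/-- The product of the letters of a word, with the first letter on the right. -/
def revProd (x : ℕ → A) : List ℕ → A
  | [] => 1
  | a :: w => revProd x w * x a

/-- The iterated commutator with the letters of a word, where the first letter acts first. -/
def adWord (x : ℕ → A) : List ℕ → A → A
  | [], c => c
  | a :: w, c => adWord x w ⁅x a, c⁆

theorem adWord_append (x : ℕ → A) (w w' : List ℕ) (c : A) :
    adWord x (w ++ w') c = adWord x w' (adWord x w c) := by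
  induction w generalizing c with
  | nil => rfl
  | cons a w ih => exact ih _

/-- The polynomial `g(s) = ∑_a s^a x_a`. -/
def letterPoly (k : Type*) [Field k] [Algebra k A] (x : ℕ → A) (N : ℕ) : A[X] :=
  ∑ a ∈ range N, polyTensor (X ^ a : k[X]) (x a)

/-- The time-ordered exponential `V(s)` of `g` over the interval from `s` to `1`, with later times
on the left. It is the solution of `V' = -V g`, `V(1) = 1`. -/
def timeOrdered (k : Type*) [Field k] [Algebra k A] (x : ℕ → A) (N : ℕ) : A[X] :=
  ∑ n ∈ range N, wordSum N n fun w => polyTensor (iterInt k w) (revProd x w)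

/-- The series `∑_w Q(w) ad_w (c)` that represents `V c V⁻¹`. -/
def conjSeries (k : Type*) [Field k] [Algebra k A] (x : ℕ → A) (N : ℕ) (c : A) : A[X] :=
  ∑ n ∈ range N, wordSum N n fun w => polyTensor (iterInt k w) (adWord x w c)

variable {J : ℕ → Submodule k A} (hJ : IsAlgFiltration J) {x : ℕ → A} (hx : ∀ a, x a ∈ J 1)
  {N : ℕ} (hN : J N = ⊥)

include hJ hx

theorem revProd_mem (w : List ℕ) : revProd x w ∈ J w.length := by
  induction w with
  | nil => exact hJ.one_mem
  | cons a w ih => exact hJ.mul_mem ih (hx a)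

theorem lie_mem (a : ℕ) {p : ℕ} {c : A} (hc : c ∈ J p) : ⁅x a, c⁆ ∈ J (p + 1) := by
  rw [Ring.lie_def]
  refine (J (p + 1)).sub_mem ?_ (hJ.mul_mem hc (hx a))
  rw [add_comm]
  exact hJ.mul_mem (hx a) hc

theorem adWord_mem {p : ℕ} {c : A} (hc : c ∈ J p) (w : List ℕ) :
    adWord x w c ∈ J (p + w.length) := by
  induction w generalizing c p with
  | nil => exact hc
  | cons a w ih =>
    have := ih (lie_mem hJ hx a hc)
    rwa [add_assoc, add_comm 1] at this

omit hx in
include hN in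
theorem eq_zero_of_mem {p : ℕ} (hp : N ≤ p) {a : A} (ha : a ∈ J p) : a = 0 := by
  have := hJ.antitone hp ha
  rwa [hN, Submodule.mem_bot] at this

end Flow

section Flow

/-- Evaluation at `1`, as a ring homomorphism for polynomials with noncommuting coefficients. -/
def evalOne {A : Type*} [Ring A] : A[X] →+* A :=
  eval₂RingHom' (RingHom.id A) 1 fun a => Commute.one_right a

theorem evalOne_apply {A : Type*} [Ring A] (p : A[X]) : evalOne p = p.eval 1 := rfl

variable {k : Type*} [Field k] [CharZero k] {A : Type*} [Ring A] [Algebra k A]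
  {J : ℕ → Submodule k A} (hJ : IsAlgFiltration J) {x : ℕ → A} (hx : ∀ a, x a ∈ J 1)
  {N : ℕ} (hN : J N = ⊥)

include hJ hx hN

theorem derivative_timeOrdered :
    derivative (timeOrdered k x N) = -(timeOrdered k x N * letterPoly k x N) := by
  set S : ℕ → A[X] := fun n => wordSum N n fun w => polyTensor (iterInt k w) (revProd x w) with hS
  have hSN : S N = 0 := wordSum_eq_zero fun w hw => by
    rw [eq_zero_of_mem hJ hN hw.ge (revProd_mem hJ hx w), map_zero]
  have hS0 : derivative (S 0) = 0 := by
    simp [hS, wordSum, iterInt, revProd, polyTensor_apply]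
  have hstep : ∀ n, derivative (S (n + 1)) = -(S n * letterPoly k x N) := fun n => by
    simp only [hS, wordSum, letterPoly]
    rw [map_sum, mul_sum, ← sum_neg_distrib]
    refine sum_congr rfl fun a _ => ?_
    have h := map_wordSum (N := N) (-(LinearMap.mulRight k (polyTensor (X ^ a : k[X]) (x a)))) n
      fun w => polyTensor (iterInt k w) (revProd x w)
    simp only [LinearMap.neg_apply, LinearMap.mulRight_apply] at h
    rw [map_wordSum, h]
    refine wordSum_congr fun w _ => ?_
    rw [derivative_polyTensor, derivative_iterInt_cons, polyTensor_mul, mul_comm (X ^ a), map_neg,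
      LinearMap.neg_apply]
    rfl
  have h1 : timeOrdered k x N = ∑ n ∈ range (N + 1), S n := by
    rw [sum_range_succ, hSN, add_zero]; rfl
  conv_lhs => rw [h1, sum_range_succ', map_add, hS0, add_zero, map_sum,
    sum_congr rfl fun n _ => hstep n, sum_neg_distrib, ← sum_mul]
  rfl

theorem derivative_conjSeries {c : A} (hc : c ∈ J 0) :
    derivative (conjSeries k x N c) = -∑ a ∈ range N, X ^ a * conjSeries k x N ⁅x a, c⁆ := by
  set S : ℕ → A → A[X] := fun n c => wordSum N n fun w => polyTensor (iterInt k w) (adWord x w c)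
    with hS
  have hSN : S N c = 0 := wordSum_eq_zero fun w hw => by
    rw [eq_zero_of_mem hJ hN (by omega) (adWord_mem hJ hx hc w), map_zero]
  have hS0 : derivative (S 0 c) = 0 := by
    simp [hS, wordSum, iterInt, adWord, polyTensor_apply]
  have hstep : ∀ n, derivative (S (n + 1) c) = -∑ a ∈ range N, X ^ a * S n ⁅x a, c⁆ := fun n => by
    simp only [hS, wordSum]
    rw [map_sum, ← sum_neg_distrib]
    refine sum_congr rfl fun a _ => ?_
    have h := map_wordSum (N := N) (-(LinearMap.mulLeft k (X ^ a : A[X]))) n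
      fun w => polyTensor (iterInt k w) (adWord x w ⁅x a, c⁆)
    simp only [LinearMap.neg_apply, LinearMap.mulLeft_apply] at h
    rw [map_wordSum, h]
    refine wordSum_congr fun w _ => ?_
    rw [derivative_polyTensor, derivative_iterInt_cons, map_neg, LinearMap.neg_apply, adWord]
    congr 1
    rw [polyTensor_apply, polyTensor_apply, Polynomial.map_mul, mul_assoc]
    simp
  have h1 : conjSeries k x N c = ∑ n ∈ range (N + 1), S n c := by
    rw [sum_range_succ, hSN, add_zero]; rfl
  rw [h1, sum_range_succ', map_add, hS0, add_zero, map_sum, sum_congr rfl fun n _ => hstep n,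
    sum_neg_distrib, sum_comm]
  simp only [← mul_sum]
  rfl

omit hJ hx hN [CharZero k] in
theorem eval_one_timeOrdered (h0 : 0 < N) : (timeOrdered k x N).eval 1 = 1 := by
  obtain ⟨N', rfl⟩ : ∃ N', N = N' + 1 := ⟨N - 1, by omega⟩
  rw [timeOrdered, sum_range_succ', eval_add, eval_finsetSum, sum_eq_zero]
  · simp [wordSum, iterInt, revProd, polyTensor_one_one]
  · intro n _
    rw [← evalOne_apply, map_wordSum, wordSum_eq_zero]
    intro w hw
    rw [evalOne_apply, eval_one_polyTensor, eval_one_iterInt (by rintro rfl; simp at hw), zero_smul]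

omit hN [CharZero k] in
theorem timeOrdered_sub_one_mem (h0 : 0 < N) : timeOrdered k x N - 1 ∈ polySub (J 1) := by
  obtain ⟨N', rfl⟩ : ∃ N', N = N' + 1 := ⟨N - 1, by omega⟩
  have e : wordSum (N' + 1) 0 (fun w => polyTensor (iterInt k w) (revProd x w)) = 1 := by
    simp [wordSum, iterInt, revProd, polyTensor_one_one]
  rw [timeOrdered, sum_range_succ', e, add_sub_cancel_right]
  refine sum_mem fun n _ => wordSum_mem _ fun w hw => polyTensor_mem _ ?_
  exact hJ.antitone (by omega) (revProd_mem hJ hx w)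

omit hJ hx hN [CharZero k] in
theorem eval_one_conjSeries (h0 : 0 < N) (c : A) : (conjSeries k x N c).eval 1 = c := by
  obtain ⟨N', rfl⟩ : ∃ N', N = N' + 1 := ⟨N - 1, by omega⟩
  rw [conjSeries, sum_range_succ', eval_add, eval_finsetSum, sum_eq_zero]
  · simp [wordSum, iterInt, adWord, eval_one_polyTensor]
  · intro n _
    rw [← evalOne_apply, map_wordSum, wordSum_eq_zero]
    intro w hw
    rw [evalOne_apply, eval_one_polyTensor, eval_one_iterInt (by rintro rfl; simp at hw), zero_smul]

omit hN [CharZero k] in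
theorem conjSeries_mem {p : ℕ} {c : A} (hc : c ∈ J p) : conjSeries k x N c ∈ polySub (J p) :=
  sum_mem fun _ _ => wordSum_mem _ fun w _ =>
    polyTensor_mem _ (hJ.antitone (by omega) (adWord_mem hJ hx hc w))

/-- Conjugation with the time-ordered exponential: both sides solve the same linear differential
equation. -/
theorem conjSeries_mul (h0 : 0 < N) {c : A} (hc : c ∈ J 0) :
    conjSeries k x N c * timeOrdered k x N = timeOrdered k x N * C c := by
  set V := timeOrdered k x N with hV
  set T := conjSeries k x N with hT
  have hV0 : V ∈ polySub (J 0) := by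
    have := (polySub (J 0)).add_mem (hJ.polySub.antitone (Nat.zero_le 1)
      (timeOrdered_sub_one_mem (k := k) hJ hx h0)) hJ.polySub.one_mem
    simpa using this
  have key : ∀ m p c, c ∈ J p → T c * V - V * C c ∈ polySub (J (p + m)) := by
    intro m
    induction m with
    | zero =>
      intro p c hc
      have hC : C c ∈ polySub (J p) := fun n => by
        rw [coeff_C]
        split_ifs
        exacts [hc, (J p).zero_mem]
      exact (polySub (J p)).sub_mem
        (hJ.polySub.mul_mem_right (conjSeries_mem hJ hx hc) hV0)
        (hJ.polySub.mul_mem_left hV0 hC)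
    | succ m ih =>
      intro p c hc
      refine mem_polySub_of_derivative ?_ ?_
      · have hc0 : c ∈ J 0 := hJ.antitone (Nat.zero_le p) hc
        have e : derivative (T c * V - V * C c) = -∑ a ∈ range N, X ^ a *
            ((T ⁅x a, c⁆ * V - V * C ⁅x a, c⁆) + (T c * V - V * C c) * C (x a)) := by
          rw [derivative_sub, derivative_mul, derivative_mul, derivative_C,
            derivative_timeOrdered hJ hx hN, derivative_conjSeries hJ hx hN hc0, ← hV, ← hT]
          have e1 : T c * V * letterPoly k x N = ∑ a ∈ range N, X ^ a * (T c * V * C (x a)) := by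
            rw [letterPoly, mul_sum]
            refine sum_congr rfl fun a _ => ?_
            rw [polyTensor_apply]
            simp only [Polynomial.map_pow, map_X]
            rw [← mul_assoc, ← X_pow_mul, mul_assoc]
          have e2 : V * letterPoly k x N * C c = ∑ a ∈ range N, X ^ a * (V * C (x a) * C c) := by
            rw [letterPoly, mul_sum, sum_mul]
            refine sum_congr rfl fun a _ => ?_
            rw [polyTensor_apply]
            simp only [Polynomial.map_pow, map_X]
            rw [← mul_assoc, ← X_pow_mul, mul_assoc, mul_assoc, mul_assoc]
          rw [neg_mul, mul_neg, neg_mul, ← mul_assoc, e1, e2, sum_mul, ← sum_neg_distrib,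
            ← sum_neg_distrib, ← sum_neg_distrib, ← sum_neg_distrib, mul_zero, add_zero,
            ← sum_add_distrib, ← sum_sub_distrib]
          refine sum_congr rfl fun a _ => ?_
          rw [Ring.lie_def, C_sub, C_mul, C_mul]
          noncomm_ring
        rw [e]
        refine Submodule.neg_mem _ (sum_mem fun a _ => ?_)
        have hXa : (X ^ a : A[X]) ∈ polySub (J 0) := fun n => by
          rw [coeff_X_pow]
          split_ifs
          exacts [hJ.one_mem, (J 0).zero_mem]
        refine hJ.polySub.mul_mem_left hXa (Submodule.add_mem _ ?_ ?_)
        · have := ih (p + 1) _ (lie_mem hJ hx a hc)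
          rwa [add_assoc, add_comm 1] at this
        · have hC : C (x a) ∈ polySub (J 1) := fun n => by
            rw [coeff_C]
            split_ifs
            exacts [hx a, (J 1).zero_mem]
          have := hJ.polySub.mul_mem (ih p c hc) hC
          rwa [add_assoc] at this
      · rw [← evalOne_apply, map_sub, map_mul, map_mul]
        simp only [evalOne_apply]
        rw [hV, hT, eval_one_timeOrdered h0, eval_one_conjSeries h0]
        simp
  have := key N 0 c hc
  rw [zero_add, hN] at this
  exact sub_eq_zero.mp (eq_zero_of_mem_polySub_bot this)

end Flow

/-! ### The logarithm of a time-ordered exponential -/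

section Magnus

variable {k : Type*} [Field k] {A : Type*} [Ring A] [Algebra k A]

theorem derivative_pow_eq_sum (W : A[X]) (m : ℕ) :
    derivative (W ^ (m + 1)) = ∑ p ∈ antidiagonal m, W ^ p.1 * derivative W * W ^ p.2 := by
  induction m with
  | zero => simp
  | succ m ih =>
    rw [pow_succ', derivative_mul, ih, Nat.sum_antidiagonal_succ, mul_sum, pow_zero, one_mul]
    congr 1
    exact sum_congr rfl fun p _ => by rw [pow_succ']; simp only [mul_assoc]

variable {J : ℕ → Submodule k A} (hJ : IsAlgFiltration J) {x : ℕ → A} (hx : ∀ a, x a ∈ J 1)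
  {N : ℕ} (hN : J N = ⊥)

include hJ hN

theorem pow_eq_zero_of_mem_polySub {W : A[X]} (hW : W ∈ polySub (J 1)) : W ^ N = 0 := by
  have := hJ.polySub.pow_mem hW N
  rw [hN] at this
  exact eq_zero_of_mem_polySub_bot this

include hx

variable (k x N) in
/-- The operator `V · V⁻¹ - 1`, where `V` is the time-ordered exponential. -/
def conjSubOne : Module.End k A[X] :=
  LinearMap.mulLeft k (timeOrdered k x N) *
    LinearMap.mulRight k (∑ j ∈ range N, (-(timeOrdered k x N - 1)) ^ j) - 1

/-- The inverse of the unipotent element `V`, as a geometric series. -/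
theorem timeOrdered_mul_inv (h0 : 0 < N) :
    timeOrdered k x N * ∑ j ∈ range N, (-(timeOrdered k x N - 1)) ^ j = 1 := by
  have h := mul_neg_geom_sum (-(timeOrdered k x N - 1)) N
  rw [neg_pow, pow_eq_zero_of_mem_polySub hJ hN (timeOrdered_sub_one_mem hJ hx h0), mul_zero,
    sub_zero, sub_neg_eq_add, add_sub_cancel] at h
  exact h

variable [CharZero k]

/-- The operator `Ad V - 1` is the part of the series for `Ad V` over nonempty words. -/
theorem conjSubOne_polyTensor (h0 : 0 < N) (q : k[X]) {c : A} (hc : c ∈ J 0) :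
    conjSubOne k x N (polyTensor q c) =
      ∑ n ∈ Ico 1 N, wordSum N n fun w => polyTensor (q * iterInt k w) (adWord x w c) := by
  have h1 : timeOrdered k x N * C c * ∑ j ∈ range N, (-(timeOrdered k x N - 1)) ^ j =
      conjSeries k x N c := by
    rw [← conjSeries_mul hJ hx hN h0 hc, mul_assoc, timeOrdered_mul_inv hJ hx hN h0, mul_one]
  have h2 : conjSubOne k x N (polyTensor q c) =
      q.map (algebraMap k A) * conjSeries k x N c - polyTensor q c := by
    rw [conjSubOne, LinearMap.sub_apply, Module.End.mul_apply, LinearMap.mulLeft_apply,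
      LinearMap.mulRight_apply, Module.End.one_apply, polyTensor_apply, ← h1, mul_assoc, mul_assoc,
      ← mul_assoc _ (q.map _), ← (commute_map_algebraMap q (timeOrdered k x N)).eq, mul_assoc]
  obtain ⟨N', hN'⟩ : ∃ N', N = N' + 1 := ⟨N - 1, by omega⟩
  have h3 : conjSeries k x N c = C c + ∑ n ∈ Ico 1 N, wordSum N n fun w =>
      polyTensor (iterInt k w) (adWord x w c) := by
    rw [conjSeries, range_eq_Ico, sum_eq_sum_Ico_succ_bot h0]
    congr 1
    simp [wordSum, iterInt, adWord, polyTensor_apply]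
  rw [h2, h3, mul_add, polyTensor_apply, add_sub_cancel_left, mul_sum]
  refine sum_congr rfl fun n _ => ?_
  rw [← LinearMap.mulLeft_apply (R := k), map_wordSum]
  refine wordSum_congr fun w _ => ?_
  rw [LinearMap.mulLeft_apply, polyTensor_apply, polyTensor_apply, Polynomial.map_mul, mul_assoc]

/-- The powers of `Ad V - 1` are series of iterated commutators as well; the coefficient of a word
is a sum over its decompositions. -/
theorem conjSubOne_pow_polyTensor (h0 : 0 < N) (m : ℕ) (q : k[X]) {c : A} (hc : c ∈ J 0) :
    (conjSubOne k x N ^ m) (polyTensor q c) =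
      ∑ n ∈ range N, wordSum N n fun w => polyTensor (q * iterIntPow k m w) (adWord x w c) := by
  induction m with
  | zero =>
    obtain ⟨N', hN'⟩ : ∃ N', N = N' + 1 := ⟨N - 1, by omega⟩
    have e : ∀ n ∈ range N', (wordSum N (n + 1) fun w =>
        polyTensor (q * iterIntPow k 0 w) (adWord x w c)) = 0 := fun n _ =>
      wordSum_eq_zero fun w hw => by
        rw [iterIntPow, if_neg (by rintro rfl; simp at hw), mul_zero, map_zero,
          LinearMap.zero_apply]
    rw [pow_zero, Module.End.one_apply]
    conv_rhs => rw [hN', sum_range_succ', ← hN', sum_eq_zero e]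
    simp [wordSum, iterIntPow, adWord]
  | succ m ih =>
    set f : ℕ → ℕ → A[X] := fun n n' => wordSum N n fun w => wordSum N n' fun w' =>
      polyTensor (q * (iterIntPow k m w * iterInt k w')) (adWord x (w ++ w') c) with hf
    have hf0 : ∀ n n', N ≤ n + n' → f n n' = 0 := fun n n' h =>
      wordSum_eq_zero fun w hw => wordSum_eq_zero fun w' hw' => by
        rw [eq_zero_of_mem hJ hN (a := adWord x (w ++ w') c) (p := 0 + (w ++ w').length)
          (by simp; omega) (adWord_mem hJ hx hc _), map_zero]
    have hL : (conjSubOne k x N ^ (m + 1)) (polyTensor q c) =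
        ∑ n ∈ range N, ∑ n' ∈ Ico 1 N, f n n' := by
      rw [pow_succ', Module.End.mul_apply, ih, map_sum]
      refine sum_congr rfl fun n _ => ?_
      rw [map_wordSum, hf, ← wordSum_sum]
      refine wordSum_congr fun w hw => ?_
      rw [conjSubOne_polyTensor hJ hx hN h0 _
        (hJ.antitone (Nat.zero_le _) (adWord_mem hJ hx hc w))]
      refine sum_congr rfl fun n' _ => wordSum_congr fun w' _ => ?_
      rw [adWord_append, mul_assoc]
    have hR : ∀ t ∈ range N, (wordSum N t fun w =>
        polyTensor (q * iterIntPow k (m + 1) w) (adWord x w c)) =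
          ∑ n ∈ range t, f n (t - n) := fun t _ => by
      have : ∀ w : List ℕ, w.length = t →
          polyTensor (q * iterIntPow k (m + 1) w) (adWord x w c) =
          ∑ n ∈ range t, polyTensor (q * (iterIntPow k m (w.take n) * iterInt k (w.drop n)))
            (adWord x w c) := fun w hw => by
        rw [iterIntPow, hw, mul_sum, map_sum, LinearMap.sum_apply]
      rw [wordSum_congr this, wordSum_sum]
      refine sum_congr rfl fun n hn => ?_
      rw [mem_range] at hn
      conv_lhs => rw [show t = n + (t - n) by omega, wordSum_append]
      refine wordSum_congr fun w hw => wordSum_congr fun w' _ => ?_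
      rw [List.take_left' hw, List.drop_left' hw]
    rw [hL, sum_congr rfl hR]
    have hsw : ∑ t ∈ range N, ∑ n ∈ range t, f n (t - n) =
        ∑ n ∈ range N, ∑ t ∈ Ioo n N, f n (t - n) := by
      refine sum_comm' fun t n => ?_
      simp only [mem_range, mem_Ioo]
      omega
    rw [hsw]
    refine sum_congr rfl fun n hn => ?_
    rw [mem_range] at hn
    have e : Ioo n N = Ico (1 + n) (N - n + n) := by ext j; simp only [mem_Ioo, mem_Ico]; omega
    rw [e, ← sum_Ico_add' (fun t => f n (t - n)) 1 (N - n) n]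
    simp only [Nat.add_sub_cancel]
    symm
    refine sum_subset (Ico_subset_Ico_right (by omega)) fun n' h1 h2 => hf0 n n' ?_
    rw [mem_Ico] at h1 h2
    omega

/-- The value of the operator `(1 + w) log (1 + w) / w`, where `w = Ad V - 1`, at `s^a x_a`, as a
series of iterated commutators. -/
theorem logQuot_conjSubOne_letter (h0 : 0 < N) {K : ℕ} (hK : N ≤ K) (a : ℕ) :
    (logQuot k K (conjSubOne k x N)) ((1 + conjSubOne k x N)
      (polyTensor (X ^ a : k[X]) (x a))) =
      ∑ n ∈ range N, wordSum N n fun w =>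
        polyTensor (X ^ a * logCoeff k K w) (adWord x w (x a)) := by
  have hc : x a ∈ J 0 := hJ.antitone (Nat.zero_le 1) (hx a)
  set q := conjSubOne k x N with hq
  set u := polyTensor (X ^ a : k[X]) (x a) with hu
  have hqK : (q ^ K) u = 0 := by
    rw [hq, hu, conjSubOne_pow_polyTensor hJ hx hN h0 K _ hc]
    refine sum_eq_zero fun n hn => wordSum_eq_zero fun w hw => ?_
    rw [mem_range] at hn
    rw [iterIntPow_eq_zero (by omega), mul_zero, map_zero, LinearMap.zero_apply]
  have h1 : ∀ K, (logQuot k K q) ((1 + q) u) = u + (∑ m ∈ range K,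
      ((-1) ^ m * (((m : k) + 1) * (m + 2))⁻¹) • (q ^ (m + 1)) u) -
        (if K = 0 then u else 0) -
          (if K = 0 then 0 else ((-1) ^ K * ((K : k) + 1)⁻¹) • (q ^ K) u) := by
    intro K
    induction K with
    | zero => simp [logQuot]
    | succ K ih =>
      rw [logQuot, sum_range_succ, LinearMap.add_apply, ← logQuot, ih, sum_range_succ]
      have h1 : ((K : k) + 1) ≠ 0 := by exact_mod_cast K.succ_ne_zero
      have h2 : ((K : k) + 2) ≠ 0 := by exact_mod_cast (K + 1).succ_ne_zero
      have e1 : ((-1) ^ K * ((K : k) + 1)⁻¹) = ((-1) ^ K * (((K : k) + 1) * (K + 2))⁻¹) -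
          (-1) ^ (K + 1) * ((K : k) + 2)⁻¹ := by
        field_simp
        ring
      have e2 : (((-1) ^ K * ((K : k) + 1)⁻¹) • q ^ K) ((1 + q) u) =
          ((-1) ^ K * ((K : k) + 1)⁻¹) • (q ^ K) u +
            ((-1) ^ K * ((K : k) + 1)⁻¹) • (q ^ (K + 1)) u := by
        rw [LinearMap.smul_apply, LinearMap.add_apply, map_add, smul_add, Module.End.one_apply,
          pow_succ, Module.End.mul_apply]
      rw [e2, if_neg (Nat.succ_ne_zero K), if_neg (Nat.succ_ne_zero K)]
      have e3 : ((-1) ^ (K + 1) * (((K + 1 : ℕ) : k) + 1)⁻¹) =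
          (-1) ^ (K + 1) * ((K : k) + 2)⁻¹ := by
        push_cast; congr 2; ring
      rw [e3]
      rcases Nat.eq_zero_or_pos K with rfl | hK0
      · simp only [pow_zero, Module.End.one_apply, if_true] at e1 ⊢
        rw [e1]
        simp
        module
      · rw [if_neg hK0.ne', if_neg hK0.ne', e1]
        module
  rw [h1 K, if_neg (by omega), if_neg (by omega), hqK, smul_zero, sub_zero, sub_zero]
  have hz : u = (q ^ 0) u := by simp
  conv_lhs => lhs; rw [hz]
  simp only [hq, hu, conjSubOne_pow_polyTensor hJ hx hN h0 _ _ hc]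
  simp only [smul_sum]
  rw [sum_comm, ← sum_add_distrib]
  refine sum_congr rfl fun n hn => ?_
  have : ∀ m ∈ range K, ((-1) ^ m * (((m : k) + 1) * (m + 2))⁻¹) • (wordSum N n fun w =>
      polyTensor (X ^ a * iterIntPow k (m + 1) w) (adWord x w (x a))) = wordSum N n fun w =>
      polyTensor (X ^ a * (C ((-1) ^ m * (((m : k) + 1) * (m + 2))⁻¹) * iterIntPow k (m + 1) w))
        (adWord x w (x a)) := fun m _ => by
    have h := map_wordSum (N := N) (((-1) ^ m * (((m : k) + 1) * (m + 2))⁻¹) •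
      (LinearMap.id : A[X] →ₗ[k] A[X])) n
      (fun w => polyTensor (X ^ a * iterIntPow k (m + 1) w) (adWord x w (x a)))
    simp only [LinearMap.smul_apply, LinearMap.id_apply] at h
    rw [h]
    refine wordSum_congr fun w _ => ?_
    rw [mul_left_comm, ← smul_eq_C_mul, map_smul, LinearMap.smul_apply]
  rw [sum_congr rfl this, ← wordSum_sum, ← wordSum_add]
  refine wordSum_congr fun w _ => ?_
  rw [logCoeff, mul_add, map_add, LinearMap.add_apply, mul_sum, map_sum, LinearMap.sum_apply]
  rfl

/-- The logarithm of the time-ordered exponential over `[0, 1]`. -/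
theorem logSum_timeOrdered (h0 : 0 < N) {K : ℕ} (hK : 2 * N ≤ K) :
    logSum k K ((timeOrdered k x N).eval 0 - 1) =
      ∑ a ∈ range N, ∑ n ∈ range N, wordSum N n fun w =>
        unitIntegral k (X ^ a * logCoeff k K w) • adWord x w (x a) := by
  set V := timeOrdered k x N with hV
  set W := V - 1 with hW
  set Vi := ∑ j ∈ range N, (-W) ^ j with hVi
  have hWmem : W ∈ polySub (J 1) := timeOrdered_sub_one_mem hJ hx h0
  have hWN : W ^ N = 0 := pow_eq_zero_of_mem_polySub hJ hN hWmem
  have hVVi : V * Vi = 1 := timeOrdered_mul_inv hJ hx hN h0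
  set g := letterPoly k x N with hg
  have hW' : derivative W = -(V * g) := by
    rw [hW, derivative_sub, derivative_one, sub_zero, hV, derivative_timeOrdered hJ hx hN]
  have hZ' : derivative (logSum k K W) =
      -(logQuot k K (conjSubOne k x N)) ((1 + conjSubOne k x N) g) := by
    have h1 := logQuot_mul_eq_sum_of_commute (k := k) (N := N) (K := K)
      (x := LinearMap.mulLeft k W) (y := LinearMap.mulRight k W) (v := LinearMap.mulRight k Vi)
      (LinearMap.ext fun f => (mul_assoc W f W).symm) (by
        ext1 f
        simp only [Module.End.mul_apply, LinearMap.add_apply, Module.End.one_apply,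
          LinearMap.mulRight_apply]
        have : Vi * V = 1 := by
          rw [hVi, show V = 1 - -W by rw [hW]; abel, geom_sum_mul_neg, neg_pow, hWN]; simp
        rw [mul_assoc f, hW, mul_sub, this]
        noncomm_ring) (by rw [LinearMap.pow_mulLeft, hWN]; ext; simp)
      (by rw [LinearMap.pow_mulRight, hWN]; ext; simp) hK
    have h2 : (LinearMap.mulLeft k W - LinearMap.mulRight k W) * LinearMap.mulRight k Vi =
        conjSubOne k x N := by
      ext1 f
      simp only [conjSubOne, Module.End.mul_apply, LinearMap.sub_apply, Module.End.one_apply,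
        LinearMap.mulRight_apply, LinearMap.mulLeft_apply]
      rw [← hV, ← hW, ← hVi, show W = V - 1 from hW]
      have : Vi * V = 1 := by
        rw [hVi, show V = 1 - -W by rw [hW]; abel, geom_sum_mul_neg, neg_pow, hWN]; simp
      rw [mul_sub, sub_mul, mul_assoc f Vi V, this]
      noncomm_ring
    rw [h2] at h1
    have h3 := congrArg (fun T : Module.End k A[X] => T (-(V * g))) h1
    simp only [Module.End.mul_apply, LinearMap.sum_apply, LinearMap.smul_apply,
      LinearMap.mulRight_apply] at h3
    have h4 : (1 + conjSubOne k x N) g = V * g * Vi := by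
      rw [conjSubOne, add_sub_cancel, Module.End.mul_apply, LinearMap.mulLeft_apply,
        LinearMap.mulRight_apply, mul_assoc]
    rw [h4, ← map_neg, ← neg_mul, h3, logSum, map_sum]
    refine sum_congr rfl fun m _ => ?_
    rw [derivative_smul, derivative_pow_eq_sum, hW']
    congr 1
    refine sum_congr rfl fun p _ => ?_
    rw [LinearMap.pow_mulLeft, LinearMap.pow_mulRight, LinearMap.mulRight_apply,
      LinearMap.mulLeft_apply, mul_assoc]
  have hI := unitIntegral_derivative (k := k) (logSum k K W)
  have hev1 : (logSum k K W).eval 1 = 0 := by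
    have hW1 : W.eval 1 = 0 := by
      rw [hW, eval_sub, eval_one, hV, eval_one_timeOrdered h0, sub_self]
    rw [logSum, eval_finsetSum]
    refine sum_eq_zero fun m _ => ?_
    rw [eval_smul, ← evalOne_apply, map_pow, evalOne_apply, hW1]
    simp
  have hev0 : (logSum k K W).eval 0 = logSum k K (V.eval 0 - 1) := by
    rw [logSum, logSum, eval_finsetSum]
    refine sum_congr rfl fun m _ => ?_
    rw [eval_smul, ← coeff_zero_eq_eval_zero, ← constantCoeff_apply, map_pow, hW, map_sub, map_one,
      constantCoeff_apply, coeff_zero_eq_eval_zero]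
  rw [hZ', hev1, hev0, zero_sub, map_neg, neg_inj] at hI
  rw [← hI, hg, letterPoly, map_sum, map_sum, map_sum]
  refine sum_congr rfl fun a _ => ?_
  rw [logQuot_conjSubOne_letter hJ hx hN h0 (by omega), map_sum]
  refine sum_congr rfl fun n _ => ?_
  rw [map_wordSum]
  simp only [unitIntegral_polyTensor]

end Magnus

/-! ### The Magnus expansion -/

section Magnus

/-- Associativity of the Cauchy product, for arbitrary summands. -/
theorem sum_antidiagonal_assoc {M : Type*} [AddCommMonoid M] (F : ℕ → ℕ → ℕ → M) (r : ℕ) :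
    ∑ p ∈ antidiagonal r, ∑ q ∈ antidiagonal p.1, F q.1 q.2 p.2 =
      ∑ p ∈ antidiagonal r, ∑ q ∈ antidiagonal p.2, F p.1 q.1 q.2 := by
  rw [sum_sigma', sum_sigma']
  refine sum_nbij' (fun t => ⟨(t.2.1, t.2.2 + t.1.2), (t.2.2, t.1.2)⟩)
    (fun t => ⟨(t.1.1 + t.2.1, t.2.2), (t.1.1, t.2.1)⟩) ?_ ?_ ?_ ?_ ?_
  all_goals
    rintro ⟨⟨a, b⟩, ⟨c, d⟩⟩ h
    simp only [mem_sigma, HasAntidiagonal.mem_antidiagonal] at h ⊢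
  · exact ⟨by omega, trivial⟩
  · exact ⟨by omega, trivial⟩
  · obtain ⟨-, rfl⟩ := h; rfl
  · obtain ⟨-, rfl⟩ := h; rfl

variable {k : Type*} [Field k] [CharZero k] {A : Type*} [Ring A] [Algebra k A]
  {J : ℕ → Submodule k A} (hJ : IsAlgFiltration J) {x : ℕ → A} (hx : ∀ a, x a ∈ J 1)
  {N : ℕ} (hN : J N = ⊥)

include hJ hx hN

/-- A solution `∑ s^m B_m` of `B' = g B` with `g = ∑ s^a x_a` satisfies `B(1) = V(0) B(0)`: the
product `V(s) B(s)` has derivative zero. -/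
theorem timeOrdered_smul_eq_sum {M : Type*} [AddCommGroup M] [Module k M] [Module A M] (h0 : 0 < N)
    (hxN : ∀ a, N ≤ a → x a = 0) {B : ℕ → M} {K : ℕ} (hBK : ∀ m, K ≤ m → B m = 0)
    (hB : ∀ m : ℕ, ((m : k) + 1) • B (m + 1) = ∑ p ∈ antidiagonal m, x p.1 • B p.2)
    [IsScalarTower k A M] :
    (timeOrdered k x N).eval 0 • B 0 = ∑ m ∈ range K, B m := by
  set V := timeOrdered k x N with hV
  have hg : ∀ a, (letterPoly k x N).coeff a = x a := fun a => by
    have : ∀ i, (polyTensor (X ^ i : k[X]) (x i)).coeff a = if i = a then x i else 0 := fun i => by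
      rw [polyTensor_apply, Polynomial.map_pow, map_X, coeff_mul_C, coeff_X_pow]
      simp only [eq_comm, ite_mul, one_mul, zero_mul]
    simp only [letterPoly, finsetSum_coeff, this, sum_ite_eq', mem_range]
    split_ifs with h
    · rfl
    · exact (hxN a (not_lt.1 h)).symm
  have hVc : ∀ j : ℕ, ((j : k) + 1) • V.coeff (j + 1) =
      -∑ p ∈ antidiagonal j, V.coeff p.1 * x p.2 := fun j => by
    have h := congrArg (fun p => p.coeff j) (derivative_timeOrdered (k := k) hJ hx hN)
    simp only [coeff_derivative, coeff_neg, coeff_mul, hg] at h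
    rw [hV, ← h, ← Nat.cast_add_one, ← Nat.cast_add_one, Nat.cast_smul_eq_nsmul, nsmul_eq_mul]
    exact (Nat.cast_commute (j + 1) _).eq
  -- The coefficients of `V(s) B(s)`.
  set c : ℕ → M := fun r => ∑ p ∈ antidiagonal r, V.coeff p.1 • B p.2 with hc
  have hc0 : ∀ r, c (r + 1) = 0 := fun r => by
    have h1 : ∑ p ∈ antidiagonal (r + 1), (p.1 : k) • V.coeff p.1 • B p.2 =
        -∑ p ∈ antidiagonal r, ∑ q ∈ antidiagonal p.1, V.coeff q.1 • x q.2 • B p.2 := by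
      rw [Nat.sum_antidiagonal_succ]
      simp only [Nat.cast_zero, zero_smul, zero_add, ← sum_neg_distrib]
      refine sum_congr rfl fun p _ => ?_
      rw [Nat.cast_add, Nat.cast_one, ← smul_assoc, hVc, neg_smul, sum_smul, ← sum_neg_distrib]
      simp only [mul_smul]
    have h2 : ∑ p ∈ antidiagonal (r + 1), (p.2 : k) • V.coeff p.1 • B p.2 =
        ∑ p ∈ antidiagonal r, ∑ q ∈ antidiagonal p.2, V.coeff p.1 • x q.1 • B q.2 := by
      rw [Nat.sum_antidiagonal_succ']
      simp only [Nat.cast_zero, zero_smul, zero_add]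
      refine sum_congr rfl fun p _ => ?_
      rw [Nat.cast_add, Nat.cast_one, smul_comm, hB, smul_sum]
    have h3 : ((r : k) + 1) • c (r + 1) = 0 := by
      have : ((r : k) + 1) • c (r + 1) =
          ∑ p ∈ antidiagonal (r + 1), (p.1 : k) • V.coeff p.1 • B p.2 +
            ∑ p ∈ antidiagonal (r + 1), (p.2 : k) • V.coeff p.1 • B p.2 := by
        rw [hc, smul_sum, ← sum_add_distrib]
        refine sum_congr rfl fun p hp => ?_
        rw [← add_smul, ← Nat.cast_add, HasAntidiagonal.mem_antidiagonal.1 hp]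
        push_cast
        rfl
      rw [this, h1, h2, neg_add_eq_zero]
      exact sum_antidiagonal_assoc (fun i j l => V.coeff i • x j • B l) r
    exact (smul_eq_zero.1 h3).resolve_left (by exact_mod_cast r.succ_ne_zero)
  set D := V.natDegree + 1 with hD
  have h1 : ∑ r ∈ range (D + K), c r = ∑ m ∈ range K, B m := by
    have e : ∀ r, c r = ∑ j ∈ range (r + 1), V.coeff j • B (r - j) := fun r =>
      Nat.sum_antidiagonal_eq_sum_range_succ (fun i j => V.coeff i • B j) r
    simp only [e]
    rw [sum_range_diag_flip (D + K) fun i j => V.coeff i • B j]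
    have e2 : ∀ i ∈ range (D + K), ∑ j ∈ range (D + K - i), V.coeff i • B j =
        V.coeff i • ∑ j ∈ range K, B j := fun i _ => by
      rw [← smul_sum]
      by_cases hi : i < D
      · congr 1
        symm
        refine sum_subset (range_subset_range.2 (by omega)) fun j _ hj => hBK j ?_
        simpa using hj
      · rw [coeff_eq_zero_of_natDegree_lt (by omega), zero_smul, zero_smul]
    rw [sum_congr rfl e2, ← sum_smul]
    have e3 : ∑ i ∈ range (D + K), V.coeff i = 1 := by
      rw [← eval_one_timeOrdered (k := k) (x := x) h0, eval_eq_sum_range' (n := D + K)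
        (by rw [← hV]; omega)]
      simp [← hV]
    rw [e3, one_smul]
  rw [← h1, show D + K = (V.natDegree + K) + 1 by omega, sum_range_succ',
    sum_eq_zero fun r _ => hc0 r, zero_add, hc, ← coeff_zero_eq_eval_zero]
  simp

/-- The Magnus expansion: with the coefficients `G_n`, the logarithm of `V(0)` is a series of
iterated commutators of the `x_a`. -/
theorem expSum_coeffG (h0 : 0 < N) :
    expSum k (2 * N) (∑ n ∈ range N, ∑ y ∈ Fintype.piFinset fun _ : Fin (n + 1) => range N,
      coeffG k n (fun j => (y j : k) + 1) •
        adWord x (List.ofFn fun j : Fin n => y j.succ) (x (y 0))) = (timeOrdered k x N).eval 0 := by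
  have h1 : ∑ n ∈ range N, ∑ y ∈ Fintype.piFinset (fun _ : Fin (n + 1) => range N),
      coeffG k n (fun j => (y j : k) + 1) •
        adWord x (List.ofFn fun j : Fin n => y j.succ) (x (y 0)) =
      logSum k (2 * N) ((timeOrdered k x N).eval 0 - 1) := by
    rw [logSum_timeOrdered hJ hx hN h0 le_rfl, sum_comm]
    refine sum_congr rfl fun n hn => ?_
    rw [mem_range] at hn
    have e := wordSum_eq_sum_piFinset (N := N) (n + 1) fun w =>
      unitIntegral k (X ^ w.headD 0 * logCoeff k (2 * N) w.tail) • adWord x w.tail (x (w.headD 0))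
    rw [wordSum] at e
    simp only [List.headD_cons, List.tail_cons] at e
    rw [e]
    refine sum_congr rfl fun y _ => ?_
    rw [List.ofFn_succ, List.headD_cons, List.tail_cons,
      coeffG_eq_unitIntegral (K := 2 * N) (by omega)]
  rw [h1]
  obtain ⟨K, hK⟩ : ∃ K, 2 * N = K + 1 := ⟨2 * N - 1, by omega⟩
  have h2 : ((timeOrdered k x N).eval 0 - 1) ^ (K + 1) = 0 := by
    have h : (timeOrdered k x N).eval 0 - 1 ∈ J 1 := by
      have := timeOrdered_sub_one_mem (k := k) hJ hx h0 0
      rwa [coeff_sub, coeff_one_zero, coeff_zero_eq_eval_zero] at this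
    refine eq_zero_of_mem hJ hN (p := K + 1) (by omega) (hJ.pow_mem h _)
  rw [hK, expSum_logSum h2, add_sub_cancel]

end Magnus

/-! ### Cochains on tuples of even elements -/

section Even

variable {k : Type*} [Field k] {𝔤 : Type*} [AddCommGroup 𝔤] [Module k 𝔤]
  (gr : ℤ → Submodule k 𝔤)

theorem parityProj_of_mem [DirectSum.Decomposition gr] {i : ℤ} {x : 𝔤} (hx : x ∈ gr i)
    (c : ZMod 2) : parityProj gr c x = if (i : ZMod 2) = c then x else 0 := by
  rw [parityProj, LinearMap.comp_apply]
  have : (DirectSum.decomposeLinearEquiv gr).toLinearMap x =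
      DirectSum.lof k ℤ (fun i => gr i) i ⟨x, hx⟩ :=
    DirectSum.decompose_of_mem gr hx
  rw [this, DirectSum.toModule_lof]
  split_ifs <;> rfl

theorem parityInv_of_mem [DirectSum.Decomposition gr] {i : ℤ} {x : 𝔤} (hx : x ∈ gr i) :
    parityInv gr x = sgn k (i : ZMod 2) • x := by
  rw [parityInv, LinearMap.sub_apply, parityProj_of_mem gr hx, parityProj_of_mem gr hx, sgn]
  rcases (show ∀ c : ZMod 2, c = 0 ∨ c = 1 by decide) (i : ZMod 2) with h | h <;> rw [h] <;> simp

/-- The arguments `x_S` in increasing order. -/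
def subTuple {V : Type*} {n : ℕ} (x : Fin n → V) (S : Finset (Fin n)) : Fin S.card → V :=
  fun i => x (S.orderEmbOfFin rfl i)

theorem insertAt_apply (f g : Cochain k 𝔤) {n : ℕ} (S : Finset (Fin n)) (x : Fin n → 𝔤) :
    insertAt f g S x =
      f (Sᶜ.card + 1) (Fin.cons (g S.card (subTuple x S)) (subTuple x Sᶜ)) := by
  rw [insertAt, MultilinearMap.curryFinFinset_symm_apply]
  simp only [finSumEquivOfFinset_inl, finSumEquivOfFinset_inr]
  rfl

/-- On elements of `gr (-1)`, which are even in the suspension, no signs occur. -/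
theorem preLieMul_apply_of_mem [DirectSum.Decomposition gr] (f g : Cochain k 𝔤) {n : ℕ}
    {x : Fin n → 𝔤} (hx : ∀ i, x i ∈ gr (-1)) :
    preLieMul gr f g n x = ∑ S : Finset (Fin n),
      f (Sᶜ.card + 1) (Fin.cons (g S.card (subTuple x S)) (subTuple x Sᶜ)) := by
  rw [preLieMul, _root_.sum_apply]
  refine sum_congr rfl fun S _ => ?_
  rw [_root_.sum_apply, sum_eq_single (0 : Fin n → ZMod 2)]
  · rw [_root_.smul_apply, MultilinearMap.compLinearMap_apply, insertAt_apply, shuffleSign]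
    have : ∀ i, parityProj gr ((0 : Fin n → ZMod 2) i - 1) (x i) = x i := fun i => by
      rw [parityProj_of_mem gr (hx i), if_pos (by simp)]
    simp only [this]
    simp [sgn]
  · intro e _ he
    obtain ⟨i, hi⟩ := Function.ne_iff.1 he
    rw [_root_.smul_apply, MultilinearMap.compLinearMap_apply,
      MultilinearMap.map_coord_zero _ i, smul_zero]
    rw [parityProj_of_mem gr (hx i), if_neg]
    intro h
    apply hi
    rw [Pi.zero_apply]
    have : e i = ((-1 : ℤ) : ZMod 2) + 1 := by rw [h]; ring
    rw [this]
    decide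
  · simp

/-- Symmetry on tuples of elements of `gr (-1)`. -/
def EvenSymm (h : Cochain k 𝔤) : Prop :=
  ∀ ⦃n : ℕ⦄ ⦃x : Fin n → 𝔤⦄, (∀ i, x i ∈ gr (-1)) → ∀ σ : Equiv.Perm (Fin n),
    h n (fun i => x (σ i)) = h n x

/-- Symmetry in all arguments but the first, which is in `gr j`, while the others are in
`gr (-1)`. -/
def TailSymm (j : ℤ) (h : Cochain k 𝔤) : Prop :=
  ∀ ⦃n : ℕ⦄ ⦃y : 𝔤⦄ ⦃x : Fin n → 𝔤⦄, y ∈ gr j → (∀ i, x i ∈ gr (-1)) →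
    ∀ σ : Equiv.Perm (Fin n),
      h (n + 1) (Fin.cons y fun i => x (σ i)) = h (n + 1) (Fin.cons y x)

variable {gr}

theorem EvenSymm.tailSymm {h : Cochain k 𝔤} (hh : EvenSymm gr h) : TailSymm gr (-1) h := by
  intro n y x hy hx σ
  have hm : ∀ i, (Fin.cons y x : Fin (n + 1) → 𝔤) i ∈ gr (-1) := Fin.cases hy hx
  rw [← hh hm (Equiv.Perm.decomposeFin.symm (0, σ))]
  congr 1
  funext i
  refine Fin.cases ?_ (fun i => ?_) i
  · simp [Equiv.Perm.decomposeFin_symm_apply_zero]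
  · simp [Equiv.Perm.decomposeFin_symm_apply_succ]

/-- For a permutation `σ` with `σ S = S'`, the tuples `(x ∘ σ)_S` and `x_{S'}` differ by a
permutation. -/
theorem exists_subTuple_eq {V : Type*} {n : ℕ} (x : Fin n → V) (σ : Equiv.Perm (Fin n))
    {S S' : Finset (Fin n)}
    (h : ∀ i, i ∈ S ↔ σ i ∈ S') :
    ∃ τ : Fin S.card ≃ Fin S'.card, subTuple (fun i => x (σ i)) S = subTuple x S' ∘ τ := by
  refine ⟨(S.orderIsoOfFin rfl).toEquiv.trans
    ((σ.subtypeEquiv h).trans (S'.orderIsoOfFin rfl).symm.toEquiv), ?_⟩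
  funext i
  simp only [subTuple, Function.comp_apply, Equiv.trans_apply]
  congr 1
  rw [← Finset.coe_orderIsoOfFin_apply, ← Finset.coe_orderIsoOfFin_apply]
  simp

theorem EvenSymm.apply_eq {h : Cochain k 𝔤} (hh : EvenSymm gr h) {a a' : ℕ} (τ : Fin a ≃ Fin a')
    {u : Fin a' → 𝔤} (hu : ∀ i, u i ∈ gr (-1)) : h a (u ∘ τ) = h a' u := by
  obtain rfl : a = a' := by simpa using Fintype.card_congr τ
  exact hh hu τ

theorem TailSymm.apply_eq {j : ℤ} {h : Cochain k 𝔤} (hh : TailSymm gr j h) {a a' : ℕ}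
    (τ : Fin a ≃ Fin a') {y : 𝔤} (hy : y ∈ gr j) {u : Fin a' → 𝔤} (hu : ∀ i, u i ∈ gr (-1)) :
    h (a + 1) (Fin.cons y (u ∘ τ)) = h (a' + 1) (Fin.cons y u) := by
  obtain rfl : a = a' := by simpa using Fintype.card_congr τ
  exact hh hy hu τ

theorem EvenSymm.preLieMul [DirectSum.Decomposition gr] {j : ℤ} {h e : Cochain k 𝔤}
    (hh : TailSymm gr j h) (he : EvenSymm gr e)
    (hej : ∀ ⦃n : ℕ⦄ ⦃x : Fin n → 𝔤⦄, (∀ i, x i ∈ gr (-1)) → e n x ∈ gr j) :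
    EvenSymm gr (preLieMul gr h e) := by
  intro n x hx σ
  rw [preLieMul_apply_of_mem gr h e hx, preLieMul_apply_of_mem gr h e fun i => hx (σ i)]
  refine Fintype.sum_equiv σ.finsetCongr _ _ fun S => ?_
  have h1 : ∀ i, i ∈ S ↔ σ i ∈ σ.finsetCongr S := fun i => by simp
  have h2 : ∀ i, i ∈ Sᶜ ↔ σ i ∈ (σ.finsetCongr S)ᶜ := fun i => by simp
  obtain ⟨τ, hτ⟩ := exists_subTuple_eq x σ h1
  obtain ⟨τ', hτ'⟩ := exists_subTuple_eq x σ h2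
  rw [hτ, hτ', he.apply_eq τ (u := subTuple x _) fun i => hx _]
  exact hh.apply_eq τ' (u := subTuple x _) (hej (x := subTuple x _) fun i => hx _) fun i => hx _

theorem sum_subTuple_add {M : Type*} [AddCommMonoid M] {n : ℕ} (p : Fin n → M)
    (S : Finset (Fin n)) : ∑ i, subTuple p S i + ∑ i, subTuple p Sᶜ i = ∑ i, p i := by
  rw [← Fintype.sum_equiv (finSumEquivOfFinset (s := S) rfl rfl) (fun i => p _) p fun _ => rfl,
    Fintype.sum_sum_type]
  simp [subTuple]

end Even

namespace CompleteDGLie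

variable {k : Type*} [Field k] {𝔤 : Type*} [AddCommGroup 𝔤] [Module k 𝔤]
  {gr : ℤ → Submodule k 𝔤} (L : CompleteDGLie k gr)

/-- The properties of a cochain, tested on tuples of elements of `gr (-1)` only, that the flow
argument uses. The values are in `gr j`. -/
structure IsEvenCochain (j : ℤ) (h : Cochain k 𝔤) : Prop where
  symm : EvenSymm gr h
  mem : ∀ ⦃n : ℕ⦄ ⦃x : Fin n → 𝔤⦄, (∀ i, x i ∈ gr (-1)) → h n x ∈ gr j
  filtered : ∀ ⦃n : ℕ⦄ ⦃p : Fin n → ℕ⦄ ⦃x : Fin n → 𝔤⦄, (∀ i, x i ∈ gr (-1)) →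
    (∀ i, x i ∈ L.F (p i)) → h n x ∈ L.F (∑ i, p i)

/-- The properties corresponding to `IsEvenCochain` for tuples whose first element is in `gr i`,
while the others are in `gr (-1)`. -/
structure IsTailCochain (i j : ℤ) (h : Cochain k 𝔤) : Prop where
  symm : TailSymm gr i h
  mem : ∀ ⦃n : ℕ⦄ ⦃y : 𝔤⦄ ⦃x : Fin n → 𝔤⦄, y ∈ gr i → (∀ i, x i ∈ gr (-1)) →
    h (n + 1) (Fin.cons y x) ∈ gr j
  filtered : ∀ ⦃n q : ℕ⦄ ⦃p : Fin n → ℕ⦄ ⦃y : 𝔤⦄ ⦃x : Fin n → 𝔤⦄, y ∈ gr i →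
    (∀ i, x i ∈ gr (-1)) → y ∈ L.F q → (∀ i, x i ∈ L.F (p i)) →
      h (n + 1) (Fin.cons y x) ∈ L.F (q + ∑ i, p i)

variable {L}

theorem IsEvenCochain.isTailCochain {j : ℤ} {h : Cochain k 𝔤} (hh : L.IsEvenCochain j h) :
    L.IsTailCochain (-1) j h where
  symm := hh.symm.tailSymm
  mem _ _ _ hy hx := hh.mem (Fin.cases hy hx)
  filtered n q p y x hy hx hq hp := by
    have := hh.filtered (p := Fin.cons q p) (x := Fin.cons y x) (Fin.cases hy hx)
      (Fin.cases hq hp)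
    simpa only [Fin.sum_univ_succ, Fin.cons_zero, Fin.cons_succ] using this

variable [DirectSum.Decomposition gr]

theorem IsTailCochain.preLieMul {i j : ℤ} {h e : Cochain k 𝔤} (hh : L.IsTailCochain i j h)
    (he : L.IsEvenCochain i e) : L.IsEvenCochain j (preLieMul gr h e) where
  symm := EvenSymm.preLieMul hh.symm he.symm he.mem
  mem n x hx := by
    rw [preLieMul_apply_of_mem gr h e hx]
    exact sum_mem fun S _ => hh.mem (he.mem fun _ => hx _) fun _ => hx _
  filtered n p x hx hp := by
    rw [preLieMul_apply_of_mem gr h e hx]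
    refine sum_mem fun S _ => ?_
    rw [← sum_subTuple_add p S]
    exact hh.filtered (he.mem fun _ => hx _) (fun _ => hx _)
      (he.filtered (fun _ => hx _) fun _ => hp _) fun _ => hp _

theorem IsEvenCochain.preLieMul {j : ℤ} {h e : Cochain k 𝔤} (hh : L.IsEvenCochain j h)
    (he : L.IsEvenCochain (-1) e) : L.IsEvenCochain j (preLieMul gr h e) :=
  hh.isTailCochain.preLieMul he

theorem IsEvenCochain.rightMul {j : ℤ} {h e : Cochain k 𝔤} (hh : L.IsEvenCochain j h)
    (he : L.IsEvenCochain (-1) e) (m : ℕ) : L.IsEvenCochain j (rightMul gr e m h) := by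
  induction m generalizing h with
  | zero => exact hh
  | succ m ih => exact ih (hh.preLieMul he)

end CompleteDGLie

section Arity

variable {k : Type*} [Field k] {𝔤 : Type*} [AddCommGroup 𝔤] [Module k 𝔤]
  (gr : ℤ → Submodule k 𝔤)

/-- The components in arities less than `p` vanish on elements of `gr (-1)`. -/
def VanishesBelow (p : ℕ) (h : Cochain k 𝔤) : Prop :=
  ∀ ⦃n : ℕ⦄ ⦃x : Fin n → 𝔤⦄, (∀ i, x i ∈ gr (-1)) → n < p → h n x = 0

variable {gr}

theorem VanishesBelow.preLieMul [DirectSum.Decomposition gr] {p q : ℕ} {h e : Cochain k 𝔤}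
    (hh : VanishesBelow gr (p + 1) h) (he : VanishesBelow gr (q + 1) e)
    (hem : ∀ ⦃n : ℕ⦄ ⦃x : Fin n → 𝔤⦄, (∀ i, x i ∈ gr (-1)) → e n x ∈ gr (-1)) :
    VanishesBelow gr (p + q + 1) (preLieMul gr h e) := by
  intro n x hx hn
  rw [preLieMul_apply_of_mem gr h e hx]
  refine sum_eq_zero fun S _ => ?_
  have hc := S.card_add_card_compl
  rw [Fintype.card_fin] at hc
  by_cases hS : S.card < q + 1
  · exact MultilinearMap.map_coord_zero _ 0 (he (fun _ => hx _) hS)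
  · exact hh (Fin.cases (hem fun _ => hx _) fun _ => hx _) (by omega)

theorem VanishesBelow.rightMul [DirectSum.Decomposition gr] {p q : ℕ} {h e : Cochain k 𝔤}
    (hh : VanishesBelow gr (p + 1) h) (he : VanishesBelow gr (q + 1) e)
    (hem : ∀ ⦃n : ℕ⦄ ⦃x : Fin n → 𝔤⦄, (∀ i, x i ∈ gr (-1)) → e n x ∈ gr (-1)) (m : ℕ) :
    VanishesBelow gr (p + m * q + 1) (rightMul gr e m h) := by
  induction m generalizing h p with
  | zero => rwa [zero_mul, add_zero]
  | succ m ih =>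
    have := ih (hh.preLieMul he hem)
    rwa [show p + q + m * q + 1 = p + (m + 1) * q + 1 by ring] at this

end Arity

/-! ### The twisted differential on even tuples -/

namespace CompleteDGLie

variable {k : Type*} [Field k] {𝔤 : Type*} [AddCommGroup 𝔤] [Module k 𝔤]
  {gr : ℤ → Submodule k 𝔤} (L : CompleteDGLie k gr)

theorem IsCochain.isEvenCochain {L : CompleteDGLie k gr} {f : Cochain k 𝔤}
    (hf : L.IsCochain 1 f) : L.IsEvenCochain 0 f where
  symm n x hx σ := by
    rw [hf.symmetric (a := fun _ => 0) (by simpa using hx) σ]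
    simp [sgn]
  mem n x hx := by
    have := hf.degree (a := fun _ => 0) (x := x) (by simpa using hx)
    simpa using this
  filtered n p x hx hp := hf.filtered hp

theorem IsCochain.isTailCochain {L : CompleteDGLie k gr} {f : Cochain k 𝔤}
    (hf : L.IsCochain 1 f) : L.IsTailCochain (-2) (-1) f where
  symm n y x hy hx σ := by
    have hm : ∀ i, (Fin.cons y x : Fin (n + 1) → 𝔤) i ∈
        gr ((Fin.cons (-1) (fun _ => 0) : Fin (n + 1) → ℤ) i - 1) := by
      refine Fin.cases ?_ fun i => ?_
      · simpa using hy
      · simpa using hx i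
    have := hf.symmetric hm (Equiv.Perm.decomposeFin.symm (0, σ))
    convert this using 1
    · congr 1
      funext i
      refine Fin.cases ?_ (fun i => ?_) i
      · simp [Equiv.Perm.decomposeFin_symm_apply_zero]
      · simp [Equiv.Perm.decomposeFin_symm_apply_succ]
    · rw [sum_eq_zero, sgn, if_pos rfl, one_smul]
      -- at most one of two different arguments has odd degree
      rintro ⟨a, b⟩ hab
      rw [mem_filter] at hab
      have hne : a ≠ b := hab.2.1.ne
      revert hne
      generalize (Equiv.Perm.decomposeFin.symm (0, σ) : Equiv.Perm (Fin (n + 1))) = τ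
      intro hne
      have hz : ∀ i : Fin (n + 1), i ≠ 0 →
          (Fin.cons (-1) (fun _ => 0) : Fin (n + 1) → ℤ) i = 0 :=
        Fin.cases (by simp) fun i _ => by simp
      rcases eq_or_ne (τ a) 0 with h | h
      · rw [hz (τ b) fun h' => hne (τ.injective (h.trans h'.symm))]; simp
      · rw [hz (τ a) h]; simp
  mem n y x hy hx := by
    have hm : ∀ i, (Fin.cons y x : Fin (n + 1) → 𝔤) i ∈
        gr ((Fin.cons (-1) (fun _ => 0) : Fin (n + 1) → ℤ) i - 1) := by
      refine Fin.cases ?_ fun i => ?_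
      · simpa using hy
      · simpa using hx i
    simpa [Fin.sum_univ_succ] using hf.degree hm
  filtered n q p y x hy hx hq hp := by
    have := hf.filtered (p := Fin.cons q p) (x := Fin.cons y x) (Fin.cases hq hp)
    simpa only [Fin.sum_univ_succ, Fin.cons_zero, Fin.cons_succ] using this

theorem bracket_comm_of_mem {x y : 𝔤} (hx : x ∈ gr (-1)) (hy : y ∈ gr (-1)) :
    L.bracket x y = L.bracket y x := by
  rw [L.antisymm hx hy]
  simp [sgn]

theorem d_mem_of_mem {i j : ℤ} {x : 𝔤} (hx : x ∈ gr i) (h : i = j + 1) : L.d x ∈ gr j := by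
  subst h
  simpa using L.d_mem hx

theorem bracket_mem_of_mem {i j l : ℤ} {x y : 𝔤} (hx : x ∈ gr i) (hy : y ∈ gr j)
    (h : i + j = l) : L.bracket x y ∈ gr l := h ▸ L.bracket_mem hx hy

theorem IsCochain.vanishesBelow {L : CompleteDGLie k gr} {r : ℤ} {f : Cochain k 𝔤}
    (hf : L.IsCochain r f) : VanishesBelow gr 2 f := by
  intro n x _ hn
  interval_cases n
  · rw [hf.arity_zero]; rfl
  · rw [hf.arity_one]; rfl

variable [DirectSum.Decomposition gr]

/-- The cochain `d_{s𝔤} + φ`, a perturbation of the differential. -/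
def totalDiff : Cochain k 𝔤 := ofLinear (-L.d) + L.phi

theorem totalDiff_zero : L.totalDiff 0 = 0 := by
  simp [totalDiff, phi, ofLinear, ofBilinear]

theorem totalDiff_one (x : Fin 1 → 𝔤) : L.totalDiff 1 x = -L.d (x 0) := by
  simp [totalDiff, phi, ofLinear, ofBilinear]

theorem totalDiff_two (x : Fin 2 → 𝔤) :
    L.totalDiff 2 x = L.bracket (parityInv gr (x 0)) (x 1) := by
  simp [totalDiff, phi, ofLinear, ofBilinear, Fin.tail]

theorem totalDiff_add_three (n : ℕ) : L.totalDiff (n + 3) = 0 := by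
  simp [totalDiff, phi, ofLinear, ofBilinear]

theorem totalDiff_two_of_mem {x : Fin 2 → 𝔤} (hx : x 0 ∈ gr (-1)) :
    L.totalDiff 2 x = -L.bracket (x 0) (x 1) := by
  rw [totalDiff_two, parityInv_of_mem gr hx]
  simp [sgn]

theorem isEvenCochain_totalDiff : L.IsEvenCochain (-2) L.totalDiff where
  symm n x hx σ := by
    obtain rfl | rfl | rfl | ⟨n, rfl⟩ : n = 0 ∨ n = 1 ∨ n = 2 ∨ ∃ m, n = m + 3 := by
      rcases n with _ | _ | _ | n <;> simp
    · simp [totalDiff_zero]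
    · rw [Subsingleton.elim σ 1]; rfl
    · rw [L.totalDiff_two_of_mem (x := fun i => x (σ i)) (hx _), L.totalDiff_two_of_mem (hx 0)]
      rcases (show ∀ σ : Equiv.Perm (Fin 2), σ = 1 ∨ σ = Equiv.swap 0 1 by decide) σ with rfl | rfl
      · rfl
      · rw [Equiv.swap_apply_left, Equiv.swap_apply_right, L.bracket_comm_of_mem (hx _) (hx _)]
    · rw [totalDiff_add_three]; rfl
  mem n x hx := by
    obtain rfl | rfl | rfl | ⟨n, rfl⟩ : n = 0 ∨ n = 1 ∨ n = 2 ∨ ∃ m, n = m + 3 := by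
      rcases n with _ | _ | _ | n <;> simp
    · simp [totalDiff_zero]
    · rw [totalDiff_one]
      exact (gr _).neg_mem (L.d_mem_of_mem (hx 0) rfl)
    · rw [L.totalDiff_two_of_mem (hx _)]
      exact (gr _).neg_mem (L.bracket_mem_of_mem (hx 0) (hx 1) rfl)
    · rw [totalDiff_add_three]; exact zero_mem _
  filtered n p x hx hp := by
    obtain rfl | rfl | rfl | ⟨n, rfl⟩ : n = 0 ∨ n = 1 ∨ n = 2 ∨ ∃ m, n = m + 3 := by
      rcases n with _ | _ | _ | n <;> simp
    · simp [totalDiff_zero]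
    · rw [totalDiff_one, Fin.sum_univ_one]
      exact (L.F _).neg_mem (L.d_F (hp 0))
    · rw [L.totalDiff_two_of_mem (hx _), Fin.sum_univ_two]
      exact (L.F _).neg_mem (L.bracket_F (hp 0) (hp 1))
    · rw [totalDiff_add_three]; exact zero_mem _

theorem totalDiff_two_cons {y : 𝔤} (hy : y ∈ gr 0) (x : Fin 1 → 𝔤) :
    L.totalDiff 2 (Fin.cons y x) = L.bracket y (x 0) := by
  rw [totalDiff_two]
  simp [parityInv_of_mem gr hy, sgn]

theorem isTailCochain_totalDiff : L.IsTailCochain 0 (-1) L.totalDiff where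
  symm n y x hy hx σ := by
    obtain rfl | rfl | ⟨n, rfl⟩ : n = 0 ∨ n = 1 ∨ ∃ m, n = m + 2 := by
      rcases n with _ | _ | n <;> simp
    · rw [Subsingleton.elim σ 1]; rfl
    · rw [Subsingleton.elim σ 1]; rfl
    · rw [totalDiff_add_three]; rfl
  mem n y x hy hx := by
    obtain rfl | rfl | ⟨n, rfl⟩ : n = 0 ∨ n = 1 ∨ ∃ m, n = m + 2 := by
      rcases n with _ | _ | n <;> simp
    · rw [totalDiff_one]
      exact (gr _).neg_mem (L.d_mem_of_mem hy rfl)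
    · rw [L.totalDiff_two_cons hy]
      exact L.bracket_mem_of_mem hy (hx 0) rfl
    · rw [totalDiff_add_three]; exact zero_mem _
  filtered n q p y x hy hx hq hp := by
    obtain rfl | rfl | ⟨n, rfl⟩ : n = 0 ∨ n = 1 ∨ ∃ m, n = m + 2 := by
      rcases n with _ | _ | n <;> simp
    · rw [totalDiff_one]
      simpa using (L.F _).neg_mem (L.d_F hq)
    · rw [L.totalDiff_two_cons hy, Fin.sum_univ_one]
      exact L.bracket_F hq (hp 0)
    · rw [totalDiff_add_three]; exact zero_mem _

/-- In degree one, `∂^φ f` is the sum of the two pre-Lie products of `f` and `d_{s𝔤} + φ`. -/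
theorem twistedDiff_one_apply (f : Cochain k 𝔤) {n : ℕ} {x : Fin n → 𝔤}
    (hx : ∀ i, x i ∈ gr (-1)) :
    L.twistedDiff 1 f n x = preLieMul gr L.totalDiff f n x + preLieMul gr f L.totalDiff n x := by
  have hs : sgn k (((-1 : ℤ) : ZMod 2) * ((1 : ℤ) : ZMod 2)) = -1 := by simp [sgn]
  simp only [twistedDiff, comm, hs, Pi.add_apply, Pi.sub_apply, Pi.smul_apply, _root_.add_apply,
    _root_.sub_apply, _root_.smul_apply, preLieMul_apply_of_mem gr _ _ hx, totalDiff,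
    MultilinearMap.cons_add, sum_add_distrib]
  module

theorem isEvenCochain_twistedDiff {f : Cochain k 𝔤} (hf : L.IsCochain 1 f) :
    L.IsEvenCochain (-1) (L.twistedDiff 1 f) := by
  have h1 := L.isTailCochain_totalDiff.preLieMul hf.isEvenCochain
  have h2 := hf.isTailCochain.preLieMul L.isEvenCochain_totalDiff
  constructor
  · intro n x hx σ
    rw [L.twistedDiff_one_apply f hx, L.twistedDiff_one_apply f fun i => hx (σ i), h1.symm hx,
      h2.symm hx]
  · intro n x hx
    rw [L.twistedDiff_one_apply f hx]
    exact add_mem (h1.mem hx) (h2.mem hx)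
  · intro n p x hx hp
    rw [L.twistedDiff_one_apply f hx]
    exact add_mem (h1.filtered hx hp) (h2.filtered hx hp)

theorem vanishesBelow_twistedDiff {f : Cochain k 𝔤} (hf : L.IsCochain 1 f) :
    VanishesBelow gr 2 (L.twistedDiff 1 f) := by
  intro n x hx hn
  rw [L.twistedDiff_one_apply f hx, preLieMul_apply_of_mem gr _ _ hx,
    preLieMul_apply_of_mem gr _ _ hx, sum_eq_zero, sum_eq_zero, add_zero]
  all_goals
    intro S _
    have hc := S.card_add_card_compl
    rw [Fintype.card_fin] at hc
  · by_cases h : Sᶜ.card = 0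
    · have hz : ∀ m, m = 0 → f (m + 1) = 0 := by rintro _ rfl; exact hf.arity_one
      rw [hz _ h]; rfl
    · have hz : ∀ m, m = 0 → L.totalDiff m = 0 := by rintro _ rfl; exact L.totalDiff_zero
      refine MultilinearMap.map_coord_zero _ 0 ?_
      rw [Fin.cons_zero, hz _ (by omega)]; rfl
  · refine MultilinearMap.map_coord_zero _ 0 ?_
    rw [Fin.cons_zero]
    exact hf.vanishesBelow (fun _ => hx _) (by omega)

end CompleteDGLie

/-! ### Power series with values in the Lie algebra -/

section Ext

variable {k : Type*} [Field k] {𝔤 : Type*} [AddCommGroup 𝔤] [Module k 𝔤]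
  {gr : ℤ → Submodule k 𝔤}

/-- The coefficient of `s^m` in `h_n(w, …, w)`, where `w = ∑_i w_i s^i`. -/
def coeffExt (h : Cochain k 𝔤) (n : ℕ) (w : ℕ → 𝔤) (m : ℕ) : 𝔤 :=
  ∑ i ∈ Nat.antidiagonalTuple n m, h n fun j => w (i j)

/-- The coefficient of `s^m` in `h_{n+1}(v, w, …, w)`, where `v = ∑_i v_i s^i` and
`w = ∑_i w_i s^i`. -/
def coeffExtCons (h : Cochain k 𝔤) (n : ℕ) (v w : ℕ → 𝔤) (m : ℕ) : 𝔤 :=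
  ∑ p ∈ antidiagonal m, ∑ i ∈ Nat.antidiagonalTuple n p.2,
    (h (n + 1)).curryLeft (v p.1) fun j => w (i j)

theorem coeffExt_zero_right (h : Cochain k 𝔤) (n : ℕ) (w : ℕ → 𝔤) :
    coeffExt h n w 0 = h n fun _ => w 0 := by
  simp [coeffExt, Nat.antidiagonalTuple_zero_right]

theorem sum_antidiagonalTuple_succ {M : Type*} [AddCommMonoid M] (n m : ℕ)
    (F : (Fin (n + 1) → ℕ) → M) :
    ∑ i ∈ Nat.antidiagonalTuple (n + 1) m, F i =
      ∑ p ∈ antidiagonal m, ∑ i ∈ Nat.antidiagonalTuple n p.2, F (Fin.cons p.1 i) := by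
  rw [sum_sigma']
  refine sum_bij' (fun i _ => ⟨(i 0, ∑ j, Fin.tail i j), Fin.tail i⟩)
    (fun t _ => Fin.cons t.1.1 t.2) ?_ ?_ ?_ ?_ ?_
  · intro i hi
    rw [Nat.mem_antidiagonalTuple, Fin.sum_univ_succ] at hi
    simpa [Nat.mem_antidiagonalTuple, Fin.tail] using hi
  · rintro ⟨p, i⟩ hi
    simp only [mem_sigma, HasAntidiagonal.mem_antidiagonal, Nat.mem_antidiagonalTuple] at hi
    rw [Nat.mem_antidiagonalTuple, Fin.sum_univ_succ]
    simpa [hi.2] using hi.1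
  · intro i _
    exact Fin.cons_self_tail i
  · rintro ⟨⟨p, q⟩, i⟩ hi
    simp only [mem_sigma, HasAntidiagonal.mem_antidiagonal, Nat.mem_antidiagonalTuple] at hi
    obtain ⟨-, rfl⟩ := hi
    simp
  · intro i _
    rw [Fin.cons_self_tail]

/-- The Leibniz rule for the derivation `s d/ds`. -/
theorem natCast_smul_coeffExt {h : Cochain k 𝔤} (hh : EvenSymm gr h) {w : ℕ → 𝔤}
    (hw : ∀ i, w i ∈ gr (-1)) (n m : ℕ) :
    (m : k) • coeffExt h (n + 1) w m =
      ((n : k) + 1) • coeffExtCons h n (fun c => (c : k) • w c) w m := by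
  have h1 : ∀ j : Fin (n + 1), ∑ i ∈ Nat.antidiagonalTuple (n + 1) m,
      (i j : k) • h (n + 1) (fun j => w (i j)) = coeffExtCons h n (fun c => (c : k) • w c) w m := by
    intro j
    have e : ∑ i ∈ Nat.antidiagonalTuple (n + 1) m, (i j : k) • h (n + 1) (fun j => w (i j)) =
        ∑ i ∈ Nat.antidiagonalTuple (n + 1) m, (i 0 : k) • h (n + 1) (fun j => w (i j)) := by
      refine sum_nbij' (fun i => i ∘ Equiv.swap 0 j) (fun i => i ∘ Equiv.swap 0 j) ?_ ?_ ?_ ?_ ?_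
      · intro i hi
        rw [Nat.mem_antidiagonalTuple] at hi ⊢
        rw [← hi]
        exact Equiv.sum_comp (Equiv.swap 0 j) i
      · intro i hi
        rw [Nat.mem_antidiagonalTuple] at hi ⊢
        rw [← hi]
        exact Equiv.sum_comp (Equiv.swap 0 j) i
      · intro i _; ext; simp
      · intro i _; ext; simp
      · intro i _
        have := hh (x := fun j => w (i j)) (fun _ => hw _) (Equiv.swap 0 j)
        simp only [Function.comp_apply, Equiv.swap_apply_left]
        rw [this]
    rw [e, sum_antidiagonalTuple_succ, coeffExtCons]
    refine sum_congr rfl fun p _ => sum_congr rfl fun i _ => ?_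
    rw [map_smul, _root_.smul_apply, MultilinearMap.curryLeft_apply, Fin.cons_zero]
    congr 2
    funext j
    refine Fin.cases rfl (fun j => rfl) j
  have h2 : (m : k) • coeffExt h (n + 1) w m = ∑ j : Fin (n + 1),
      ∑ i ∈ Nat.antidiagonalTuple (n + 1) m, (i j : k) • h (n + 1) (fun j => w (i j)) := by
    rw [sum_comm, coeffExt, smul_sum]
    refine sum_congr rfl fun i hi => ?_
    rw [← sum_smul, ← Nat.cast_sum, Nat.mem_antidiagonalTuple.1 hi]
  rw [h2, sum_congr rfl fun j _ => h1 j, sum_const, card_univ, Fintype.card_fin,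
    ← Nat.cast_smul_eq_nsmul k]
  push_cast
  rfl

theorem sum_insertAt_eq_coeffExtCons (h e : Cochain k 𝔤) {n : ℕ} (S : Finset (Fin n))
    (w : ℕ → 𝔤) (m : ℕ) :
    ∑ i ∈ Nat.antidiagonalTuple n m, h (Sᶜ.card + 1) (Fin.cons
      (e S.card (subTuple (fun j => w (i j)) S)) (subTuple (fun j => w (i j)) Sᶜ)) =
      coeffExtCons h Sᶜ.card (coeffExt e S.card w) w m := by
  have h1 : coeffExtCons h Sᶜ.card (coeffExt e S.card w) w m =
      ∑ p ∈ antidiagonal m, ∑ t ∈ Nat.antidiagonalTuple S.card p.1 ×ˢ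
        Nat.antidiagonalTuple Sᶜ.card p.2, h (Sᶜ.card + 1) (Fin.cons
          (e S.card fun j => w (t.1 j)) fun j => w (t.2 j)) := by
    rw [coeffExtCons]
    refine sum_congr rfl fun p _ => ?_
    rw [sum_product_right]
    refine sum_congr rfl fun i _ => ?_
    rw [coeffExt, map_sum, _root_.sum_apply]
    rfl
  rw [h1, sum_sigma']
  refine sum_bij' (fun i _ => ⟨(∑ j, subTuple i S j, ∑ j, subTuple i Sᶜ j),
      (subTuple i S, subTuple i Sᶜ)⟩)
    (fun t _ => Sum.elim t.2.1 t.2.2 ∘ (finSumEquivOfFinset (s := S) rfl rfl).symm) ?_ ?_ ?_ ?_ ?_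
  · intro i hi
    rw [Nat.mem_antidiagonalTuple] at hi
    simp [sum_subTuple_add, hi, Nat.mem_antidiagonalTuple]
  · rintro ⟨p, t⟩ ht
    simp only [mem_sigma, HasAntidiagonal.mem_antidiagonal, mem_product,
      Nat.mem_antidiagonalTuple] at ht
    rw [Nat.mem_antidiagonalTuple, ← ht.1, ← ht.2.1, ← ht.2.2]
    refine (Equiv.sum_comp (finSumEquivOfFinset (s := S) rfl rfl).symm
      (Sum.elim t.1 t.2)).trans ?_
    rw [Fintype.sum_sum_type]
    rfl
  · intro i _
    funext j
    obtain ⟨j, rfl⟩ := (finSumEquivOfFinset (s := S) rfl rfl).surjective j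
    rcases j with j | j
    · rw [Function.comp_apply, Equiv.symm_apply_apply, Sum.elim_inl, finSumEquivOfFinset_inl]
      rfl
    · rw [Function.comp_apply, Equiv.symm_apply_apply, Sum.elim_inr, finSumEquivOfFinset_inr]
      rfl
  · rintro ⟨⟨p, q⟩, t⟩ ht
    simp only [mem_sigma, HasAntidiagonal.mem_antidiagonal, mem_product,
      Nat.mem_antidiagonalTuple] at ht
    have e1 : subTuple (Sum.elim t.1 t.2 ∘ (finSumEquivOfFinset (s := S) rfl rfl).symm) S =
        t.1 := by
      funext j
      rw [subTuple, ← finSumEquivOfFinset_inl (s := S) rfl rfl, Function.comp_apply,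
        Equiv.symm_apply_apply, Sum.elim_inl]
    have e2 : subTuple (Sum.elim t.1 t.2 ∘ (finSumEquivOfFinset (s := S) rfl rfl).symm) Sᶜ =
        t.2 := by
      funext j
      rw [subTuple, ← finSumEquivOfFinset_inr (s := S) rfl rfl, Function.comp_apply,
        Equiv.symm_apply_apply, Sum.elim_inr]
    simp only [e1, e2, ht.2.1, ht.2.2]
  · intro i _
    rfl

/-- The pre-Lie product is the directional derivative: the coefficients of
`h ⋆ e = h' · e`, with exponential normalization. -/
theorem coeffExt_preLieMul [CharZero k] [DirectSum.Decomposition gr] (h e : Cochain k 𝔤)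
    {w : ℕ → 𝔤} (hw : ∀ i, w i ∈ gr (-1)) (n m : ℕ) :
    (n ! : k)⁻¹ • coeffExt (preLieMul gr h e) n w m = ∑ p ∈ antidiagonal n,
      ((p.1 ! : k)⁻¹ * (p.2 ! : k)⁻¹) • coeffExtCons h p.2 (coeffExt e p.1 w) w m := by
  have h1 : coeffExt (preLieMul gr h e) n w m = ∑ S : Finset (Fin n),
      coeffExtCons h (n - S.card) (coeffExt e S.card w) w m := by
    rw [coeffExt, sum_congr rfl fun i _ => preLieMul_apply_of_mem gr h e
      (x := fun j => w (i j)) fun _ => hw _, sum_comm]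
    refine sum_congr rfl fun S _ => ?_
    rw [sum_insertAt_eq_coeffExtCons, card_compl, Fintype.card_fin]
  rw [h1, ← powerset_univ, sum_powerset_apply_card
    (fun a => coeffExtCons h (n - a) (coeffExt e a w) w m), card_univ, Fintype.card_fin,
    Nat.sum_antidiagonal_eq_sum_range_succ_mk, smul_sum]
  refine sum_congr rfl fun a ha => ?_
  rw [mem_range] at ha
  rw [← Nat.cast_smul_eq_nsmul k, smul_smul]
  congr 1
  rw [Nat.cast_choose k (by omega : a ≤ n)]
  have h1 : (n ! : k) ≠ 0 := by exact_mod_cast n.factorial_ne_zero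
  have h2 : (a ! : k) ≠ 0 := by exact_mod_cast a.factorial_ne_zero
  have h3 : ((n - a)! : k) ≠ 0 := by exact_mod_cast (n - a).factorial_ne_zero
  field_simp

end Ext

/-! ### The flow of an even cochain -/

section Trunc

variable {k : Type*} [Field k] {𝔤 : Type*} [AddCommGroup 𝔤] [Module k 𝔤]

/-- The truncated sum `∑_{n < N} h_n(x, …, x) / n!`. -/
def truncEval (N : ℕ) (h : Cochain k 𝔤) (x : 𝔤) : 𝔤 :=
  ∑ n ∈ range N, (n ! : k)⁻¹ • h n fun _ => x

/-- The coefficient of `s^m` in `∑_{n < N} h_n(w, …, w) / n!` for a power series `w`. -/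
def truncExt (N : ℕ) (h : Cochain k 𝔤) (w : ℕ → 𝔤) (m : ℕ) : 𝔤 :=
  ∑ n ∈ range N, (n ! : k)⁻¹ • coeffExt h n w m

/-- The coefficient of `s^m` in the directional derivative `∑_{n < N} h_{n+1}(v, w, …, w) / n!` for
power series `v` and `w`. -/
def truncExtCons (N : ℕ) (h : Cochain k 𝔤) (v w : ℕ → 𝔤) (m : ℕ) : 𝔤 :=
  ∑ n ∈ range N, (n ! : k)⁻¹ • coeffExtCons h n v w m

theorem truncExt_zero_right (N : ℕ) (h : Cochain k 𝔤) (w : ℕ → 𝔤) :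
    truncExt N h w 0 = truncEval N h (w 0) := by
  simp only [truncExt, truncEval, coeffExt_zero_right]

theorem coeffExtCons_sub (h : Cochain k 𝔤) (n : ℕ) (v v' w : ℕ → 𝔤) (m : ℕ) :
    coeffExtCons h n (v - v') w m = coeffExtCons h n v w m - coeffExtCons h n v' w m := by
  simp only [coeffExtCons, Pi.sub_apply, map_sub, _root_.sub_apply, sum_sub_distrib]

theorem coeffExtCons_smul (h : Cochain k 𝔤) (n : ℕ) (c : k) (v w : ℕ → 𝔤) (m : ℕ) :
    coeffExtCons h n (c • v) w m = c • coeffExtCons h n v w m := by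
  simp only [coeffExtCons, Pi.smul_apply, map_smul, _root_.smul_apply, smul_sum]

theorem coeffExtCons_sum {ι : Type*} (s : Finset ι) (h : Cochain k 𝔤) (n : ℕ) (v : ι → ℕ → 𝔤)
    (w : ℕ → 𝔤) (m : ℕ) :
    coeffExtCons h n (∑ i ∈ s, v i) w m = ∑ i ∈ s, coeffExtCons h n (v i) w m := by
  simp only [coeffExtCons, Finset.sum_apply, map_sum, _root_.sum_apply]
  rw [sum_congr rfl fun p _ => sum_comm, sum_comm]

/-- If `v_0 = 0`, a factor `s` can be extracted from the series `v`. -/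
theorem coeffExtCons_succ (h : Cochain k 𝔤) (n : ℕ) {v : ℕ → 𝔤} (hv : v 0 = 0) (w : ℕ → 𝔤)
    (m : ℕ) : coeffExtCons h n v w (m + 1) = coeffExtCons h n (fun c => v (c + 1)) w m := by
  rw [coeffExtCons, Nat.sum_antidiagonal_succ]
  simp only [hv, map_zero, _root_.zero_apply, sum_const_zero, zero_add]
  rfl

end Trunc

namespace CompleteDGLie

variable {k : Type*} [Field k] {𝔤 : Type*} [AddCommGroup 𝔤] [Module k 𝔤]
  {gr : ℤ → Submodule k 𝔤} {L : CompleteDGLie k gr}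

theorem IsEvenCochain.coeffExt_mem {i : ℤ} {e : Cochain k 𝔤} (he : L.IsEvenCochain i e)
    {w : ℕ → 𝔤} (hw : ∀ i, w i ∈ gr (-1)) (n m : ℕ) : coeffExt e n w m ∈ gr i :=
  sum_mem fun _ _ => he.mem fun _ => hw _

theorem IsEvenCochain.coeffExt_mem_F {i : ℤ} {e : Cochain k 𝔤} (he : L.IsEvenCochain i e)
    {w : ℕ → 𝔤} (hw : ∀ i, w i ∈ gr (-1)) (hw1 : ∀ i, w i ∈ L.F 1) (n m : ℕ) :
    coeffExt e n w m ∈ L.F n :=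
  sum_mem fun _ _ => by
    simpa using he.filtered (p := fun _ : Fin n => 1) (fun _ => hw _) fun _ => hw1 _

theorem IsTailCochain.coeffExtCons_mem_F {i j : ℤ} {h : Cochain k 𝔤} (hh : L.IsTailCochain i j h)
    {v w : ℕ → 𝔤} (hw : ∀ i, w i ∈ gr (-1)) (hw1 : ∀ i, w i ∈ L.F 1) {m q : ℕ}
    (hv : ∀ c ≤ m, v c ∈ gr i) (hvq : ∀ c ≤ m, v c ∈ L.F q) (n : ℕ) :
    coeffExtCons h n v w m ∈ L.F (q + n) :=
  sum_mem fun p hp => sum_mem fun _ _ => by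
    have hp' : p.1 ≤ m := by
      rw [HasAntidiagonal.mem_antidiagonal] at hp; omega
    simpa using hh.filtered (p := fun _ : Fin n => 1) (hv _ hp') (fun _ => hw _) (hvq _ hp')
      fun _ => hw1 _

theorem IsEvenCochain.truncExt_mem {i : ℤ} {e : Cochain k 𝔤} (he : L.IsEvenCochain i e)
    {w : ℕ → 𝔤} (hw : ∀ i, w i ∈ gr (-1)) (N m : ℕ) : truncExt N e w m ∈ gr i :=
  sum_mem fun _ _ => (gr i).smul_mem _ (he.coeffExt_mem hw _ _)

/-- The directional derivative depends on the direction modulo `F N` only. -/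
theorem IsTailCochain.truncExtCons_congr {i j : ℤ} {h : Cochain k 𝔤} (hh : L.IsTailCochain i j h)
    {v v' w : ℕ → 𝔤} (hw : ∀ i, w i ∈ gr (-1)) (hw1 : ∀ i, w i ∈ L.F 1) {m N : ℕ}
    (hv : ∀ c ≤ m, v c ∈ gr i) (hv' : ∀ c ≤ m, v' c ∈ gr i)
    (hvv : ∀ c ≤ m, v c ≡ v' c [SMOD L.F N]) :
    truncExtCons N h v w m ≡ truncExtCons N h v' w m [SMOD L.F N] := by
  refine SModEq.sum fun n _ => SModEq.smul ?_ _
  rw [SModEq.sub_mem, ← coeffExtCons_sub]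
  exact L.F_antitone (Nat.le_add_right N n) <| hh.coeffExtCons_mem_F hw hw1
    (fun c hc => sub_mem (hv c hc) (hv' c hc)) (fun c hc => SModEq.sub_mem.1 (hvv c hc)) n

variable [CharZero k]

/-- The pre-Lie product as a directional derivative, in terms of truncated sums. -/
theorem truncExt_preLieMul [DirectSum.Decomposition gr] {i j : ℤ} {h e : Cochain k 𝔤}
    (hh : L.IsTailCochain i j h) (he : L.IsEvenCochain i e) {w : ℕ → 𝔤}
    (hw : ∀ i, w i ∈ gr (-1)) (hw1 : ∀ i, w i ∈ L.F 1) (N m : ℕ) :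
    truncExt N (preLieMul gr h e) w m ≡ truncExtCons N h (truncExt N e w) w m [SMOD L.F N] := by
  set G : ℕ → ℕ → 𝔤 := fun a c =>
    ((a ! : k)⁻¹ * (c ! : k)⁻¹) • coeffExtCons h c (coeffExt e a w) w m with hG
  have hGF : ∀ a c, N ≤ a + c → G a c ∈ L.F N := fun a c hac =>
    L.F_antitone hac <| (L.F _).smul_mem _ <| hh.coeffExtCons_mem_F hw hw1
      (fun _ _ => he.coeffExt_mem hw _ _) (fun _ _ => he.coeffExt_mem_F hw hw1 _ _) c
  have h1 : truncExt N (preLieMul gr h e) w m = ∑ a ∈ range N, ∑ c ∈ range (N - a), G a c := by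
    rw [truncExt, ← sum_range_diag_flip N G]
    refine sum_congr rfl fun n _ => ?_
    rw [coeffExt_preLieMul h e hw, Nat.sum_antidiagonal_eq_sum_range_succ G]
  have h2 : truncExtCons N h (truncExt N e w) w m = ∑ a ∈ range N, ∑ c ∈ range N, G a c := by
    rw [truncExtCons, sum_comm]
    refine sum_congr rfl fun c _ => ?_
    have : truncExt N e w = ∑ a ∈ range N, (a ! : k)⁻¹ • coeffExt e a w := by
      funext m
      simp only [truncExt, Finset.sum_apply, Pi.smul_apply]
    rw [this, coeffExtCons_sum, smul_sum]
    refine sum_congr rfl fun a _ => ?_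
    rw [coeffExtCons_smul, smul_smul, hG, mul_comm]
  rw [h1, h2]
  refine SModEq.sum fun a ha => ?_
  rw [mem_range] at ha
  rw [SModEq.comm, SModEq.sub_mem, ← sum_sdiff (range_subset_range.2 (Nat.sub_le N a)),
    add_sub_cancel_right]
  refine sum_mem fun c hc => hGF a c ?_
  simp only [mem_sdiff, mem_range] at hc
  omega

/-- The chain rule for the derivation `s d/ds`. -/
theorem natCast_smul_truncExt {j : ℤ} {h : Cochain k 𝔤} (hh : L.IsEvenCochain j h)
    {w : ℕ → 𝔤} (hw : ∀ i, w i ∈ gr (-1)) (hw1 : ∀ i, w i ∈ L.F 1) (N m : ℕ) :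
    (m : k) • truncExt N h w m ≡
      truncExtCons N h (fun c => (c : k) • w c) w m [SMOD L.F N] := by
  rcases N with _ | N
  · rw [L.F_zero]; exact SModEq.top
  have h0 : (m : k) • (((0 ! : ℕ) : k)⁻¹ • coeffExt h 0 w m) = 0 := by
    rcases m with _ | m
    · simp
    · simp [coeffExt, Nat.antidiagonalTuple_zero_succ]
  rw [truncExt, smul_sum, sum_range_succ', h0, add_zero, truncExtCons, sum_range_succ]
  rw [← add_zero (∑ n ∈ range N, _)]
  refine SModEq.add (congrArg _ ?_) (SModEq.zero.2 ?_).symm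
  · refine sum_congr rfl fun n _ => ?_
    rw [smul_comm, natCast_smul_coeffExt hh.symm hw, smul_smul]
    congr 1
    have h1 : (n ! : k) ≠ 0 := by exact_mod_cast n.factorial_ne_zero
    have h2 : (n : k) + 1 ≠ 0 := by exact_mod_cast n.succ_ne_zero
    rw [Nat.factorial_succ]
    push_cast
    field_simp
  · refine (L.F _).smul_mem _ ?_
    rw [add_comm]
    exact hh.isTailCochain.coeffExtCons_mem_F hw hw1 (fun _ _ => (gr _).smul_mem _ (hw _))
      (fun _ _ => (L.F 1).smul_mem _ (hw1 _)) N

/-- If the coefficients of `b = ∑ b_c s^c` are given by the right multiplications with `e`, that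
is, if `b` is an integral curve of the vector field `e`, then evaluation at `b` is given by
`exp (s r_e)`. -/
theorem truncExt_flow [DirectSum.Decomposition gr] {e : Cochain k 𝔤} (he : L.IsEvenCochain (-1) e)
    {b : ℕ → 𝔤} (hb : ∀ i, b i ∈ gr (-1)) (hb1 : ∀ i, b i ∈ L.F 1) {N : ℕ}
    (hbe : ∀ c : ℕ, ((c : k) + 1) • b (c + 1) ≡
      (c ! : k)⁻¹ • truncEval N (rightMul gr e c e) (b 0) [SMOD L.F N])
    (m : ℕ) {j : ℤ} {h : Cochain k 𝔤} (hh : L.IsEvenCochain j h) :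
    truncExt N h b m ≡ (m ! : k)⁻¹ • truncEval N (rightMul gr e m h) (b 0) [SMOD L.F N] := by
  induction m using Nat.strong_induction_on generalizing j h with
  | _ m ih =>
    rcases m with _ | m
    · rw [truncExt_zero_right, Nat.factorial_zero, Nat.cast_one, inv_one, one_smul]
      rfl
    have hm : ((m + 1 : ℕ) : k) ≠ 0 := by exact_mod_cast m.succ_ne_zero
    have h1 := natCast_smul_truncExt hh hb hb1 N (m + 1)
    have h2 : truncExtCons N h (fun c => (c : k) • b c) b (m + 1) =
        truncExtCons N h (fun c => ((c + 1 : ℕ) : k) • b (c + 1)) b m :=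
      sum_congr rfl fun n _ => by rw [coeffExtCons_succ h n (by simp)]
    have h3 : truncExtCons N h (fun c => ((c + 1 : ℕ) : k) • b (c + 1)) b m ≡
        truncExtCons N h (truncExt N e b) b m [SMOD L.F N] := by
      refine hh.isTailCochain.truncExtCons_congr hb hb1 (fun _ _ => (gr _).smul_mem _ (hb _))
        (fun _ _ => he.truncExt_mem hb _ _) fun c hc => ?_
      rw [Nat.cast_add_one]
      exact (hbe c).trans (ih c (by omega) he).symm
    have h4 := truncExt_preLieMul hh.isTailCochain he hb hb1 N m
    have h5 := ih m (by omega) (hh.preLieMul he)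
    rw [h2] at h1
    have h6 := ((h1.trans h3).trans (h4.symm.trans h5)).smul ((m + 1 : ℕ) : k)⁻¹
    rw [smul_smul, inv_mul_cancel₀ hm, one_smul, smul_smul] at h6
    rw [Nat.factorial_succ, Nat.cast_mul, mul_inv]
    exact h6

end CompleteDGLie

/-! ### The curvature along the flow -/

namespace CompleteDGLie

variable {k : Type*} [Field k] {𝔤 : Type*} [AddCommGroup 𝔤] [Module k 𝔤]
  {gr : ℤ → Submodule k 𝔤} (L : CompleteDGLie k gr)

/-- The coefficients of `-d g + [g, b] = [g, δ + b]` for power series `g` and `b`. -/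
def gaugeField (g b : ℕ → 𝔤) (m : ℕ) : 𝔤 :=
  -L.d (g m) + ∑ p ∈ antidiagonal m, L.bracket (g p.1) (b p.2)

/-- The coefficients of the curvature `d b + ½ [b, b]` of a power series `b`. -/
def curvature (b : ℕ → 𝔤) (m : ℕ) : 𝔤 :=
  L.d (b m) + (2 : k)⁻¹ • ∑ p ∈ antidiagonal m, L.bracket (b p.1) (b p.2)

theorem mem_F_zero (x : 𝔤) : x ∈ L.F 0 := L.F_zero ▸ Submodule.mem_top

theorem d_congr {N : ℕ} {x y : 𝔤} (h : x ≡ y [SMOD L.F N]) : L.d x ≡ L.d y [SMOD L.F N] := by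
  rw [SModEq.sub_mem] at h ⊢
  rw [← map_sub]
  exact L.d_F h

theorem bracket_congr_left {N : ℕ} {x y : 𝔤} (h : x ≡ y [SMOD L.F N]) (z : 𝔤) :
    L.bracket x z ≡ L.bracket y z [SMOD L.F N] := by
  rw [SModEq.sub_mem] at h ⊢
  rw [← LinearMap.map_sub₂]
  simpa using L.bracket_F h (L.mem_F_zero z)

theorem bracket_congr_right {N : ℕ} {x y : 𝔤} (h : x ≡ y [SMOD L.F N]) (z : 𝔤) :
    L.bracket z x ≡ L.bracket z y [SMOD L.F N] := by
  rw [SModEq.sub_mem] at h ⊢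
  rw [← map_sub]
  simpa using L.bracket_F (L.mem_F_zero z) h

theorem gaugeField_congr {N : ℕ} {g g' b : ℕ → 𝔤} (h : ∀ a, g a ≡ g' a [SMOD L.F N]) (m : ℕ) :
    L.gaugeField g b m ≡ L.gaugeField g' b m [SMOD L.F N] :=
  (L.d_congr (h m)).neg.add <| SModEq.sum fun p _ => L.bracket_congr_left (h p.1) _

variable {L}

theorem curvature_mem {b : ℕ → 𝔤} (hb : ∀ a, b a ∈ gr (-1)) (m : ℕ) : L.curvature b m ∈ gr (-2) :=
  add_mem (L.d_mem_of_mem (hb m) rfl) <| (gr _).smul_mem _ <| sum_mem fun p _ =>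
    L.bracket_mem_of_mem (hb p.1) (hb p.2) rfl

variable [CharZero k]

/-- The Bianchi identity `d v + [v, b] = [g, d b + ½ [b, b]]` for `v = -d g + [g, b]`. -/
theorem bracket_curvature {g b : ℕ → 𝔤} (hg : ∀ a, g a ∈ gr 0) (hb : ∀ a, b a ∈ gr (-1)) (m : ℕ) :
    L.d (L.gaugeField g b m) + ∑ p ∈ antidiagonal m, L.bracket (L.gaugeField g b p.1) (b p.2) =
      ∑ p ∈ antidiagonal m, L.bracket (g p.1) (L.curvature b p.2) := by
  have h1 : L.d (L.gaugeField g b m) = ∑ p ∈ antidiagonal m,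
      (L.bracket (L.d (g p.1)) (b p.2) + L.bracket (g p.1) (L.d (b p.2))) := by
    rw [gaugeField, map_add, map_neg, L.d_d, neg_zero, zero_add, map_sum]
    refine sum_congr rfl fun p _ => ?_
    rw [L.leibniz _ (hg _)]
    simp [sgn]
  have h2 : ∑ p ∈ antidiagonal m, L.bracket (L.gaugeField g b p.1) (b p.2) =
      -∑ p ∈ antidiagonal m, L.bracket (L.d (g p.1)) (b p.2) +
        ∑ p ∈ antidiagonal m, ∑ q ∈ antidiagonal p.2,
          L.bracket (L.bracket (g p.1) (b q.1)) (b q.2) := by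
    rw [← sum_antidiagonal_assoc fun i j l => L.bracket (L.bracket (g i) (b j)) (b l),
      ← sum_neg_distrib, ← sum_add_distrib]
    refine sum_congr rfl fun p _ => ?_
    rw [gaugeField, map_add, map_neg, map_sum, LinearMap.add_apply, LinearMap.neg_apply,
      LinearMap.sum_apply]
  have h3 : ∀ p : ℕ × ℕ, (2 : k)⁻¹ • ∑ q ∈ antidiagonal p.2,
      L.bracket (g p.1) (L.bracket (b q.1) (b q.2)) =
        ∑ q ∈ antidiagonal p.2, L.bracket (L.bracket (g p.1) (b q.1)) (b q.2) := by
    intro p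
    have e : ∑ q ∈ antidiagonal p.2, L.bracket (b q.1) (L.bracket (g p.1) (b q.2)) =
        ∑ q ∈ antidiagonal p.2, L.bracket (L.bracket (g p.1) (b q.1)) (b q.2) := by
      rw [← Nat.sum_antidiagonal_swap]
      refine sum_congr rfl fun q _ => ?_
      exact L.bracket_comm_of_mem (hb _) (L.bracket_mem_of_mem (hg _) (hb _) rfl)
    have e2 : ∑ q ∈ antidiagonal p.2, L.bracket (g p.1) (L.bracket (b q.1) (b q.2)) =
        (2 : k) • ∑ q ∈ antidiagonal p.2, L.bracket (L.bracket (g p.1) (b q.1)) (b q.2) := by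
      rw [two_smul]
      nth_rewrite 2 [← e]
      rw [← sum_add_distrib]
      refine sum_congr rfl fun q _ => ?_
      rw [L.jacobi _ (hg _) (hb _)]
      simp [sgn]
    rw [e2, smul_smul, inv_mul_cancel₀ two_ne_zero, one_smul]
  rw [h1, h2, sum_add_distrib, ← sum_congr rfl fun p _ => h3 p]
  simp only [curvature, map_add, map_smul, map_sum, sum_add_distrib]
  abel

/-- The derivative of the curvature is the covariant derivative `d b' + [b', b]`. -/
theorem natCast_smul_curvature {b : ℕ → 𝔤} (hb : ∀ a, b a ∈ gr (-1)) (m : ℕ) :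
    ((m : k) + 1) • L.curvature b (m + 1) = L.d (((m : k) + 1) • b (m + 1)) +
      ∑ p ∈ antidiagonal m, L.bracket (((p.1 : k) + 1) • b (p.1 + 1)) (b p.2) := by
  set S := ∑ p ∈ antidiagonal (m + 1), (p.1 : k) • L.bracket (b p.1) (b p.2) with hS
  have h1 : ∑ p ∈ antidiagonal (m + 1), (p.2 : k) • L.bracket (b p.1) (b p.2) = S := by
    rw [hS, ← Nat.sum_antidiagonal_swap]
    refine sum_congr rfl fun p _ => ?_
    rw [Prod.fst_swap, Prod.snd_swap, L.bracket_comm_of_mem (hb _) (hb _)]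
  have h2 : ((m : k) + 1) • ∑ p ∈ antidiagonal (m + 1), L.bracket (b p.1) (b p.2) =
      (2 : k) • S := by
    conv_rhs =>
      rw [two_smul]
      arg 2
      rw [← h1]
    rw [hS, ← sum_add_distrib, smul_sum]
    refine sum_congr rfl fun p hp => ?_
    rw [← add_smul, ← Nat.cast_add, HasAntidiagonal.mem_antidiagonal.1 hp]
    push_cast
    rfl
  have h3 : S = ∑ p ∈ antidiagonal m, L.bracket (((p.1 : k) + 1) • b (p.1 + 1)) (b p.2) := by
    rw [hS, Nat.sum_antidiagonal_succ]
    simp only [Nat.cast_zero, zero_smul, zero_add, Nat.cast_add, Nat.cast_one, map_smul,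
      LinearMap.smul_apply]
  rw [curvature, smul_add, smul_comm, h2, smul_smul, inv_mul_cancel₀ two_ne_zero, one_smul, h3,
    map_smul]

variable [DirectSum.Decomposition gr]

/-- The vector field of `d_{s𝔤} + φ` is minus the curvature. -/
theorem truncExt_totalDiff {b : ℕ → 𝔤} (hb : ∀ a, b a ∈ gr (-1)) {N : ℕ} (hN : 3 ≤ N) (m : ℕ) :
    truncExt N L.totalDiff b m = -L.curvature b m := by
  obtain ⟨N, rfl⟩ := Nat.exists_eq_add_of_le' hN
  have hz : ∀ n, coeffExt L.totalDiff (n + 3) b m = 0 := fun n => by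
    simp [coeffExt, totalDiff_add_three]
  have h0 : coeffExt L.totalDiff 0 b m = 0 := by
    simp [coeffExt, totalDiff_zero]
  have h1 : coeffExt L.totalDiff 1 b m = -L.d (b m) := by
    rw [coeffExt, Nat.antidiagonalTuple_one, sum_singleton, totalDiff_one]
    rfl
  have h2 : coeffExt L.totalDiff 2 b m = -∑ p ∈ antidiagonal m, L.bracket (b p.1) (b p.2) := by
    rw [coeffExt, Nat.antidiagonalTuple_two, sum_map, ← sum_neg_distrib]
    refine sum_congr rfl fun p _ => ?_
    rw [L.totalDiff_two_of_mem (hb _)]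
    rfl
  rw [truncExt, sum_range_succ', sum_range_succ', sum_range_succ',
    sum_eq_zero fun n _ => by rw [hz, smul_zero]]
  rw [zero_add, zero_add, one_add_one_eq_two, h0, h1, h2, curvature]
  simp only [Nat.factorial, Nat.cast_one, Nat.succ_eq_add_one]
  norm_num

omit [CharZero k] in
/-- The derivative of the vector field of `d_{s𝔤} + φ` at `b`, in the direction `g`, is
`[g, δ + b]`. -/
theorem truncExtCons_totalDiff {g b : ℕ → 𝔤} (hg : ∀ a, g a ∈ gr 0) {N : ℕ} (hN : 3 ≤ N) (m : ℕ) :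
    truncExtCons N L.totalDiff g b m = L.gaugeField g b m := by
  obtain ⟨N, rfl⟩ : ∃ M, N = M + 2 := ⟨N - 2, by omega⟩
  have hz : ∀ n, coeffExtCons L.totalDiff (n + 2) g b m = 0 := fun n => by
    simp [coeffExtCons, totalDiff_add_three]
  have h0 : coeffExtCons L.totalDiff 0 g b m = -L.d (g m) := by
    rw [coeffExtCons, sum_eq_single (m, 0)]
    · simp [Nat.antidiagonalTuple_zero_zero, totalDiff_one]
    · rintro ⟨p, q⟩ hp hne
      rw [HasAntidiagonal.mem_antidiagonal] at hp
      rcases q with _ | q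
      · exact absurd (by simpa using hp) hne
      · rw [Nat.antidiagonalTuple_zero_succ, sum_empty]
    · simp
  have h1 : coeffExtCons L.totalDiff 1 g b m =
      ∑ p ∈ antidiagonal m, L.bracket (g p.1) (b p.2) := by
    rw [coeffExtCons]
    refine sum_congr rfl fun p _ => ?_
    rw [Nat.antidiagonalTuple_one, sum_singleton, MultilinearMap.curryLeft_apply,
      L.totalDiff_two_cons (hg _)]
    rfl
  rw [truncExtCons, sum_range_succ', sum_range_succ', sum_eq_zero fun n _ => by rw [hz, smul_zero]]
  rw [zero_add, zero_add, h0, h1, gaugeField]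
  simp [add_comm]

section Flow

variable {f : Cochain k 𝔤} (hf : L.IsCochain 1 f) {b g : ℕ → 𝔤} (hb : ∀ i, b i ∈ gr (-1))
  (hb1 : ∀ i, b i ∈ L.F 1) (hg : ∀ a, g a ∈ gr 0) {N : ℕ} (hN : 3 ≤ N)
  (hbe : ∀ c : ℕ, ((c : k) + 1) • b (c + 1) ≡
    (c ! : k)⁻¹ • truncEval N (rightMul gr (L.twistedDiff 1 f) c (L.twistedDiff 1 f)) (b 0)
      [SMOD L.F N])
  (hge : ∀ a : ℕ, g a ≡ (a ! : k)⁻¹ • truncEval N (rightMul gr (L.twistedDiff 1 f) a f) (b 0)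
    [SMOD L.F N])

include hf hb hb1 hg hN hbe hge

omit hg in
/-- The velocity of the flow of `∂^φ f` is the gauge field of `f(b)`, up to the derivative of `f`
in the direction of the curvature. -/
theorem smul_flow_eq_sub (m : ℕ) : ((m : k) + 1) • b (m + 1) ≡
    L.gaugeField g b m - truncExtCons N f (L.curvature b) b m [SMOD L.F N] := by
  set l := L.twistedDiff 1 f with hl
  have hle : L.IsEvenCochain (-1) l := L.isEvenCochain_twistedDiff hf
  have h1 : truncExt N l b m ≡ ((m : k) + 1) • b (m + 1) [SMOD L.F N] :=
    (truncExt_flow hle hb hb1 hbe m hle).trans (hbe m).symm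
  have h2 : truncExt N l b m =
      truncExt N (preLieMul gr L.totalDiff f) b m +
        truncExt N (preLieMul gr f L.totalDiff) b m := by
    simp only [truncExt, coeffExt]
    rw [← sum_add_distrib]
    refine sum_congr rfl fun n _ => ?_
    rw [← smul_add, ← sum_add_distrib]
    congr 1
    exact sum_congr rfl fun i _ => L.twistedDiff_one_apply f fun _ => hb _
  have hgt : ∀ a, truncExt N f b a ≡ g a [SMOD L.F N] := fun a =>
    (truncExt_flow hle hb hb1 hbe a hf.isEvenCochain).trans (hge a).symm
  have h3 : truncExt N (preLieMul gr L.totalDiff f) b m ≡ L.gaugeField g b m [SMOD L.F N] := by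
    refine (truncExt_preLieMul L.isTailCochain_totalDiff hf.isEvenCochain hb hb1 N m).trans ?_
    rw [truncExtCons_totalDiff (fun a => hf.isEvenCochain.truncExt_mem hb _ _) hN]
    exact L.gaugeField_congr hgt m
  have h4 : truncExt N (preLieMul gr f L.totalDiff) b m ≡
      -truncExtCons N f (L.curvature b) b m [SMOD L.F N] := by
    refine (truncExt_preLieMul hf.isTailCochain L.isEvenCochain_totalDiff hb hb1 N m).trans ?_
    have e : truncExt N L.totalDiff b = (-1 : k) • L.curvature b := by
      funext a
      rw [truncExt_totalDiff hb hN, Pi.smul_apply, neg_one_smul]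
    rw [e]
    refine congrArg _ ?_
    simp only [truncExtCons, coeffExtCons_smul]
    rw [← sum_neg_distrib]
    exact sum_congr rfl fun n _ => by rw [neg_one_smul, smul_neg]
  rw [sub_eq_add_neg]
  refine h1.symm.trans ?_
  rw [h2]
  exact h3.add h4

/-- The curvature vanishes along the flow if it vanishes initially. -/
theorem curvature_flow (h0 : L.curvature b 0 ≡ 0 [SMOD L.F N]) (m : ℕ) :
    L.curvature b m ≡ 0 [SMOD L.F N] := by
  induction m using Nat.strong_induction_on with
  | _ m ih =>
    rcases m with _ | m
    · exact h0
    have h1 : ∀ c ≤ m, ((c : k) + 1) • b (c + 1) ≡ L.gaugeField g b c [SMOD L.F N] := by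
      intro c hc
      have h := smul_flow_eq_sub hf hb hb1 hN hbe hge c
      have hz : truncExtCons N f (L.curvature b) b c ≡ 0 [SMOD L.F N] := by
        have := hf.isTailCochain.truncExtCons_congr (v' := 0) (N := N) hb hb1 (m := c)
          (fun a _ => curvature_mem hb a) (fun _ _ => zero_mem _) fun a ha => ih a (by omega)
        refine this.trans (congrArg _ ?_)
        simp [truncExtCons, coeffExtCons]
      simpa using h.trans (SModEq.rfl.sub hz)
    have h2 : ((m : k) + 1) • L.curvature b (m + 1) ≡ 0 [SMOD L.F N] := by
      rw [natCast_smul_curvature hb]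
      have e : L.d (((m : k) + 1) • b (m + 1)) +
          ∑ p ∈ antidiagonal m, L.bracket (((p.1 : k) + 1) • b (p.1 + 1)) (b p.2) ≡
          L.d (L.gaugeField g b m) +
            ∑ p ∈ antidiagonal m, L.bracket (L.gaugeField g b p.1) (b p.2) [SMOD L.F N] := by
        refine (L.d_congr (h1 m le_rfl)).add (SModEq.sum fun p hp => L.bracket_congr_left
          (h1 p.1 ?_) _)
        rw [HasAntidiagonal.mem_antidiagonal] at hp
        omega
      refine e.trans ?_
      rw [bracket_curvature hg hb, ← sum_const_zero (s := antidiagonal m)]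
      refine SModEq.sum fun p hp => ?_
      rw [← map_zero (L.bracket (g p.1))]
      refine L.bracket_congr_right (ih p.2 ?_) _
      rw [HasAntidiagonal.mem_antidiagonal] at hp
      omega
    have h3 := h2.smul ((m : k) + 1)⁻¹
    rwa [smul_smul, inv_mul_cancel₀ (by exact_mod_cast m.succ_ne_zero), one_smul, smul_zero] at h3

/-- If the curvature vanishes initially, the flow satisfies `b' = [g, δ + b]`. -/
theorem smul_flow_eq (h0 : L.curvature b 0 ≡ 0 [SMOD L.F N]) (m : ℕ) :
    ((m : k) + 1) • b (m + 1) ≡ L.gaugeField g b m [SMOD L.F N] := by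
  have h := smul_flow_eq_sub hf hb hb1 hN hbe hge m
  have hz : truncExtCons N f (L.curvature b) b m ≡ 0 [SMOD L.F N] := by
    have := hf.isTailCochain.truncExtCons_congr (v' := 0) (N := N) hb hb1 (m := m)
      (fun a _ => curvature_mem hb a) (fun _ _ => zero_mem _)
      fun a _ => curvature_flow hf hb hb1 hg hN hbe hge h0 a
    refine this.trans (congrArg _ ?_)
    simp [truncExtCons, coeffExtCons]
  simpa using h.trans (SModEq.rfl.sub hz)

end Flow

end CompleteDGLie

/-! ### Convergence -/

section Converge

variable {k V ι : Type*} [Field k] [AddCommGroup V] [Module k V] {F : ℕ → Submodule k V}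
  {u : ι → V} {a a' : V}

theorem HasFSum.smodEq_sum (h : HasFSum F u a) {p : ℕ} {T : Finset ι} (hT : ∀ i ∉ T, u i ∈ F p) :
    a ≡ ∑ i ∈ T, u i [SMOD F p] := by
  classical
  obtain ⟨s, hs⟩ := Filter.eventually_atTop.1 (h p)
  rw [SModEq.sub_mem]
  have h1 := hs (s ∪ T) subset_union_left
  have h2 : ∑ i ∈ (s ∪ T) \ T, u i ∈ F p := sum_mem fun i hi => hT i (mem_sdiff.1 hi).2
  have := add_mem h1 h2
  rwa [← sum_sdiff (subset_union_right : T ⊆ s ∪ T), sub_add_eq_sub_sub, sub_add_eq_add_sub,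
    sub_add_cancel] at this

theorem HasFSum.mem (h : HasFSum F u a) {p : ℕ} (hu : ∀ i, u i ∈ F p) : a ∈ F p := by
  have := h.smodEq_sum (p := p) (T := ∅) fun i _ => hu i
  rwa [sum_empty, SModEq.zero] at this

theorem HasFSum.unique (hF : ∀ x, (∀ p, x ∈ F p) → x = 0) (h : HasFSum F u a)
    (h' : HasFSum F u a') : a = a' := by
  refine sub_eq_zero.1 (hF _ fun p => ?_)
  obtain ⟨s, hs, hs'⟩ := ((h p).and (h' p)).exists
  simpa using sub_mem hs hs'

theorem HasFSum.hasFSum_fsum (h : HasFSum F u a) : HasFSum F u (fsum F u) := by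
  have he : ∃ a, HasFSum F u a := ⟨a, h⟩
  rw [fsum, dif_pos he]
  exact he.choose_spec

theorem HasFSum.fsum_eq (hF : ∀ x, (∀ p, x ∈ F p) → x = 0) (h : HasFSum F u a) :
    fsum F u = a :=
  h.hasFSum_fsum.unique hF h

end Converge

namespace CompleteDGLie

variable {k : Type*} [Field k] {𝔤 : Type*} [AddCommGroup 𝔤] [Module k 𝔤]
  {gr : ℤ → Submodule k 𝔤} (L : CompleteDGLie k gr)

/-- A family of homogeneous elements converges if only finitely many of them have a weight below any
given bound. -/
theorem exists_hasFSum {ι : Type*} {u : ι → 𝔤} {i : ℤ} (hu : ∀ t, u t ∈ gr i) (wt : ι → ℕ)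
    (hwt : ∀ t, u t ∈ L.F (wt t)) (hfin : ∀ p, {t | wt t < p}.Finite) :
    ∃ a ∈ gr i, HasFSum L.F u a := by
  classical
  set T : ℕ → Finset ι := fun p => (hfin p).toFinset with hT
  have hmem : ∀ {t p}, t ∈ T p ↔ wt t < p := by simp [hT]
  have hTm : Monotone T := fun p q hpq t ht => hmem.2 ((hmem.1 ht).trans_le hpq)
  have hd : ∀ p, ∀ s, T p ⊆ s → ∑ t ∈ s, u t - ∑ t ∈ T p, u t ∈ L.F p := fun p s hs => by
    rw [← sum_sdiff hs, add_sub_cancel_right]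
    refine sum_mem fun t ht => L.F_antitone ?_ (hwt t)
    have := (mem_sdiff.1 ht).2
    rw [hmem] at this
    omega
  obtain ⟨y, hy, hyx⟩ := L.complete i (fun p => ∑ t ∈ T p, u t) (fun p => sum_mem fun t _ => hu t)
    fun p => hd p _ (hTm (Nat.le_succ p))
  refine ⟨y, hy, fun p => Filter.eventually_atTop.2 ⟨T p, fun s hs => ?_⟩⟩
  have := sub_mem (hyx p) (hd p s hs)
  simpa using this

theorem hasFSum_fsum {ι : Type*} {u : ι → 𝔤} {i : ℤ} (hu : ∀ t, u t ∈ gr i) (wt : ι → ℕ)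
    (hwt : ∀ t, u t ∈ L.F (wt t)) (hfin : ∀ p, {t | wt t < p}.Finite) :
    HasFSum L.F u (fsum L.F u) :=
  (L.exists_hasFSum hu wt hwt hfin).elim fun _ h => h.2.hasFSum_fsum

theorem fsum_mem {ι : Type*} {u : ι → 𝔤} {i : ℤ} (hu : ∀ t, u t ∈ gr i) (wt : ι → ℕ)
    (hwt : ∀ t, u t ∈ L.F (wt t)) (hfin : ∀ p, {t | wt t < p}.Finite) :
    fsum L.F u ∈ gr i := by
  obtain ⟨a, ha, h⟩ := L.exists_hasFSum hu wt hwt hfin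
  rwa [h.fsum_eq L.separated]

theorem eq_of_forall_smodEq {x y : 𝔤} (N₀ : ℕ) (h : ∀ N, N₀ ≤ N → x ≡ y [SMOD L.F N]) :
    x = y := by
  refine sub_eq_zero.1 (L.separated _ fun p => ?_)
  exact L.F_antitone (le_max_left p N₀) (SModEq.sub_mem.1 (h _ (le_max_right p N₀)))

variable {L}

theorem IsEvenCochain.smul {j : ℤ} {h : Cochain k 𝔤} (hh : L.IsEvenCochain j h) (c : k) :
    L.IsEvenCochain j (c • h) where
  symm n x hx σ := by
    rw [Pi.smul_apply, _root_.smul_apply, _root_.smul_apply, hh.symm hx]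
  mem n x hx := (gr j).smul_mem c (hh.mem hx)
  filtered n p x hx hp := (L.F _).smul_mem c (hh.filtered hx hp)

section EvalExp

variable {j : ℤ} {h : Cochain k 𝔤} (hh : L.IsEvenCochain j h) {α : 𝔤} (hα : α ∈ gr (-1))
  (hα1 : α ∈ L.F 1)

include hh hα

theorem IsEvenCochain.term_mem (n : ℕ) : (n ! : k)⁻¹ • h n (fun _ => α) ∈ gr j :=
  (gr j).smul_mem _ (hh.mem fun _ => hα)

include hα1

theorem IsEvenCochain.term_mem_F (n : ℕ) : (n ! : k)⁻¹ • h n (fun _ => α) ∈ L.F n :=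
  (L.F n).smul_mem _ <| by
    simpa using hh.filtered (p := fun _ : Fin n => 1) (fun _ => hα) fun _ => hα1

theorem IsEvenCochain.hasFSum_evalExp :
    HasFSum L.F (fun n : ℕ => (n ! : k)⁻¹ • h n fun _ => α) (L.evalExp h α) :=
  L.hasFSum_fsum (hh.term_mem hα) id (hh.term_mem_F hα hα1) Set.finite_lt_nat

theorem IsEvenCochain.evalExp_mem : L.evalExp h α ∈ gr j :=
  L.fsum_mem (hh.term_mem hα) id (hh.term_mem_F hα hα1) Set.finite_lt_nat

theorem IsEvenCochain.evalExp_smodEq (N : ℕ) :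
    L.evalExp h α ≡ truncEval N h α [SMOD L.F N] :=
  (hh.hasFSum_evalExp hα hα1).smodEq_sum fun n hn =>
    L.F_antitone (by simpa using hn) (hh.term_mem_F hα hα1 n)

theorem IsEvenCochain.evalExp_mem_F {p : ℕ} (hp : VanishesBelow gr p h) :
    L.evalExp h α ∈ L.F p :=
  (hh.hasFSum_evalExp hα hα1).mem fun n => by
    rcases lt_or_ge n p with hn | hn
    · rw [hp (fun _ => hα) hn, smul_zero]
      exact zero_mem _
    · exact L.F_antitone hn (hh.term_mem_F hα hα1 n)

end EvalExp

end CompleteDGLie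

/-! ### The ambient action as the endpoint of a flow -/

namespace CompleteDGLie

variable {k : Type*} [Field k] {𝔤 : Type*} [AddCommGroup 𝔤] [Module k 𝔤]
  {gr : ℤ → Submodule k 𝔤} (L : CompleteDGLie k gr) [DirectSum.Decomposition gr]

/-- The coefficients of the power series `∑_m b_m s^m` that represents the flow of `l` with initial
value `α`. -/
def flowSeq (l : Cochain k 𝔤) (α : 𝔤) : ℕ → 𝔤
  | 0 => α
  | c + 1 => L.evalExp (((c + 1)! : k)⁻¹ • rightMul gr l c l) α

/-- The elements `f_i`, with indices starting from `0`. -/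
def weightSeq (l f : Cochain k 𝔤) (α : 𝔤) (a : ℕ) : 𝔤 := L.weightComp l f α a.succPNat

omit [DirectSum.Decomposition gr] in
theorem ofLinear_id_apply_mem {n : ℕ} {x : Fin n → 𝔤} (hx : ∀ i, x i ∈ gr (-1)) :
    ofLinear (LinearMap.id : 𝔤 →ₗ[k] 𝔤) n x ∈ gr (-1) := by
  rcases n with _ | _ | n
  · exact zero_mem _
  · exact hx 0
  · exact zero_mem _

omit [DirectSum.Decomposition gr] in
theorem truncEval_smul (N : ℕ) (c : k) (h : Cochain k 𝔤) (x : 𝔤) :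
    truncEval N (c • h) x = c • truncEval N h x := by
  simp only [truncEval, Pi.smul_apply, _root_.smul_apply, smul_sum]
  exact sum_congr rfl fun n _ => smul_comm _ _ _

variable {L}

section

variable {f : Cochain k 𝔤} (hf : L.IsCochain 1 f)

include hf

theorem isEvenCochain_weightCochain (i : ℕ+) :
    L.IsEvenCochain 0 (weightCochain (gr := gr) (L.twistedDiff 1 f) f i) :=
  (hf.isEvenCochain.rightMul (L.isEvenCochain_twistedDiff hf) _).smul _

theorem vanishesBelow_weightCochain (a : ℕ) :
    VanishesBelow gr (a + 2) (weightCochain (gr := gr) (L.twistedDiff 1 f) f a.succPNat) := by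
  intro n x hx hn
  have := VanishesBelow.rightMul (p := 1) (q := 1) hf.vanishesBelow
    (L.vanishesBelow_twistedDiff hf) (L.isEvenCochain_twistedDiff hf).mem a hx (by omega)
  rw [weightCochain, Nat.succPNat_coe, Nat.succ_sub_one, Pi.smul_apply, _root_.smul_apply, this,
    smul_zero]

theorem vanishesBelow_rightMul (c : ℕ) :
    VanishesBelow gr (c + 2) (rightMul gr (L.twistedDiff 1 f) c (L.twistedDiff 1 f)) := by
  intro n x hx hn
  exact VanishesBelow.rightMul (p := 1) (q := 1) (L.vanishesBelow_twistedDiff hf)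
    (L.vanishesBelow_twistedDiff hf) (L.isEvenCochain_twistedDiff hf).mem c hx (by omega)

theorem isEvenCochain_rightMul (c : ℕ) :
    L.IsEvenCochain (-1) (rightMul gr (L.twistedDiff 1 f) c (L.twistedDiff 1 f)) :=
  (L.isEvenCochain_twistedDiff hf).rightMul (L.isEvenCochain_twistedDiff hf) _

theorem preLieExp_apply_of_mem {n : ℕ} {x : Fin n → 𝔤} (hx : ∀ i, x i ∈ gr (-1)) {N : ℕ}
    (hn : n ≤ N + 1) :
    preLieExp gr (L.twistedDiff 1 f) n x = ofLinear (LinearMap.id : 𝔤 →ₗ[k] 𝔤) n x + ∑ c ∈ range N,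
      ((c + 1)! : k)⁻¹ • rightMul gr (L.twistedDiff 1 f) c (L.twistedDiff 1 f) n x := by
  rw [preLieExp, _root_.add_apply, _root_.sum_apply]
  congr 1
  have h1 : ∑ i ∈ Ico 1 n, ((i ! : k)⁻¹ • rightMul gr (L.twistedDiff 1 f) (i - 1)
      (L.twistedDiff 1 f) n) x = ∑ i ∈ Ico 1 (N + 1), (i ! : k)⁻¹ •
        rightMul gr (L.twistedDiff 1 f) (i - 1) (L.twistedDiff 1 f) n x := by
    refine sum_subset (Ico_subset_Ico_right hn) fun i hi hin => ?_
    rw [mem_Ico] at hi hin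
    exact (congrArg _ (vanishesBelow_rightMul hf (i - 1) hx (by omega))).trans (smul_zero _)
  rw [h1, sum_Ico_eq_sum_range]
  refine sum_congr (by simp) fun c _ => ?_
  rw [add_comm 1 c, Nat.add_sub_cancel]

variable {α : 𝔤} (hα : α ∈ gr (-1)) (hα1 : α ∈ L.F 1)

include hα hα1

theorem flowSeq_mem (m : ℕ) : L.flowSeq (L.twistedDiff 1 f) α m ∈ gr (-1) := by
  rcases m with _ | c
  · exact hα
  · exact ((isEvenCochain_rightMul hf c).smul _).evalExp_mem hα hα1

theorem flowSeq_mem_F (m : ℕ) : L.flowSeq (L.twistedDiff 1 f) α m ∈ L.F (m + 1) := by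
  rcases m with _ | c
  · exact hα1
  · refine ((isEvenCochain_rightMul hf c).smul _).evalExp_mem_F hα hα1 fun n x hx hn => ?_
    rw [Pi.smul_apply, _root_.smul_apply, vanishesBelow_rightMul hf c hx hn, smul_zero]

theorem flowSeq_mem_F_one (m : ℕ) : L.flowSeq (L.twistedDiff 1 f) α m ∈ L.F 1 :=
  L.F_antitone (Nat.le_add_left 1 m) (flowSeq_mem_F hf hα hα1 m)

theorem weightSeq_mem (a : ℕ) : L.weightSeq (L.twistedDiff 1 f) f α a ∈ gr 0 :=
  (isEvenCochain_weightCochain hf _).evalExp_mem hα hα1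

theorem weightSeq_mem_F (a : ℕ) : L.weightSeq (L.twistedDiff 1 f) f α a ∈ L.F (a + 2) :=
  (isEvenCochain_weightCochain hf _).evalExp_mem_F hα hα1 (vanishesBelow_weightCochain hf a)

theorem flowSeq_succ_smodEq (N c : ℕ) : L.flowSeq (L.twistedDiff 1 f) α (c + 1) ≡
    ((c + 1)! : k)⁻¹ • truncEval N (rightMul gr (L.twistedDiff 1 f) c (L.twistedDiff 1 f)) α
      [SMOD L.F N] := by
  rw [← truncEval_smul]
  exact ((isEvenCochain_rightMul hf c).smul _).evalExp_smodEq hα hα1 N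

theorem weightSeq_smodEq (N a : ℕ) : L.weightSeq (L.twistedDiff 1 f) f α a ≡
    (a ! : k)⁻¹ • truncEval N (rightMul gr (L.twistedDiff 1 f) a f) α [SMOD L.F N] := by
  rw [← truncEval_smul]
  exact (isEvenCochain_weightCochain hf _).evalExp_smodEq hα hα1 N

theorem smul_flowSeq_smodEq [CharZero k] (N c : ℕ) :
    ((c : k) + 1) • L.flowSeq (L.twistedDiff 1 f) α (c + 1) ≡
    (c ! : k)⁻¹ • truncEval N (rightMul gr (L.twistedDiff 1 f) c (L.twistedDiff 1 f)) α
      [SMOD L.F N] := by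
  have h := (flowSeq_succ_smodEq hf hα hα1 N c).smul ((c : k) + 1)
  rwa [smul_smul, Nat.factorial_succ, Nat.cast_mul, mul_inv, Nat.cast_add_one,
    mul_inv_cancel_left₀ (by exact_mod_cast c.succ_ne_zero)] at h

omit hα1 in
theorem preLieExp_term_mem (n : ℕ) :
    (n ! : k)⁻¹ • preLieExp gr (L.twistedDiff 1 f) n (fun _ => α) ∈ gr (-1) := by
  rw [preLieExp_apply_of_mem hf (fun _ => hα) (Nat.le_succ n)]
  exact (gr _).smul_mem _ <| add_mem (ofLinear_id_apply_mem fun _ => hα) <| sum_mem fun c _ =>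
    (gr _).smul_mem _ <| (isEvenCochain_rightMul hf c).mem fun _ => hα

theorem preLieExp_term_mem_F (n : ℕ) :
    (n ! : k)⁻¹ • preLieExp gr (L.twistedDiff 1 f) n (fun _ => α) ∈ L.F n := by
  rw [preLieExp_apply_of_mem hf (fun _ => hα) (Nat.le_succ n)]
  refine (L.F n).smul_mem _ <| add_mem ?_ <| sum_mem fun c _ => (L.F n).smul_mem _ <| by
    simpa using (isEvenCochain_rightMul hf c).filtered (p := fun _ : Fin n => 1) (fun _ => hα)
      fun _ => hα1
  rcases n with _ | _ | n
  · exact zero_mem _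
  · exact hα1
  · exact zero_mem _

theorem hasFSum_ambient :
    HasFSum L.F (fun n : ℕ => (n ! : k)⁻¹ • preLieExp gr (L.twistedDiff 1 f) n fun _ => α)
      (L.ambient (L.twistedDiff 1 f) α) :=
  L.hasFSum_fsum (preLieExp_term_mem hf hα) id (preLieExp_term_mem_F hf hα hα1) Set.finite_lt_nat

theorem ambient_mem :
    L.ambient (L.twistedDiff 1 f) α ∈ gr (-1) :=
  L.fsum_mem (preLieExp_term_mem hf hα) id (preLieExp_term_mem_F hf hα hα1) Set.finite_lt_nat

/-- The ambient action is the value at `1` of the flow. -/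
theorem ambient_smodEq {N : ℕ} (hN : 2 ≤ N) :
    L.ambient (L.twistedDiff 1 f) α ≡
      ∑ m ∈ range N, L.flowSeq (L.twistedDiff 1 f) α m [SMOD L.F N] := by
  have h1 := (hasFSum_ambient hf hα hα1).smodEq_sum (p := N) (T := range N) fun n hn =>
    L.F_antitone (by simpa using hn) (preLieExp_term_mem_F hf hα hα1 n)
  refine h1.trans ?_
  obtain ⟨M, rfl⟩ : ∃ M, N = M + 2 := ⟨N - 2, by omega⟩
  have h2 : ∑ n ∈ range (M + 2),
      (n ! : k)⁻¹ • preLieExp gr (L.twistedDiff 1 f) n (fun _ => α) =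
      (∑ n ∈ range (M + 2), (n ! : k)⁻¹ • ofLinear (LinearMap.id : 𝔤 →ₗ[k] 𝔤) n fun _ => α) +
        ∑ c ∈ range (M + 1), ((c + 1)! : k)⁻¹ • truncEval (M + 2)
          (rightMul gr (L.twistedDiff 1 f) c (L.twistedDiff 1 f)) α := by
    simp only [truncEval, smul_sum]
    rw [sum_comm, ← sum_add_distrib]
    refine sum_congr rfl fun n hn => ?_
    rw [mem_range] at hn
    rw [preLieExp_apply_of_mem hf (fun _ => hα) (N := M + 1) (by omega), smul_add, smul_sum]
    congr 1
    exact sum_congr rfl fun c _ => smul_comm _ _ _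
  have h3 : (∑ n ∈ range (M + 2), (n ! : k)⁻¹ • ofLinear (LinearMap.id : 𝔤 →ₗ[k] 𝔤) n
      fun _ => α) = α := by
    rw [sum_eq_single 1]
    · simp [ofLinear]
    · intro n _ hn
      rcases n with _ | _ | n
      · simp [ofLinear]
      · exact absurd rfl hn
      · simp [ofLinear]
    · simp
  rw [h2, h3, sum_range_succ' (fun m => L.flowSeq (L.twistedDiff 1 f) α m) (M + 1), add_comm α]
  exact (SModEq.sum fun c _ => (flowSeq_succ_smodEq hf hα hα1 (M + 2) c).symm).add rfl

end

variable [CharZero k] {f : Cochain k 𝔤} (hf : L.IsCochain 1 f) {α : 𝔤} (hα : L.IsMaurerCartan α)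

include hf hα

omit [CharZero k] hf in
theorem curvature_flowSeq_zero (l : Cochain k 𝔤) : L.curvature (L.flowSeq l α) 0 = 0 := by
  rw [← hα.2.2]
  simp [curvature, flowSeq]

theorem curvature_flowSeq (m : ℕ) : L.curvature (L.flowSeq (L.twistedDiff 1 f) α) m = 0 :=
  L.eq_of_forall_smodEq 3 fun N hN =>
    curvature_flow hf (flowSeq_mem hf hα.1 hα.2.1) (flowSeq_mem_F_one hf hα.1 hα.2.1)
      (weightSeq_mem hf hα.1 hα.2.1) hN (smul_flowSeq_smodEq hf hα.1 hα.2.1 N)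
      (weightSeq_smodEq hf hα.1 hα.2.1 N) (by rw [curvature_flowSeq_zero hα]) m

theorem smul_flowSeq (m : ℕ) : ((m : k) + 1) • L.flowSeq (L.twistedDiff 1 f) α (m + 1) =
    L.gaugeField (L.weightSeq (L.twistedDiff 1 f) f α) (L.flowSeq (L.twistedDiff 1 f) α) m :=
  L.eq_of_forall_smodEq 3 fun N hN =>
    smul_flow_eq hf (flowSeq_mem hf hα.1 hα.2.1) (flowSeq_mem_F_one hf hα.1 hα.2.1)
      (weightSeq_mem hf hα.1 hα.2.1) hN (smul_flowSeq_smodEq hf hα.1 hα.2.1 N)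
      (weightSeq_smodEq hf hα.1 hα.2.1 N) (by rw [curvature_flowSeq_zero hα]) m

/-- The value `b(1)` has curvature zero, since the series `b` has curvature zero. -/
theorem isMaurerCartan_ambient : L.IsMaurerCartan (L.ambient (L.twistedDiff 1 f) α) := by
  refine ⟨ambient_mem hf hα.1 hα.2.1, ?_, ?_⟩
  · have h := (ambient_smodEq hf hα.1 hα.2.1 le_rfl).mono (L.F_antitone one_le_two)
    have h2 := sum_mem fun m (_ : m ∈ range 2) => flowSeq_mem_F_one hf hα.1 hα.2.1 m
    simpa using add_mem (SModEq.sub_mem.1 h) h2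
  · refine L.eq_of_forall_smodEq 2 fun N hN => ?_
    set b := L.flowSeq (L.twistedDiff 1 f) α with hb
    have h := ambient_smodEq hf hα.1 hα.2.1 hN
    set β := L.ambient (L.twistedDiff 1 f) α
    have h1 := (L.d_congr h).add (((L.bracket_congr_left h β).trans
      (L.bracket_congr_right h _)).smul (2 : k)⁻¹)
    refine h1.trans ?_
    have h2 : ∑ m ∈ range N, L.curvature b m = 0 :=
      sum_eq_zero fun m _ => curvature_flowSeq hf hα m
    have h3 : ∑ m ∈ range N, L.curvature b m = L.d (∑ m ∈ range N, b m) +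
        (2 : k)⁻¹ • ∑ i ∈ range N, ∑ j ∈ range (N - i), L.bracket (b i) (b j) := by
      simp only [curvature]
      rw [sum_add_distrib, map_sum, ← smul_sum,
        ← sum_range_diag_flip N fun i j => L.bracket (b i) (b j)]
      congr 2
      exact sum_congr rfl fun m _ =>
        Nat.sum_antidiagonal_eq_sum_range_succ (fun i j => L.bracket (b i) (b j)) m
    rw [← h2, h3]
    refine SModEq.rfl.add (SModEq.smul ?_ _)
    rw [LinearMap.map_sum₂]
    refine SModEq.sum fun i _ => ?_
    rw [map_sum, SModEq.sub_mem, ← sum_sdiff (range_subset_range.2 (Nat.sub_le N i)),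
      add_sub_cancel_right]
    refine sum_mem fun j hj => ?_
    simp only [mem_sdiff, mem_range] at hj
    exact L.F_antitone (by omega)
      (L.bracket_F (flowSeq_mem_F hf hα.1 hα.2.1 i) (flowSeq_mem_F hf hα.1 hα.2.1 j))

end CompleteDGLie

/-! ### The gauge action on the quotients by the filtration -/

namespace CompleteDGLie

variable {k : Type*} [Field k] {𝔤 : Type*} [AddCommGroup 𝔤] [Module k 𝔤]
  {gr : ℤ → Submodule k 𝔤} (L : CompleteDGLie k gr)

theorem nestedAd_mem {n : ℕ} {y : Fin (n + 1) → 𝔤} (hy : ∀ j, y j ∈ gr 0) :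
    L.nestedAd n y ∈ gr 0 := by
  induction n with
  | zero => exact hy 0
  | succ n ih => exact L.bracket_mem_of_mem (hy _) (ih fun j => hy _) rfl

theorem nestedAd_mem_F {n : ℕ} {y : Fin (n + 1) → 𝔤} {p : Fin (n + 1) → ℕ}
    (hy : ∀ j, y j ∈ L.F (p j)) : L.nestedAd n y ∈ L.F (∑ j, p j) := by
  induction n with
  | zero =>
    rw [Fin.sum_univ_one]
    exact hy 0
  | succ n ih =>
    rw [Fin.sum_univ_castSucc, add_comm]
    exact L.bracket_F (hy _) (ih fun j => hy _)

theorem succ_le_sum_pnat {n : ℕ} (i : Fin (n + 1) → ℕ+) : n + 1 ≤ ∑ j, (i j : ℕ) := by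
  simpa using sum_le_sum fun j (_ : j ∈ univ) => Nat.succ_le_of_lt (i j).pos

theorem le_sum_pnat {n : ℕ} (i : Fin (n + 1) → ℕ+) (j : Fin (n + 1)) :
    (i j : ℕ) ≤ ∑ j, (i j : ℕ) :=
  single_le_sum (f := fun j => (i j : ℕ)) (fun _ _ => Nat.zero_le _) (mem_univ j)

section GaugeElement

variable {fc : ℕ+ → 𝔤} (hfc : ∀ i, fc i ∈ gr 0) (hfc1 : ∀ i : ℕ+, fc i ∈ L.F i)

theorem finite_setOf_sum_lt (p : ℕ) :
    {t : Σ n : ℕ, Fin (n + 1) → ℕ+ | ∑ j, (t.2 j : ℕ) < p}.Finite := by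
  refine ((range p).sigma fun n => Fintype.piFinset fun _ : Fin (n + 1) =>
    Iic p.succPNat).finite_toSet.subset ?_
  rintro ⟨n, i⟩ hi
  simp only [Set.mem_ofPred_eq] at hi
  have h1 := succ_le_sum_pnat i
  simp only [coe_sigma, Set.mem_sigma_iff, mem_coe, mem_range, Fintype.mem_piFinset, mem_Iic]
  refine ⟨by omega, fun j => ?_⟩
  have h2 := le_sum_pnat i j
  rw [← PNat.coe_le_coe, Nat.succPNat_coe]
  omega

include hfc1 in
theorem gaugeTerm_mem_F (t : Σ n : ℕ, Fin (n + 1) → ℕ+) :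
    L.gaugeTerm fc t ∈ L.F (∑ j, (t.2 j : ℕ)) :=
  (L.F _).smul_mem _ (L.nestedAd_mem_F fun _ => hfc1 _)

include hfc in
theorem gaugeTerm_mem (t : Σ n : ℕ, Fin (n + 1) → ℕ+) : L.gaugeTerm fc t ∈ gr 0 :=
  (gr 0).smul_mem _ (L.nestedAd_mem fun _ => hfc _)

include hfc hfc1

theorem hasFSum_gaugeElement : HasFSum L.F (L.gaugeTerm fc) (L.gaugeElement fc) :=
  L.hasFSum_fsum (L.gaugeTerm_mem hfc) _ (L.gaugeTerm_mem_F hfc1) finite_setOf_sum_lt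

theorem gaugeElement_mem : L.gaugeElement fc ∈ gr 0 :=
  L.fsum_mem (L.gaugeTerm_mem hfc) _ (L.gaugeTerm_mem_F hfc1) finite_setOf_sum_lt

theorem gaugeElement_mem_F : L.gaugeElement fc ∈ L.F 1 :=
  (L.hasFSum_gaugeElement hfc hfc1).mem fun t => L.F_antitone
    ((t.2 0).pos.trans_le (le_sum_pnat t.2 0)) (L.gaugeTerm_mem_F hfc1 t)

/-- Modulo `F N` only the finitely many terms with `n ≤ N` and all `i_j ≤ N` contribute. -/
theorem gaugeElement_smodEq (N : ℕ) :
    L.gaugeElement fc ≡ ∑ n ∈ range N, ∑ y ∈ Fintype.piFinset fun _ : Fin (n + 1) => range N,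
      coeffG k n (fun j => (y j : k) + 1) • L.nestedAd n (fun j => fc (y j).succPNat)
        [SMOD L.F N] := by
  classical
  have h1 := (L.hasFSum_gaugeElement hfc hfc1).smodEq_sum (p := N)
    (T := (range N).sigma fun n => Fintype.piFinset fun _ : Fin (n + 1) =>
      (range N).image Nat.succPNat) ?_
  · refine h1.trans (congrArg _ ?_)
    rw [sum_sigma]
    refine sum_congr rfl fun n _ => ?_
    refine (sum_nbij' (fun y j => (y j).succPNat) (fun i j => (i j : ℕ) - 1) ?_ ?_ ?_ ?_ ?_).symm
    · intro y hy
      rw [Fintype.mem_piFinset] at hy ⊢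
      exact fun j => mem_image_of_mem _ (hy j)
    · intro i hi
      rw [Fintype.mem_piFinset] at hi ⊢
      intro j
      obtain ⟨a, ha, h⟩ := mem_image.1 (hi j)
      rw [← h, Nat.succPNat_coe, Nat.succ_sub_one]
      exact ha
    · intro y _
      funext j
      simp
    · intro i _
      funext j
      apply PNat.eq
      rw [Nat.succPNat_coe, Nat.succ_eq_add_one]
      exact Nat.sub_add_cancel (i j).pos
    · intro y _
      simp [gaugeTerm]
  · rintro ⟨n, i⟩ hi
    refine L.F_antitone ?_ (L.gaugeTerm_mem_F hfc1 ⟨n, i⟩)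
    by_contra hlt
    rw [not_le] at hlt
    apply hi
    simp only at hlt
    rw [mem_sigma, mem_range, Fintype.mem_piFinset]
    have h1 := succ_le_sum_pnat i
    refine ⟨by simp only; omega, fun j => mem_image.2 ⟨(i j : ℕ) - 1, ?_, ?_⟩⟩
    · have h2 := le_sum_pnat i j
      have h3 := (i j).pos
      rw [mem_range]
      omega
    · apply PNat.eq
      rw [Nat.succPNat_coe, Nat.succ_eq_add_one]
      exact Nat.sub_add_cancel (i j).pos

end GaugeElement

/-- The filtration of `𝔤 ⊕ k δ` for which `δ` is in the zeroth but not in the first step. -/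
def extFil (q : ℕ) : Submodule k (𝔤 × k) := (L.F q).prod (if q = 0 then ⊤ else ⊥)

theorem extFil_zero : L.extFil 0 = ⊤ := by
  rw [extFil, L.F_zero, if_pos rfl, Submodule.prod_top]

theorem extFil_succ (q : ℕ) : L.extFil (q + 1) = L.extF (q + 1) := by
  rw [extFil, if_neg (Nat.succ_ne_zero q), extF]

theorem extFil_antitone : Antitone L.extFil := by
  intro p q hpq
  refine Submodule.prod_mono (L.F_antitone hpq) ?_
  split_ifs with h1 h2
  · exact le_rfl
  · omega
  · exact bot_le
  · exact le_rfl

variable [DirectSum.Decomposition gr]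

theorem extBracket_apply (x : 𝔤) (v : 𝔤 × k) :
    L.extBracket (x, 0) v = (L.bracket x v.1 - v.2 • L.d (parityInv gr x), 0) := by
  simp [extBracket]

theorem extBracket_apply_of_mem {x : 𝔤} (hx : x ∈ gr 0) (v : 𝔤 × k) :
    L.extBracket (x, 0) v = (L.bracket x v.1 - v.2 • L.d x, 0) := by
  rw [extBracket_apply, parityInv_of_mem gr hx]
  simp [sgn]

theorem extBracket_mem_extF {x : 𝔤} {p q : ℕ} (hx : x ∈ L.F p) {v : 𝔤 × k} (hv : v ∈ L.extF q) :
    L.extBracket (x, 0) v ∈ L.extF (p + q) := by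
  obtain ⟨h1, h2⟩ := hv
  rw [extBracket_apply]
  rw [SetLike.mem_coe, Submodule.mem_bot] at h2
  exact ⟨by simpa [h2] using L.bracket_F hx h1, rfl⟩

theorem extBracket_mem_extFil {x : 𝔤} {p q : ℕ} (hx0 : x ∈ gr 0) (hx : x ∈ L.F (p + 1))
    {v : 𝔤 × k} (hv : v ∈ L.extFil q) : L.extBracket (x, 0) v ∈ L.extFil (q + (p + 1)) := by
  rcases q with _ | q
  · rw [zero_add, extFil_succ, L.extBracket_apply_of_mem hx0]
    refine ⟨sub_mem ?_ ((L.F _).smul_mem _ (L.d_F hx)), rfl⟩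
    simpa using L.bracket_F hx (L.mem_F_zero v.1)
  · rw [extFil_succ] at hv
    rw [← add_assoc, extFil_succ, show q + 1 + p + 1 = p + 1 + (q + 1) by omega]
    exact L.extBracket_mem_extF hx hv

/-- The operator `ad_x` on the quotient of `𝔤 ⊕ k δ` by `F N`. -/
def adQuot (N : ℕ) : 𝔤 →ₗ[k] Module.End k ((𝔤 × k) ⧸ L.extF N) where
  toFun x := (L.extF N).mapQ (L.extF N) (L.extBracket (x, 0)) fun v hv => by
    simpa using L.extBracket_mem_extF (L.mem_F_zero x) hv
  map_add' x y := Submodule.linearMap_qext _ <| LinearMap.ext fun v => congrArg (L.extF N).mkQ <| by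
    beta_reduce
    rw [← LinearMap.add_apply, ← map_add, Prod.mk_add_mk, add_zero]
  map_smul' c x := Submodule.linearMap_qext _ <| LinearMap.ext fun v =>
    congrArg (L.extF N).mkQ <| by
      beta_reduce
      rw [RingHom.id_apply, ← LinearMap.smul_apply, ← map_smul, Prod.smul_mk, smul_zero]

theorem adQuot_mk (N : ℕ) (x : 𝔤) (v : 𝔤 × k) :
    L.adQuot N x ((L.extF N).mkQ v) = (L.extF N).mkQ (L.extBracket (x, 0) v) := rfl

end CompleteDGLie

/-! ### The exponential of the gauge element -/

namespace CompleteDGLie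

variable {k : Type*} [Field k] {𝔤 : Type*} [AddCommGroup 𝔤] [Module k 𝔤]
  {gr : ℤ → Submodule k 𝔤} (L : CompleteDGLie k gr)

/-- The operators on the quotient of `𝔤 ⊕ k δ` by `F N` that raise the filtration by `p`. -/
def shiftFil (N p : ℕ) : Submodule k (Module.End k ((𝔤 × k) ⧸ L.extF N)) where
  carrier := {T | ∀ q, ∀ z ∈ (L.extFil q).map (L.extF N).mkQ,
    T z ∈ (L.extFil (q + p)).map (L.extF N).mkQ}
  add_mem' hS hT q z hz := add_mem (hS q z hz) (hT q z hz)
  zero_mem' _ _ _ := zero_mem _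
  smul_mem' c _ hT q z hz := Submodule.smul_mem _ c (hT q z hz)

theorem isAlgFiltration_shiftFil (N : ℕ) : IsAlgFiltration (L.shiftFil N) where
  one_mem _ _ hz := hz
  mul_mem {p q S T} hS hT r z hz := by
    have := hS _ _ (hT r z hz)
    rwa [add_assoc, add_comm q p] at this
  antitone _ _ hpq _ hT r z hz :=
    Submodule.map_mono (L.extFil_antitone (Nat.add_le_add_left hpq r)) (hT r z hz)

theorem shiftFil_eq_bot {N : ℕ} (hN : 0 < N) : L.shiftFil N N = ⊥ := by
  rw [eq_bot_iff]
  intro T hT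
  obtain ⟨M, rfl⟩ : ∃ M, N = M + 1 := ⟨N - 1, by omega⟩
  rw [Submodule.mem_bot]
  refine LinearMap.ext fun z => ?_
  have h := hT 0 z (by
    rw [extFil_zero, Submodule.map_top, Submodule.range_mkQ]
    exact Submodule.mem_top)
  rw [zero_add, extFil_succ] at h
  obtain ⟨v, hv, hv'⟩ := h
  rw [← hv', LinearMap.zero_apply, Submodule.mkQ_apply, Submodule.Quotient.mk_eq_zero]
  exact hv

variable {L} [DirectSum.Decomposition gr]

theorem adQuot_mem_shiftFil (N : ℕ) {x : 𝔤} {p : ℕ} (hx0 : x ∈ gr 0) (hx : x ∈ L.F (p + 1)) :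
    L.adQuot N x ∈ L.shiftFil N (p + 1) := by
  rintro q _ ⟨v, hv, rfl⟩
  exact ⟨_, L.extBracket_mem_extFil hx0 hx hv, rfl⟩

theorem adQuot_eq_zero {N : ℕ} {x : 𝔤} (hx0 : x ∈ gr 0) (hx : x ∈ L.F N) : L.adQuot N x = 0 := by
  refine Submodule.linearMap_qext _ <| LinearMap.ext fun v => ?_
  refine (Submodule.Quotient.mk_eq_zero _).2 ?_
  rw [L.extBracket_apply_of_mem hx0]
  refine ⟨sub_mem ?_ ((L.F _).smul_mem _ (L.d_F hx)), rfl⟩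
  simpa using L.bracket_F hx (L.mem_F_zero v.1)

theorem adQuot_congr {N : ℕ} {x y : 𝔤} (hx : x ∈ gr 0) (hy : y ∈ gr 0)
    (h : x ≡ y [SMOD L.F N]) : L.adQuot N x = L.adQuot N y := by
  rw [← sub_eq_zero, ← map_sub]
  exact adQuot_eq_zero (sub_mem hx hy) (SModEq.sub_mem.1 h)

/-- The adjoint action of elements of degree zero on `𝔤 ⊕ k δ` is a representation. -/
theorem adQuot_bracket (N : ℕ) {x y : 𝔤} (hx : x ∈ gr 0) (hy : y ∈ gr 0) :
    L.adQuot N (L.bracket x y) = ⁅L.adQuot N x, L.adQuot N y⁆ := by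
  refine Submodule.linearMap_qext _ <| LinearMap.ext fun v => ?_
  rw [LinearMap.comp_apply, LinearMap.comp_apply, Ring.lie_def, LinearMap.sub_apply,
    Module.End.mul_apply, Module.End.mul_apply, adQuot_mk, adQuot_mk, adQuot_mk, adQuot_mk,
    adQuot_mk, ← map_sub]
  refine congrArg _ ?_
  rw [L.extBracket_apply_of_mem (L.bracket_mem_of_mem hx hy rfl), L.extBracket_apply_of_mem hx,
    L.extBracket_apply_of_mem hy, L.extBracket_apply_of_mem hx, L.extBracket_apply_of_mem hy]
  refine Prod.ext ?_ (sub_zero _).symm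
  have h1 := L.jacobi v.1 hx hy
  have h2 := L.leibniz y hx
  have h3 := L.antisymm (L.d_mem_of_mem (j := -1) hx rfl) hy
  simp only [sgn, Int.cast_zero, mul_zero, if_true, one_smul] at h1 h2 h3
  simp only [Prod.fst_sub, map_sub, map_smul, zero_smul, sub_zero]
  rw [h1, h2, h3]
  module

/-- The representation maps nested brackets to iterated commutators of operators. -/
theorem adQuot_nestedAd (N : ℕ) {g : ℕ → 𝔤} (hg : ∀ a, g a ∈ gr 0) {n : ℕ} (y : Fin (n + 1) → ℕ) :
    L.adQuot N (L.nestedAd n fun j => g (y j)) =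
      adWord (fun a => L.adQuot N (g a)) (List.ofFn fun j : Fin n => y j.succ)
        (L.adQuot N (g (y 0))) := by
  induction n with
  | zero => rfl
  | succ n ih =>
    rw [nestedAd, adQuot_bracket N (hg _) (L.nestedAd_mem fun _ => hg _),
      ih fun j => y j.castSucc, List.ofFn_succ', List.concat_eq_append, adWord_append]
    rfl

theorem adQuot_pow_mk (N : ℕ) (x : 𝔤) (m : ℕ) (v : 𝔤 × k) :
    (L.adQuot N x ^ m) ((L.extF N).mkQ v) = (L.extF N).mkQ ((L.extBracket (x, 0) ^ m) v) := by
  induction m with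
  | zero => rfl
  | succ m ih =>
    rw [pow_succ', Module.End.mul_apply, ih, adQuot_mk, pow_succ', Module.End.mul_apply]

/-- The operator `ad_x` with `x ∈ F 1` maps `δ` to `F 1` and raises the filtration on `F 1`. -/
theorem extBracket_pow_mem {x : 𝔤} (hx0 : x ∈ gr 0) (hx : x ∈ L.F 1) (m : ℕ) (v : 𝔤 × k) :
    (L.extBracket (x, 0) ^ m) v ∈ L.extFil m := by
  induction m with
  | zero =>
    rw [extFil_zero]
    exact Submodule.mem_top
  | succ m ih =>
    rw [pow_succ', Module.End.mul_apply]
    exact L.extBracket_mem_extFil (p := 0) hx0 hx ih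

variable [CharZero k]

/-- The exponential of `ad_ξ` maps `δ + b_0` to `δ + ∑ b_m`, for a solution `b` of
`b' = [g, δ + b]`. -/
theorem expSum_adQuot_gaugeElement {fc : ℕ+ → 𝔤} (hfc : ∀ i, fc i ∈ gr 0)
    (hfc1 : ∀ i : ℕ+, fc i ∈ L.F i) {b : ℕ → 𝔤} (hbF : ∀ m, b m ∈ L.F m)
    (hb : ∀ m : ℕ, ((m : k) + 1) • b (m + 1) = L.gaugeField (fun a => fc a.succPNat) b m)
    {N : ℕ} (hN : 0 < N) :
    expSum k (2 * N) (L.adQuot N (L.gaugeElement fc)) ((L.extF N).mkQ (b 0, 1)) =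
      (L.extF N).mkQ (∑ m ∈ range N, b m, 1) := by
  set g : ℕ → 𝔤 := fun a => fc a.succPNat with hg
  have hg0 : ∀ a, g a ∈ gr 0 := fun a => hfc _
  have hg1 : ∀ a, g a ∈ L.F (a + 1) := fun a => hfc1 a.succPNat
  set x : ℕ → Module.End k ((𝔤 × k) ⧸ L.extF N) := fun a => L.adQuot N (g a) with hx
  have hx1 : ∀ a, x a ∈ L.shiftFil N 1 := fun a =>
    adQuot_mem_shiftFil N (p := 0) (hg0 a) (L.F_antitone (Nat.le_add_left _ _) (hg1 a))
  have hξ : L.adQuot N (L.gaugeElement fc) = ∑ n ∈ range N,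
      ∑ y ∈ Fintype.piFinset fun _ : Fin (n + 1) => range N, coeffG k n (fun j => (y j : k) + 1) •
        adWord x (List.ofFn fun j : Fin n => y j.succ) (x (y 0)) := by
    rw [adQuot_congr (L.gaugeElement_mem hfc hfc1) _ (L.gaugeElement_smodEq hfc hfc1 N)]
    · simp only [map_sum, map_smul]
      exact sum_congr rfl fun n _ => sum_congr rfl fun y _ => by rw [← adQuot_nestedAd N hg0 y]
    · exact sum_mem fun n _ => sum_mem fun y _ => (gr 0).smul_mem _ (L.nestedAd_mem fun _ => hfc _)
  -- The coefficients of `δ + b(s)`: the constant element `δ` belongs to the coefficient of `s^0`.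
  set B : ℕ → (𝔤 × k) ⧸ L.extF N := fun m => (L.extF N).mkQ (b m, if m = 0 then 1 else 0) with hB
  have hBK : ∀ m, N ≤ m → B m = 0 := fun m hm => by
    refine (Submodule.Quotient.mk_eq_zero _).2 ⟨L.F_antitone hm (hbF m), ?_⟩
    rw [if_neg (by omega)]
    exact zero_mem _
  have hBB : ∀ m : ℕ, ((m : k) + 1) • B (m + 1) = ∑ p ∈ antidiagonal m, x p.1 • B p.2 := by
    intro m
    have h1 : ∀ p : ℕ × ℕ, x p.1 • B p.2 = (L.extF N).mkQ
        (L.bracket (g p.1) (b p.2) - (if p.2 = 0 then L.d (g p.1) else 0), 0) := fun p => by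
      rw [Module.End.smul_def, hx, hB, adQuot_mk, L.extBracket_apply_of_mem (hg0 _)]
      congr 3
      split_ifs <;> simp
    have h2 : ∑ p ∈ antidiagonal m, (if p.2 = 0 then L.d (g p.1) else 0) = L.d (g m) := by
      rw [sum_eq_single (m, 0)]
      · simp
      · rintro ⟨p, q⟩ hp hne
        rw [HasAntidiagonal.mem_antidiagonal] at hp
        rw [if_neg]
        rintro rfl
        exact hne (by simpa using hp)
      · simp
    rw [sum_congr rfl fun p _ => h1 p, ← map_sum, hB, ← map_smul]
    refine congrArg _ ?_
    rw [if_neg (Nat.succ_ne_zero m), Prod.smul_mk, hb m, smul_zero]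
    refine Prod.ext ?_ ?_
    · rw [Prod.fst_sum, sum_sub_distrib, h2]
      exact (sub_eq_neg_add _ _).symm
    · rw [Prod.snd_sum, sum_const_zero]
  have hmain := timeOrdered_smul_eq_sum (L.isAlgFiltration_shiftFil N) hx1 (L.shiftFil_eq_bot hN)
    hN (fun a ha => adQuot_eq_zero (hg0 a) (L.F_antitone (by omega) (hg1 a))) hBK hBB
  rw [hξ, expSum_coeffG (L.isAlgFiltration_shiftFil N) hx1 (L.shiftFil_eq_bot hN) hN]
  have hB0 : B 0 = (L.extF N).mkQ (b 0, 1) := by rw [hB]; simp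
  have hBs : ∑ m ∈ range N, B m = (L.extF N).mkQ (∑ m ∈ range N, b m, 1) := by
    rw [hB, ← map_sum]
    refine congrArg _ (Prod.ext ?_ ?_)
    · rw [Prod.fst_sum]
    · rw [Prod.snd_sum, sum_ite_eq', if_pos (mem_range.2 hN)]
  rw [← hB0, ← hBs, ← hmain]
  rfl

/-- The exponential series of `ad_ξ` at `δ + b_0` converges to `δ + b(1)`, for a solution `b` of
`b' = [g, δ + b]`. -/
theorem hasFSum_exp_gaugeElement {fc : ℕ+ → 𝔤} (hfc : ∀ i, fc i ∈ gr 0)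
    (hfc1 : ∀ i : ℕ+, fc i ∈ L.F i) {b : ℕ → 𝔤} (hbF : ∀ m, b m ∈ L.F m)
    (hb : ∀ m : ℕ, ((m : k) + 1) • b (m + 1) = L.gaugeField (fun a => fc a.succPNat) b m)
    {β : 𝔤} (hβ : ∀ N, 2 ≤ N → β ≡ ∑ m ∈ range N, b m [SMOD L.F N]) :
    HasFSum L.extF
      (fun m : ℕ => (m ! : k)⁻¹ • ((L.extBracket (L.gaugeElement fc, 0)) ^ m) (b 0, 1)) (β, 1) := by
  intro p
  set N := p + 2 with hN
  refine Filter.eventually_atTop.2 ⟨range (2 * N), fun s hs => ?_⟩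
  have h1 : (β, 1) - ∑ m ∈ range (2 * N),
      (m ! : k)⁻¹ • ((L.extBracket (L.gaugeElement fc, 0)) ^ m) (b 0, 1) ∈ L.extF N := by
    rw [← Submodule.Quotient.mk_eq_zero, ← Submodule.mkQ_apply, map_sub, map_sum]
    have h2 := expSum_adQuot_gaugeElement hfc hfc1 hbF hb (N := N) (by omega)
    rw [expSum, LinearMap.sum_apply] at h2
    simp only [LinearMap.smul_apply, adQuot_pow_mk] at h2
    simp only [map_smul]
    rw [h2, ← map_sub, Submodule.mkQ_apply, Submodule.Quotient.mk_eq_zero]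
    exact ⟨SModEq.sub_mem.1 (hβ N (by omega)), by simp⟩
  have h3 : ∑ m ∈ s \ range (2 * N),
      (m ! : k)⁻¹ • ((L.extBracket (L.gaugeElement fc, 0)) ^ m) (b 0, 1) ∈ L.extF N := by
    refine sum_mem fun m hm => Submodule.smul_mem _ _ ?_
    simp only [mem_sdiff, mem_range] at hm
    have := L.extFil_antitone (by omega : p + 1 + 1 ≤ m) (extBracket_pow_mem
      (L.gaugeElement_mem hfc hfc1) (L.gaugeElement_mem_F hfc hfc1) m (b 0, 1))
    rwa [extFil_succ] at this
  have h4 := sub_mem h1 h3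
  rw [sub_sub, add_comm, sum_sdiff hs] at h4
  exact ⟨L.F_antitone (by omega) h4.1, h4.2⟩

end CompleteDGLie

end AmbientGauge

end

theorem mainTheorem1 {k : Type*} [Field k] [CharZero k] {𝔤 : Type*} [AddCommGroup 𝔤] [Module k 𝔤]
    (gr : ℤ → Submodule k 𝔤) [DirectSum.Decomposition gr]
    (L : AmbientGauge.CompleteDGLie k gr)
    (f l : AmbientGauge.Cochain k 𝔤) (hf : L.IsCochain 1 f) (hl : l = L.twistedDiff 1 f)
    (α : 𝔤) (hα : L.IsMaurerCartan α) :
    -- the series defining `l.α`, the `f_i` and `ξ` converge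
    AmbientGauge.HasFSum L.F
      (fun n : ℕ => (n.factorial : k)⁻¹ • AmbientGauge.preLieExp gr l n fun _ => α)
      (L.ambient l α) ∧
    (∀ i : ℕ+, AmbientGauge.HasFSum L.F
      (fun n : ℕ => (n.factorial : k)⁻¹ •
        AmbientGauge.CompleteDGLie.weightCochain (gr := gr) l f i n fun _ => α)
      (L.weightComp l f α i)) ∧
    AmbientGauge.HasFSum L.F (L.gaugeTerm (L.weightComp l f α))
      (L.gaugeElement (L.weightComp l f α)) ∧
    -- `l.α` is a Maurer--Cartan element and `ξ` an element of degree zero of positive filtration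
    L.IsMaurerCartan (L.ambient l α) ∧
    L.gaugeElement (L.weightComp l f α) ∈ gr 0 ∧
    L.gaugeElement (L.weightComp l f α) ∈ L.F 1 ∧
    -- `exp(ad_ξ)(δ + α) = δ + l.α` in `𝔤 ⊕ k δ`
    AmbientGauge.HasFSum L.extF
      (fun m : ℕ => (m.factorial : k)⁻¹ •
        ((L.extBracket (L.gaugeElement (L.weightComp l f α), 0)) ^ m) (α, 1))
      (L.ambient l α, 1) := by
  subst hl
  have hfc : ∀ i, L.weightComp (L.twistedDiff 1 f) f α i ∈ gr 0 := fun i =>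
    (AmbientGauge.CompleteDGLie.isEvenCochain_weightCochain hf i).evalExp_mem hα.1 hα.2.1
  have hfc1 : ∀ i : ℕ+, L.weightComp (L.twistedDiff 1 f) f α i ∈ L.F i := fun i => by
    have h := AmbientGauge.CompleteDGLie.weightSeq_mem_F hf hα.1 hα.2.1 ((i : ℕ) - 1)
    have hi : ((i : ℕ) - 1).succPNat = i := PNat.eq (Nat.sub_add_cancel i.pos)
    rw [AmbientGauge.CompleteDGLie.weightSeq, hi] at h
    exact L.F_antitone (by omega) h
  refine ⟨AmbientGauge.CompleteDGLie.hasFSum_ambient hf hα.1 hα.2.1, fun i =>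
    (AmbientGauge.CompleteDGLie.isEvenCochain_weightCochain hf i).hasFSum_evalExp hα.1 hα.2.1,
    L.hasFSum_gaugeElement hfc hfc1, AmbientGauge.CompleteDGLie.isMaurerCartan_ambient hf hα,
    L.gaugeElement_mem hfc hfc1, L.gaugeElement_mem_F hfc hfc1, ?_⟩
  exact AmbientGauge.CompleteDGLie.hasFSum_exp_gaugeElement hfc hfc1
    (b := L.flowSeq (L.twistedDiff 1 f) α)
    (fun m => L.F_antitone (Nat.le_succ m)
      (AmbientGauge.CompleteDGLie.flowSeq_mem_F hf hα.1 hα.2.1 m))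
    (AmbientGauge.CompleteDGLie.smul_flowSeq hf hα)
    fun N hN => AmbientGauge.CompleteDGLie.ambient_smodEq hf hα.1 hα.2.1 hN
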